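/- Let $\mathbf k$ be a field and let $\mathcal H_n(0)$ be the $0$-Hecke algebra over $\mathbf k$, with generators $\pi_1,\dots,\pi_{n-1}$ and relations $\pi_i^2=\pi_i$, $\pi_i\pi_{i+1}\pi_i=\pi_{i+1}\pi_i\pi_{i+1}$, $\pi_i\pi_j=\pi_j\pi_i$ for $|i-j|>1$; put $\bar\pi_i=\pi_i-1$. For a composition $\gamma$ let $|\gamma|$ be its size and $\mathrm{Diag}(\gamma)$ its ribbon (rows from bottom to top), and let $\ell(\gamma^\top)$ be the number of columns of $\mathrm{Diag}(\gamma)$. For a sequence $\vec\gamma=(\gamma^{(1)},\dots,\gamma^{(\ell)})$ of compositions of total size $N$, let $\mathbf P_{\vec\gamma}$ be the $\mathcal H_N(0)$-module with basis the standard tableaux of the generalized ribbon with connected components $\mathrm{Diag}(\gamma^{(1)}),\dots,\mathrm{Diag}(\gamma^{(\ell)})$ from southwest to northeast, each component lying in rows strictly above those of the previous one (entries increase from left to right along rows and from top to bottom along columns), where $\bar\pi_i T=-T$ if $i$ is in a higher row of $T$ than $i+1$, $\bar\pi_iT=0$ if they are in the same row, and $\bar\pi_iT=s_i(T)$ (exchange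 $i$ and $i+1$) if $i$ is in a lower row; $\mathbf P_\gamma$ is the case $\ell=1$. Write $\gamma\cdot\delta$ for concatenation and $\gamma\odot\delta$ for near-concatenation of compositions (the last part of $\gamma$ and the first part of $\delta$ are added). For $n=p+q$, an $\mathcal H_p(0)$-module $M$ and an $\mathcal H_q(0)$-module $M'$, let $M\widehat\otimes M'=\mathcal H_n(0)\otimes_{\mathcal H_p(0)\otimes\mathcal H_q(0)}(M\otimes_{\mathbf k}M')$ be the induction product, extended to graded objects and iterated. There is a canonical map $\mathbf P_{\gamma^{(1)}}\widehat\otimes\cdots\widehat\otimes\mathbf P_{\gamma^{(\ell)}}\to\mathbf P_{(\gamma^{(1)},\dots,\gamma^{(\ell)})}$ sending $1\otimes(T_1\otimes\cdots\otimes T_\ell)$ to the juxtaposition of the tableaux $T_j$, the entries of $T_j$ being raised by $|\gamma^{(1)}|+\dots+|\gamma^{(j-1)}|$. Let $\mu_{\gamma,\delta}:\mathbf P_{(\gamma,\delta)}\to\mathbf P_{\gamma\odot\delta}$ send a tableau $T$ to the same filling of $\mathrm{Diag}(\gamma\odot\delta)$ (second component moved down one unit) if it is standard, and to $0$ otherwise.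 Let $A=\bigoplus_{d\ge0}A_d$ with $A_d=\bigoplus_{\gamma:\,\ell(\gamma^\top)=d}\mathbf P_\gamma$, where $\mathbf P_\gamma$ has external degree $|\gamma|$, with multiplication $A_a\widehat\otimes A_b\to A_{a+b}$ given on $\mathbf P_\gamma\widehat\otimes\mathbf P_\delta$ by the canonical map to $\mathbf P_{(\gamma,\delta)}$ followed by $\mu_{\gamma,\delta}$. For a composition $\alpha=(\alpha_1,\dots,\alpha_r)$, $r\ge1$, let $\mathbb S_A^\alpha$ be the kernel of the map $$A_{\alpha_1}\widehat\otimes\cdots\widehat\otimes A_{\alpha_r}\longrightarrow\bigoplus_{i=1}^{r-1}A_{\alpha_1}\widehat\otimes\cdots\widehat\otimes A_{\alpha_i+\alpha_{i+1}}\widehat\otimes\cdots\widehat\otimes A_{\alpha_r}$$ whose $i$th component multiplies the factors $i$ and $i+1$, and let $(\mathbb S_A^\alpha)_{(\bullet,N)}$ be its component of external degree $N$. For $\vec\gamma=(\gamma^{(1)},\dots,\gamma^{(r)})$ let $\mathcal C(\vec\gamma)$ be the cochain complex with terms $\mathcal C_i(\vec\gamma)=\bigoplus_{I\subseteq[r-1],\,|I|=i}\mathbf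 P_{\vec\gamma(I)}$, where $\vec\gamma(I)$ is obtained from $\vec\gamma$ by replacing the $j$th comma by $\odot$ for all $j\in I$, and with differential $T\mapsto\sum_{j\in[r-1]\setminus I}(-1)^{\#\{i\in I\,:\,i<j\}}\phi_j(T)$ for $T\in\mathbf P_{\vec\gamma(I)}$, where $\phi_j$ glues at the $j$th comma by the same rule as $\mu$. In particular $H^0(\mathcal C(\vec\gamma))\subseteq\mathcal C_0(\vec\gamma)=\mathbf P_{\vec\gamma}$ is the kernel of the differential $\mathcal C_0(\vec\gamma)\to\mathcal C_1(\vec\gamma)$. **Proposition.** Let $\alpha=(\alpha_1,\dots,\alpha_r)$, $r\ge 1$, be a composition and $N\ge0$. The canonical map $$\bigl(A_{\alpha_1}\widehat\otimes\cdots\widehat\otimes A_{\alpha_r}\bigr)_{(\bullet,N)}\longrightarrow\bigoplus_{\vec\gamma}\mathbf P_{(\gamma^{(1)},\dots,\gamma^{(r)})}$$ is an isomorphism, and there is an isomorphism of projective $\mathcal H_N(0)$-modules $$(\mathbb S_A^\alpha)_{(\bullet,N)}\;\cong\;\bigoplus_{\vec\gamma}\mathbf P_{\gamma^{(1)}\cdot\gamma^{(2)}\cdots\gamma^{(r)}},$$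 where both sums run over all tuples $\vec\gamma=(\gamma^{(1)},\dots,\gamma^{(r)})$ of compositions with $\ell((\gamma^{(j)})^\top)=\alpha_j$ for all $j$ and $\sum_j|\gamma^{(j)}|=N$, such that, under the first isomorphism, the summand of $(\mathbb S_A^\alpha)_{(\bullet,N)}$ indexed by $\vec\gamma$ is the submodule $H^0(\mathcal C(\vec\gamma))\subseteq\mathbf P_{(\gamma^{(1)},\dots,\gamma^{(r)})}$. All the modules $\mathbf P_{\gamma^{(1)}\cdots\gamma^{(r)}}$ occurring here, and $(\mathbb S_A^\alpha)_{(\bullet,N)}$, are projective. -/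

import Mathlib

universe u

open scoped TensorProduct DirectSum

namespace ZeroHecke

noncomputable section

/-! ## The 0-Hecke algebra -/

/-- Defining relations of the 0-Hecke algebra on `n` letters. Indices are zero-based: the generator
`i` (with `i + 1 < n`) is the usual `π_{i+1}`, which exchanges the letters `i` and `i + 1`. -/
inductive HeckeRel (k : Type u) [Field k] (n : ℕ) :
    FreeAlgebra k {i : ℕ // i + 1 < n} → FreeAlgebra k {i : ℕ // i + 1 < n} → Prop
  | idem (i : {i : ℕ // i + 1 < n}) :
      HeckeRel k n (FreeAlgebra.ι k i * FreeAlgebra.ι k i) (FreeAlgebra.ι k i)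
  | braid (i j : {i : ℕ // i + 1 < n}) (h : j.1 = i.1 + 1) :
      HeckeRel k n (FreeAlgebra.ι k i * FreeAlgebra.ι k j * FreeAlgebra.ι k i)
        (FreeAlgebra.ι k j * FreeAlgebra.ι k i * FreeAlgebra.ι k j)
  | comm (i j : {i : ℕ // i + 1 < n}) (h : i.1 + 1 < j.1) :
      HeckeRel k n (FreeAlgebra.ι k i * FreeAlgebra.ι k j)
        (FreeAlgebra.ι k j * FreeAlgebra.ι k i)

/-- The 0-Hecke algebra `H_n(0)` over the field `k`. -/
def Hecke (k : Type u) [Field k] (n : ℕ) : Type u := RingQuot (HeckeRel k n)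

instance (k : Type u) [Field k] (n : ℕ) : Ring (Hecke k n) :=
  inferInstanceAs (Ring (RingQuot (HeckeRel k n)))

instance (k : Type u) [Field k] (n : ℕ) : Algebra k (Hecke k n) :=
  inferInstanceAs (Algebra k (RingQuot (HeckeRel k n)))

/-- The generator `π_i`. -/
def heckeGen (k : Type u) [Field k] (n : ℕ) (i : {i : ℕ // i + 1 < n}) : Hecke k n :=
  RingQuot.mkAlgHom k (HeckeRel k n) (FreeAlgebra.ι k i)

/-- The element `π̄_i = π_i - 1`. -/
def heckeBar (k : Type u) [Field k] (n : ℕ) (i : {i : ℕ // i + 1 < n}) : Hecke k n :=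
  heckeGen k n i - 1

section HeckeBasics

variable {k : Type u} [Field k] {n : ℕ}

theorem heckeGen_idem (i : {i : ℕ // i + 1 < n}) :
    heckeGen k n i * heckeGen k n i = heckeGen k n i := by
  have h := RingQuot.mkAlgHom_rel k (HeckeRel.idem (k := k) (n := n) i)
  rw [map_mul] at h
  exact h

theorem heckeGen_braid (i j : {i : ℕ // i + 1 < n}) (hij : j.1 = i.1 + 1) :
    heckeGen k n i * heckeGen k n j * heckeGen k n i
      = heckeGen k n j * heckeGen k n i * heckeGen k n j := by
  have h := RingQuot.mkAlgHom_rel k (HeckeRel.braid (k := k) (n := n) i j hij)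
  simp only [map_mul] at h
  exact h

theorem heckeGen_comm (i j : {i : ℕ // i + 1 < n}) (hij : i.1 + 1 < j.1) :
    heckeGen k n i * heckeGen k n j = heckeGen k n j * heckeGen k n i := by
  have h := RingQuot.mkAlgHom_rel k (HeckeRel.comm (k := k) (n := n) i j hij)
  simp only [map_mul] at h
  exact h

/-- The universal property of the presentation. -/
def heckeLift {B : Type*} [Ring B] [Algebra k B] (e : {i : ℕ // i + 1 < n} → B)
    (h1 : ∀ i, e i * e i = e i)
    (h2 : ∀ i j : {i : ℕ // i + 1 < n}, j.1 = i.1 + 1 → e i * e j * e i = e j * e i * e j)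
    (h3 : ∀ i j : {i : ℕ // i + 1 < n}, i.1 + 1 < j.1 → e i * e j = e j * e i) :
    Hecke k n →ₐ[k] B :=
  RingQuot.liftAlgHom k ⟨FreeAlgebra.lift k e, by
    intro x y h
    cases h with
    | idem i => simpa using h1 i
    | braid i j h => simpa using h2 i j h
    | comm i j h => simpa using h3 i j h⟩

theorem heckeLift_gen {B : Type*} [Ring B] [Algebra k B] (e : {i : ℕ // i + 1 < n} → B)
    (h1 : ∀ i, e i * e i = e i)
    (h2 : ∀ i j : {i : ℕ // i + 1 < n}, j.1 = i.1 + 1 → e i * e j * e i = e j * e i * e j)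
    (h3 : ∀ i j : {i : ℕ // i + 1 < n}, i.1 + 1 < j.1 → e i * e j = e j * e i)
    (i : {i : ℕ // i + 1 < n}) : heckeLift e h1 h2 h3 (heckeGen k n i) = e i := by
  have h := RingQuot.liftAlgHom_mkAlgHom_apply k (s := HeckeRel k n) (FreeAlgebra.lift k e)
    (by
      intro x y h
      cases h with
      | idem i => simpa using h1 i
      | braid i j h => simpa using h2 i j h
      | comm i j h => simpa using h3 i j h) (FreeAlgebra.ι k i)
  rw [FreeAlgebra.lift_ι_apply] at h
  exact h

theorem hecke_induction {C : Hecke k n → Prop} (hk : ∀ r : k, C (algebraMap k _ r))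
    (hg : ∀ i, C (heckeBar k n i)) (hadd : ∀ a b, C a → C b → C (a + b))
    (hmul : ∀ a b, C a → C b → C (a * b)) (a : Hecke k n) : C a := by
  obtain ⟨b, rfl⟩ := RingQuot.mkAlgHom_surjective k (HeckeRel k n) a
  induction b using FreeAlgebra.induction with
  | grade0 r => rw [AlgHom.commutes]; exact hk r
  | grade1 i =>
    have h : RingQuot.mkAlgHom k (HeckeRel k n) (FreeAlgebra.ι k i)
        = heckeBar k n i + algebraMap k (Hecke k n) 1 := by
      rw [map_one]
      exact (sub_add_cancel _ _).symm
    rw [h]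
    exact hadd _ _ (hg i) (hk 1)
  | mul a b ha hb => rw [map_mul]; exact hmul _ _ ha hb
  | add a b ha hb => rw [map_add]; exact hadd _ _ ha hb

/-- A `k`-linear map that commutes with all `π̄_i` is `H_n(0)`-linear. -/
def heckeLinear {M M' : Type*} [AddCommGroup M] [Module k M] [Module (Hecke k n) M]
    [IsScalarTower k (Hecke k n) M] [AddCommGroup M'] [Module k M'] [Module (Hecke k n) M']
    [IsScalarTower k (Hecke k n) M'] (f : M →ₗ[k] M')
    (hf : ∀ i x, f (heckeBar k n i • x) = heckeBar k n i • f x) : M →ₗ[Hecke k n] M' :=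
  { f with
    map_smul' := by
      intro a
      change ∀ x, f (a • x) = a • f x
      induction a using hecke_induction with
      | hk r => intro x; simp
      | hg i => exact hf i
      | hadd a b ha hb => intro x; rw [add_smul, map_add, ha, hb, add_smul]
      | hmul a b ha hb => intro x; rw [mul_smul, ha, hb, mul_smul] }

/-- The embedding of `H_m(0)` onto the factor of a parabolic subalgebra of `H_n(0)` that moves the
letters `s, …, s + m - 1`; it sends `π_i` to `π_{s+i}`. -/
def heckeShift {m : ℕ} (s : ℕ) (h : s + m ≤ n) : Hecke k m →ₐ[k] Hecke k n :=
  heckeLift (fun i => heckeGen k n ⟨s + i.1, by have := i.2; omega⟩)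
    (fun _ => heckeGen_idem _)
    (fun _ _ hij => heckeGen_braid _ _ (by simp only [hij]; omega))
    (fun _ _ hij => heckeGen_comm _ _ (by simp only; omega))

theorem heckeShift_bar {m : ℕ} (s : ℕ) (h : s + m ≤ n) (i : {i : ℕ // i + 1 < m}) :
    heckeShift s h (heckeBar k m i) = heckeBar k n ⟨s + i.1, by have := i.2; omega⟩ := by
  rw [heckeBar, map_sub, map_one, heckeShift, heckeLift_gen, heckeBar]

end HeckeBasics

/-! ## Compositions, generalized ribbons and their tableaux -/

/-- A composition: an ordered list of positive integers. -/
abbrev Comp : Type := List ℕ+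

/-- The size `|γ|`. -/
def Comp.size (γ : Comp) : ℕ := (γ.map PNat.val).sum

/-- The number `ℓ(γᵀ)` of columns of the ribbon of `γ`: consecutive rows overlap in exactly one
column. -/
def Comp.numCols : Comp → ℕ
  | [] => 0
  | [a] => a
  | a :: b :: γ => ((a : ℕ) - 1) + Comp.numCols (b :: γ)

/-- Near-concatenation `α ⊙ β`; the empty composition is neutral. -/
def Comp.near : Comp → Comp → Comp
  | [], β => β
  | [a], [] => [a]
  | [a], b :: β => (a + b) :: β
  | a :: a' :: α, β => a :: Comp.near (a' :: α) β

/-- The position of a cell of a generalized ribbon relative to the preceding one, when the cells are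
traversed from southwest to northeast: one unit to the right (same row), one unit up (same column),
or one unit up and one unit to the right (first cell of the next connected component). -/
inductive Step : Type
  | right : Step
  | up : Step
  | diag : Step

/-- The steps out of the successive cells of the ribbon of a composition (rows from bottom to top):
inside a row the step is `right`, out of the last cell of a row it is `up` into the next row, and out
of the last cell of the ribbon it is `diag`, into a possible next component. -/
def Comp.steps : Comp → List Step
  | [] => []
  | a :: γ => List.replicate ((a : ℕ) - 1) Step.right ++
      (if γ = [] then Step.diag else Step.up) :: Comp.steps γ

/-- The step from cell `c` to cell `c + 1` of the generalized ribbon with components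
`γ⁽¹⁾, γ⁽²⁾, …` (from bottom to top). Only the values at `c` with `c + 1` less than the number of
cells matter. -/
def shape (L : List Comp) (c : ℕ) : Step := (L.flatMap Comp.steps).getD c Step.diag

open Classical in
/-- The row (counted from the bottom) of cell `c`. -/
def row (st : ℕ → Step) (c : ℕ) : ℕ := ((Finset.range c).filter (fun q => st q ≠ Step.right)).card

/-- Standardness of a filling `T` of the cells `0, …, N - 1`, where `T c` is the entry of cell `c`:
entries increase along rows from left to right and along columns from top to bottom. -/
def IsStd {N : ℕ} (st : ℕ → Step) (T : Equiv.Perm (Fin N)) : Prop :=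
  ∀ (c : ℕ) (h : c + 1 < N),
    (st c = Step.right → T ⟨c, by omega⟩ < T ⟨c + 1, h⟩) ∧
    (st c = Step.up → T ⟨c + 1, h⟩ < T ⟨c, by omega⟩)

/-- Standard tableaux with `N` cells of the shape given by `st`. -/
abbrev Tab (N : ℕ) (st : ℕ → Step) : Type := {T : Equiv.Perm (Fin N) // IsStd st T}

/-- The vector space with basis the standard tableaux of a generalized ribbon shape. -/
def TabMod (k : Type u) [Field k] (N : ℕ) (st : ℕ → Step) : Type u := Tab N st →₀ k

instance (k : Type u) [Field k] (N : ℕ) (st : ℕ → Step) : AddCommGroup (TabMod k N st) :=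
  inferInstanceAs (AddCommGroup (Tab N st →₀ k))

instance (k : Type u) [Field k] (N : ℕ) (st : ℕ → Step) : Module k (TabMod k N st) :=
  inferInstanceAs (Module k (Tab N st →₀ k))

/-- The basis vector of a standard tableau. -/
def tabVec (k : Type u) [Field k] {N : ℕ} {st : ℕ → Step} (T : Tab N st) : TabMod k N st :=
  (Finsupp.single T (1 : k) : Tab N st →₀ k)

open Classical in
/-- The basis vector of a filling if it is standard, and `0` otherwise. -/
def stdVec (k : Type u) [Field k] {N : ℕ} (st : ℕ → Step) (T : Equiv.Perm (Fin N)) :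
    TabMod k N st :=
  if h : IsStd st T then tabVec k ⟨T, h⟩ else 0

/-- The `k`-linear map with prescribed values on standard tableaux. -/
def tabLift {k : Type u} [Field k] {N : ℕ} {st : ℕ → Step} {M : Type*} [AddCommGroup M]
    [Module k M] (f : Tab N st → M) : TabMod k N st →ₗ[k] M :=
  Finsupp.linearCombination k f

/-- The row of the entry `x` in the filling `T`. -/
def rowOf {N : ℕ} (st : ℕ → Step) (T : Equiv.Perm (Fin N)) (x : Fin N) : ℕ := row st (T.symm x)

/-- The action of `π̄_i` on tableaux: `-T` if `i` is in a higher row than `i + 1`, `0` if they are in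
the same row, and the tableau with `i` and `i + 1` exchanged if `i` is in a lower row. -/
def barOp (k : Type u) [Field k] (N : ℕ) (st : ℕ → Step) (i : {i : ℕ // i + 1 < N}) :
    TabMod k N st →ₗ[k] TabMod k N st :=
  tabLift (fun T =>
    if rowOf st T.1 ⟨i.1 + 1, i.2⟩ < rowOf st T.1 ⟨i.1, by have := i.2; omega⟩ then
      - stdVec k st T.1
    else if rowOf st T.1 ⟨i.1, by have := i.2; omega⟩ = rowOf st T.1 ⟨i.1 + 1, i.2⟩ then 0
    else stdVec k st (Equiv.swap ⟨i.1, by have := i.2; omega⟩ ⟨i.1 + 1, i.2⟩ * T.1))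

section TabBasics

variable {k : Type u} [Field k] {N : ℕ} {st : ℕ → Step}

theorem stdVec_pos {T : Equiv.Perm (Fin N)} (h : IsStd st T) :
    stdVec k st T = tabVec k ⟨T, h⟩ := by
  rw [stdVec, dif_pos h]

theorem stdVec_neg {T : Equiv.Perm (Fin N)} (h : ¬ IsStd st T) : stdVec k st T = 0 := by
  rw [stdVec, dif_neg h]

theorem tabLift_stdVec {M : Type*} [AddCommGroup M] [Module k M] (f : Tab N st → M)
    {T : Equiv.Perm (Fin N)} (h : IsStd st T) : tabLift (k := k) f (stdVec k st T) = f ⟨T, h⟩ := by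
  rw [stdVec_pos h, tabLift]
  exact (Finsupp.linearCombination_single k _ _).trans (one_smul _ _)

theorem tab_hom_ext {M : Type*} [AddCommGroup M] [Module k M] {f g : TabMod k N st →ₗ[k] M}
    (h : ∀ T, IsStd st T → f (stdVec k st T) = g (stdVec k st T)) : f = g := by
  refine Finsupp.lhom_ext' (fun T => LinearMap.ext_ring ?_)
  have := h T.1 T.2
  rw [stdVec_pos T.2] at this
  exact this

theorem barOp_stdVec (i : {i : ℕ // i + 1 < N}) {T : Equiv.Perm (Fin N)} (h : IsStd st T) :
    barOp k N st i (stdVec k st T) =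
    if rowOf st T ⟨i.1 + 1, i.2⟩ < rowOf st T ⟨i.1, by have := i.2; omega⟩ then
      - stdVec k st T
    else if rowOf st T ⟨i.1, by have := i.2; omega⟩ = rowOf st T ⟨i.1 + 1, i.2⟩ then 0
    else stdVec k st (Equiv.swap ⟨i.1, by have := i.2; omega⟩ ⟨i.1 + 1, i.2⟩ * T) :=
  tabLift_stdVec _ h

theorem row_succ_right {c : ℕ} (h : st c = Step.right) : row st (c + 1) = row st c := by
  classical
  simp [row, Finset.range_add_one, Finset.filter_insert, h]

theorem row_succ_ne {c : ℕ} (h : st c ≠ Step.right) : row st (c + 1) = row st c + 1 := by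
  classical
  simp [row, Finset.range_add_one, Finset.filter_insert, h]

theorem row_mono (st : ℕ → Step) : Monotone (row st) := by
  refine monotone_nat_of_le_succ (fun c => ?_)
  by_cases h : st c = Step.right
  · rw [row_succ_right h]
  · rw [row_succ_ne h]; omega

theorem swap_lt_swap {i : ℕ} (hi : i + 1 < N) {x y : Fin N} (hxy : x < y)
    (h : ¬ (x.1 = i ∧ y.1 = i + 1)) :
    Equiv.swap (⟨i, by omega⟩ : Fin N) ⟨i + 1, hi⟩ x
      < Equiv.swap (⟨i, by omega⟩ : Fin N) ⟨i + 1, hi⟩ y := by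
  rw [Fin.lt_def] at hxy ⊢
  simp only [Equiv.swap_apply_def, Fin.ext_iff]
  split_ifs <;> first | omega | (dsimp only; omega)

theorem isStd_swap {T : Equiv.Perm (Fin N)} (h : IsStd st T) (i : ℕ) (hi : i + 1 < N)
    (hr : rowOf st T ⟨i, by omega⟩ < rowOf st T ⟨i + 1, hi⟩) :
    IsStd st (Equiv.swap ⟨i, by omega⟩ ⟨i + 1, hi⟩ * T) := by
  intro c hc
  refine ⟨fun hs => ?_, fun hs => ?_⟩
  · refine swap_lt_swap hi ((h c hc).1 hs) ?_
    rintro ⟨h1, h2⟩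
    have e1 : T.symm ⟨i, by omega⟩ = ⟨c, by omega⟩ := by
      rw [Equiv.symm_apply_eq]; exact Fin.ext h1.symm
    have e2 : T.symm ⟨i + 1, hi⟩ = ⟨c + 1, hc⟩ := by
      rw [Equiv.symm_apply_eq]; exact Fin.ext h2.symm
    rw [rowOf, rowOf, e1, e2, row_succ_right hs] at hr
    exact lt_irrefl _ hr
  · refine swap_lt_swap hi ((h c hc).2 hs) ?_
    rintro ⟨h1, h2⟩
    have e1 : T.symm ⟨i, by omega⟩ = ⟨c + 1, hc⟩ := by
      rw [Equiv.symm_apply_eq]; exact Fin.ext h1.symm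
    have e2 : T.symm ⟨i + 1, hi⟩ = ⟨c, by omega⟩ := by
      rw [Equiv.symm_apply_eq]; exact Fin.ext h2.symm
    rw [rowOf, rowOf, e1, e2] at hr
    exact absurd (row_mono st (Nat.le_succ c)) (not_le.mpr hr)

/-- Auxiliary: the same operators on all fillings, standard or not. -/
def fillOp (k : Type u) [Field k] {N : ℕ} (st : ℕ → Step) (a b : Fin N) :
    (Equiv.Perm (Fin N) →₀ k) →ₗ[k] (Equiv.Perm (Fin N) →₀ k) :=
  Finsupp.linearCombination k (fun T =>
    if rowOf st T b < rowOf st T a then - Finsupp.single T (1 : k)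
    else if rowOf st T a = rowOf st T b then 0
    else Finsupp.single (Equiv.swap a b * T) 1)

theorem fillOp_single (a b : Fin N) (T : Equiv.Perm (Fin N)) :
    fillOp k st a b (Finsupp.single T 1) =
    if rowOf st T b < rowOf st T a then - Finsupp.single T (1 : k)
    else if rowOf st T a = rowOf st T b then 0
    else Finsupp.single (Equiv.swap a b * T) 1 :=
  (Finsupp.linearCombination_single k _ _).trans (one_smul _ _)

theorem fillOp_gt {a b : Fin N} {T : Equiv.Perm (Fin N)} (h : rowOf st T b < rowOf st T a) :
    fillOp k st a b (Finsupp.single T 1) = - Finsupp.single T (1 : k) := by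
  rw [fillOp_single, if_pos h]

theorem fillOp_eq {a b : Fin N} {T : Equiv.Perm (Fin N)} (h : rowOf st T a = rowOf st T b) :
    fillOp k st a b (Finsupp.single T 1) = 0 := by
  rw [fillOp_single, if_neg (by omega), if_pos h]

theorem fillOp_lt {a b : Fin N} {T : Equiv.Perm (Fin N)} (h : rowOf st T a < rowOf st T b) :
    fillOp k st a b (Finsupp.single T 1) = Finsupp.single (Equiv.swap a b * T) 1 := by
  rw [fillOp_single, if_neg (by omega), if_neg (by omega)]

theorem rowOf_swap (T : Equiv.Perm (Fin N)) (a b x : Fin N) :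
    rowOf st (Equiv.swap a b * T) x = rowOf st T (Equiv.swap a b x) := by
  have : (Equiv.swap a b * T).symm x = T.symm (Equiv.swap a b x) := by
    rw [Equiv.symm_apply_eq, Equiv.Perm.mul_apply, Equiv.apply_symm_apply, Equiv.swap_apply_self]
  rw [rowOf, rowOf, this]

theorem fill_hom_ext {M : Type*} [AddCommGroup M] [Module k M]
    {f g : (Equiv.Perm (Fin N) →₀ k) →ₗ[k] M}
    (h : ∀ T, f (Finsupp.single T 1) = g (Finsupp.single T 1)) : f = g :=
  Finsupp.lhom_ext' (fun T => LinearMap.ext_ring (h T))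

theorem fillOp_sq (a b : Fin N) :
    fillOp k st a b * fillOp k st a b = - fillOp k st a b := by
  refine fill_hom_ext (fun T => ?_)
  rw [Module.End.mul_apply, LinearMap.neg_apply]
  rcases lt_trichotomy (rowOf st T a) (rowOf st T b) with h | h | h
  · rw [fillOp_lt h, fillOp_gt (by simpa [rowOf_swap] using h)]
  · rw [fillOp_eq h, map_zero, neg_zero]
  · rw [fillOp_gt h, map_neg, fillOp_gt h]

theorem fillOp_comm {a b c d : Fin N} (h1 : c ≠ a) (h2 : c ≠ b) (h3 : d ≠ a) (h4 : d ≠ b) :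
    fillOp k st a b * fillOp k st c d = fillOp k st c d * fillOp k st a b := by
  refine fill_hom_ext (fun T => ?_)
  rw [Module.End.mul_apply, Module.End.mul_apply]
  have e1 : Equiv.swap a b c = c := Equiv.swap_apply_of_ne_of_ne h1 h2
  have e2 : Equiv.swap a b d = d := Equiv.swap_apply_of_ne_of_ne h3 h4
  have e3 : Equiv.swap c d a = a := Equiv.swap_apply_of_ne_of_ne h1.symm h3.symm
  have e4 : Equiv.swap c d b = b := Equiv.swap_apply_of_ne_of_ne h2.symm h4.symm
  have e5 : Equiv.swap a b * (Equiv.swap c d * T) = Equiv.swap c d * (Equiv.swap a b * T) := by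
    rw [← mul_assoc, ← mul_assoc]
    congr 1
    refine Equiv.ext (fun x => ?_)
    simp only [Equiv.Perm.mul_apply]
    by_cases hxc : x = c
    · subst hxc; simp [e1, e2]
    by_cases hxd : x = d
    · subst hxd; simp [e1, e2]
    by_cases hxa : x = a
    · subst hxa; simp [e3, e4]
    by_cases hxb : x = b
    · subst hxb; simp [e3, e4]
    rw [Equiv.swap_apply_of_ne_of_ne hxc hxd, Equiv.swap_apply_of_ne_of_ne hxa hxb,
      Equiv.swap_apply_of_ne_of_ne hxc hxd]
  rcases lt_trichotomy (rowOf st T a) (rowOf st T b) with h | h | h <;>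
  rcases lt_trichotomy (rowOf st T c) (rowOf st T d) with h' | h' | h' <;>
  simp [fillOp_single, rowOf_swap, e1, e2, e3, e4, e5, h, h', not_lt_of_gt, ne_of_lt]

theorem fillOp_braid {a b c : Fin N} (hab : a ≠ b) (hac : a ≠ c) (hbc : b ≠ c) :
    fillOp k st a b * fillOp k st b c * fillOp k st a b
      = fillOp k st b c * fillOp k st a b * fillOp k st b c := by
  refine fill_hom_ext (fun T => ?_)
  simp only [Module.End.mul_apply]
  have e1 : Equiv.swap a b c = c := Equiv.swap_apply_of_ne_of_ne hac.symm hbc.symm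
  have e2 : Equiv.swap b c a = a := Equiv.swap_apply_of_ne_of_ne hab hac
  have key : Equiv.swap a b * (Equiv.swap b c * (Equiv.swap a b * T))
        = Equiv.swap b c * (Equiv.swap a b * (Equiv.swap b c * T)) := by
    simp only [← mul_assoc]
    congr 1
    rw [Equiv.swap_mul_swap_mul_swap hab hac, Equiv.swap_comm a b, Equiv.swap_comm b c,
      Equiv.swap_mul_swap_mul_swap hbc.symm hac.symm, Equiv.swap_comm a c]
  rcases lt_trichotomy (rowOf st T a) (rowOf st T b) with h1 | h1 | h1 <;>
  rcases lt_trichotomy (rowOf st T b) (rowOf st T c) with h2 | h2 | h2 <;>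
  rcases lt_trichotomy (rowOf st T a) (rowOf st T c) with h3 | h3 | h3 <;>
  first
  | omega
  | simp [fillOp_single, rowOf_swap, e1, e2, key, h1, h2, h3, not_lt_of_gt, ne_of_lt]

/-- Auxiliary: the inclusion of tableaux among all fillings. -/
def tabIncl (k : Type u) [Field k] (N : ℕ) (st : ℕ → Step) :
    TabMod k N st →ₗ[k] (Equiv.Perm (Fin N) →₀ k) :=
  tabLift (fun T => Finsupp.single T.1 1)

theorem tabIncl_injective : Function.Injective (tabIncl k N st) := by
  have h : ∀ x : Tab N st →₀ k, tabIncl k N st x = Finsupp.mapDomain Subtype.val x := by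
    intro x
    simp only [tabIncl, tabLift, Finsupp.mapDomain]
    exact (Finsupp.linearCombination_apply k x).trans (by simp)
  intro x y hxy
  exact Finsupp.mapDomain_injective Subtype.val_injective ((h x).symm.trans (hxy.trans (h y)))

theorem tabIncl_stdVec {T : Equiv.Perm (Fin N)} (h : IsStd st T) :
    tabIncl k N st (stdVec k st T) = Finsupp.single T 1 :=
  tabLift_stdVec _ h

theorem tabIncl_barOp (i : {i : ℕ // i + 1 < N}) :
    tabIncl k N st ∘ₗ barOp k N st i
      = fillOp k st ⟨i.1, by have := i.2; omega⟩ ⟨i.1 + 1, i.2⟩ ∘ₗ tabIncl k N st := by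
  refine tab_hom_ext (fun T hT => ?_)
  rw [LinearMap.comp_apply, LinearMap.comp_apply, tabIncl_stdVec hT, fillOp_single,
    barOp_stdVec i hT]
  split_ifs with h1 h2
  · rw [map_neg, tabIncl_stdVec hT]
  · rw [map_zero]
  · rw [tabIncl_stdVec (isStd_swap hT i.1 i.2 (by omega))]

theorem tabIncl_mul {f g : Module.End k (TabMod k N st)}
    {F G : Module.End k (Equiv.Perm (Fin N) →₀ k)}
    (hf : tabIncl k N st ∘ₗ f = F ∘ₗ tabIncl k N st)
    (hg : tabIncl k N st ∘ₗ g = G ∘ₗ tabIncl k N st) :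
    tabIncl k N st ∘ₗ (f * g) = (F * G) ∘ₗ tabIncl k N st := by
  rw [Module.End.mul_eq_comp, Module.End.mul_eq_comp, ← LinearMap.comp_assoc, hf,
    LinearMap.comp_assoc, hg, LinearMap.comp_assoc]

theorem tabIncl_cancel {f g : Module.End k (TabMod k N st)}
    {F G : Module.End k (Equiv.Perm (Fin N) →₀ k)} (hFG : F = G)
    (hf : tabIncl k N st ∘ₗ f = F ∘ₗ tabIncl k N st)
    (hg : tabIncl k N st ∘ₗ g = G ∘ₗ tabIncl k N st) : f = g := by
  subst hFG
  exact LinearMap.ext (fun x => tabIncl_injective (LinearMap.congr_fun (hf.trans hg.symm) x))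

theorem barOp_sq (i : {i : ℕ // i + 1 < N}) :
    barOp k N st i * barOp k N st i = - barOp k N st i := by
  refine tabIncl_cancel (fillOp_sq _ _) (tabIncl_mul (tabIncl_barOp i) (tabIncl_barOp i)) ?_
  rw [LinearMap.comp_neg, LinearMap.neg_comp, tabIncl_barOp]

theorem barOp_comm (i j : {i : ℕ // i + 1 < N}) (hij : i.1 + 1 < j.1) :
    barOp k N st i * barOp k N st j = barOp k N st j * barOp k N st i := by
  refine tabIncl_cancel (fillOp_comm ?_ ?_ ?_ ?_)
    (tabIncl_mul (tabIncl_barOp i) (tabIncl_barOp j))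
    (tabIncl_mul (tabIncl_barOp j) (tabIncl_barOp i)) <;>
  rw [Ne, Fin.ext_iff] <;> dsimp only <;> omega

theorem barOp_braid (i j : {i : ℕ // i + 1 < N}) (hij : j.1 = i.1 + 1) :
    barOp k N st i * barOp k N st j * barOp k N st i
      = barOp k N st j * barOp k N st i * barOp k N st j := by
  obtain ⟨i, hi⟩ := i
  obtain ⟨j, hj⟩ := j
  dsimp only at hij
  subst hij
  refine tabIncl_cancel (fillOp_braid ?_ ?_ ?_)
    (tabIncl_mul (tabIncl_mul (tabIncl_barOp _) (tabIncl_barOp _)) (tabIncl_barOp _))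
    (tabIncl_mul (tabIncl_mul (tabIncl_barOp _) (tabIncl_barOp _)) (tabIncl_barOp _)) <;>
  rw [Ne, Fin.ext_iff] <;> dsimp only <;> omega

end TabBasics

/-- The action of `H_N(0)` on the span of the standard tableaux: `π_i = π̄_i + 1`. -/
def tabAction (k : Type u) [Field k] (N : ℕ) (st : ℕ → Step) :
    Hecke k N →ₐ[k] Module.End k (TabMod k N st) :=
  heckeLift (fun i => barOp k N st i + 1)
    (fun i => by
      have h := barOp_sq (k := k) (st := st) i
      calc (barOp k N st i + 1) * (barOp k N st i + 1)
          = barOp k N st i * barOp k N st i + barOp k N st i + barOp k N st i + 1 := by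
            noncomm_ring
        _ = _ := by rw [h]; abel)
    (fun i j hij => by
      have h1 := barOp_sq (k := k) (st := st) i
      have h2 := barOp_sq (k := k) (st := st) j
      have h3 := barOp_braid (k := k) (st := st) i j hij
      generalize barOp k N st i = e at *
      generalize barOp k N st j = f at *
      calc (e + 1) * (f + 1) * (e + 1)
          = e * f * e + (e * f + f * e + e + f + 1) + (e * e + e) := by noncomm_ring
        _ = f * e * f + (e * f + f * e + e + f + 1) + (f * f + f) := by
            rw [h1, h2, h3]; noncomm_ring
        _ = (f + 1) * (e + 1) * (f + 1) := by noncomm_ring)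
    (fun i j hij => by
      have h := barOp_comm (k := k) (st := st) i j hij
      generalize barOp k N st i = e at *
      generalize barOp k N st j = f at *
      calc (e + 1) * (f + 1) = e * f + e + f + 1 := by noncomm_ring
        _ = (f + 1) * (e + 1) := by rw [h]; noncomm_ring)

instance (k : Type u) [Field k] (N : ℕ) (st : ℕ → Step) : Module (Hecke k N) (TabMod k N st) :=
  Module.compHom _ (tabAction k N st).toRingHom

instance (k : Type u) [Field k] (N : ℕ) (st : ℕ → Step) :
    IsScalarTower k (Hecke k N) (TabMod k N st) :=
  ⟨fun r a x => by
    change tabAction k N st (r • a) x = r • tabAction k N st a x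
    rw [map_smul, LinearMap.smul_apply]⟩

section TabMaps

variable {k : Type u} [Field k]

theorem heckeBar_smul {N : ℕ} {st : ℕ → Step} (i : {i : ℕ // i + 1 < N}) (x : TabMod k N st) :
    heckeBar k N i • x = barOp k N st i x := by
  change tabAction k N st (heckeBar k N i) x = _
  rw [heckeBar, map_sub, map_one, tabAction, heckeLift_gen, add_sub_cancel_right]

/-- `st'` is obtained from `st` by gluing some consecutive components horizontally. -/
def IsGluing (N : ℕ) (st st' : ℕ → Step) : Prop :=
  ∀ c, c + 1 < N → st' c = st c ∨ (st c = Step.diag ∧ st' c = Step.right)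

theorem IsGluing.isStd {N : ℕ} {st st' : ℕ → Step} (h : IsGluing N st st')
    {T : Equiv.Perm (Fin N)} (hT : IsStd st' T) : IsStd st T := by
  intro c hc
  rcases h c hc with e | ⟨e, -⟩
  · rw [← e]; exact hT c hc
  · simp [e]

theorem row_lt_of_lt {st : ℕ → Step} {c d : ℕ} (h : row st c < row st d) : c < d := by
  by_contra hcd
  exact absurd (row_mono st (not_lt.mp hcd)) (not_le.mpr h)

theorem IsGluing.row_le {N : ℕ} {st st' : ℕ → Step} (h : IsGluing N st st') {c d : ℕ}
    (hcd : c ≤ d) (hd : d < N) : row st' d + row st c ≤ row st d + row st' c := by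
  induction d, hcd using Nat.le_induction with
  | base => omega
  | succ d hcd ih =>
    have := ih (by omega)
    by_cases h1 : st d = Step.right
    · have h2 : st' d = Step.right := by
        rcases h d hd with e | ⟨e, e'⟩
        · rw [e, h1]
        · exact e'
      rw [row_succ_right h1, row_succ_right h2]; exact this
    · rw [row_succ_ne h1]
      by_cases h2 : st' d = Step.right
      · rw [row_succ_right h2]; omega
      · rw [row_succ_ne h2]; omega

/-- Along a row of a standard filling the entries increase. -/
theorem IsStd.lt_of_row_eq {N : ℕ} {st : ℕ → Step} {T : Equiv.Perm (Fin N)} (hT : IsStd st T)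
    {c d : ℕ} (hcd : c < d) (hd : d < N) (hr : row st c = row st d) :
    T ⟨c, hcd.trans hd⟩ < T ⟨d, hd⟩ := by
  induction d, (show c + 1 ≤ d from hcd) using Nat.le_induction with
  | base =>
    refine (hT c hd).1 ?_
    by_contra hne
    rw [row_succ_ne hne] at hr
    omega
  | succ d hcd ih =>
    have h1 := row_mono st (show c ≤ d by omega)
    have h2 : st d = Step.right := by
      by_contra hne
      rw [row_succ_ne hne] at hr
      omega
    rw [row_succ_right h2] at hr
    exact (ih (by omega) (by omega) hr).trans ((hT d hd).1 h2)

/-- The gluing map: a tableau is sent to the same filling of the glued shape if that is standard,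
and to `0` otherwise. -/
def glueMap (k : Type u) [Field k] {N : ℕ} {st st' : ℕ → Step} (h : IsGluing N st st') :
    TabMod k N st →ₗ[Hecke k N] TabMod k N st' :=
  heckeLinear (tabLift (fun T => stdVec k st' T.1)) (by
    intro i x
    rw [heckeBar_smul, heckeBar_smul]
    suffices hs : tabLift (fun T => stdVec k st' T.1) ∘ₗ barOp k N st i
        = barOp k N st' i ∘ₗ tabLift (fun T => stdVec k st' T.1) from LinearMap.congr_fun hs x
    refine tab_hom_ext (fun T hT => ?_)
    rw [LinearMap.comp_apply, LinearMap.comp_apply, tabLift_stdVec _ hT, barOp_stdVec i hT]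
    obtain ⟨i, hi⟩ := i
    have ha : T (T.symm ⟨i, by omega⟩) = ⟨i, by omega⟩ := T.apply_symm_apply _
    have hb : T (T.symm ⟨i + 1, hi⟩) = ⟨i + 1, hi⟩ := T.apply_symm_apply _
    have hlt : (⟨i, by omega⟩ : Fin N) < ⟨i + 1, hi⟩ := by simp
    by_cases hT' : IsStd st' T
    · rw [barOp_stdVec _ hT']
      rcases lt_trichotomy (rowOf st T ⟨i, by omega⟩) (rowOf st T ⟨i + 1, hi⟩) with hr | hr | hr
      · have hcd := row_lt_of_lt hr
        have hle := row_mono st' hcd.le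
        rw [if_neg (by simp only; omega), if_neg (by simp only; omega),
          tabLift_stdVec _ (isStd_swap hT i hi hr)]
        rw [if_neg (by simp only [rowOf]; omega)]
        split_ifs with he
        · refine stdVec_neg (fun hS => ?_)
          have := hS.lt_of_row_eq hcd (T.symm ⟨i + 1, hi⟩).2 he
          simp only [Fin.eta, Equiv.Perm.mul_apply, ha, hb, Equiv.swap_apply_left,
            Equiv.swap_apply_right] at this
          exact absurd this (not_lt.mpr hlt.le)
        · rfl
      · have he : rowOf st' T ⟨i, by omega⟩ = rowOf st' T ⟨i + 1, hi⟩ := by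
          rcases le_total (T.symm ⟨i, by omega⟩).1 (T.symm ⟨i + 1, hi⟩).1 with hc | hc
          · have h1 := h.row_le hc (T.symm ⟨i + 1, hi⟩).2
            have h2 := row_mono st' hc
            simp only [rowOf] at hr ⊢
            omega
          · have h1 := h.row_le hc (T.symm ⟨i, by omega⟩).2
            have h2 := row_mono st' hc
            simp only [rowOf] at hr ⊢
            omega
        rw [if_neg (by simp only; omega), if_pos hr, if_neg (by simp only; omega), if_pos he,
          map_zero]
      · have hcd := row_lt_of_lt hr
        have hle := row_mono st' hcd.le
        have hne : rowOf st' T ⟨i + 1, hi⟩ ≠ rowOf st' T ⟨i, by omega⟩ := by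
          intro he
          have := hT'.lt_of_row_eq hcd (T.symm ⟨i, by omega⟩).2 he
          simp only [Fin.eta, ha, hb] at this
          exact absurd this (not_lt.mpr hlt.le)
        rw [if_pos hr, map_neg, tabLift_stdVec _ hT, if_pos]
        simp only [rowOf] at hne ⊢
        omega
    · rw [stdVec_neg hT', map_zero]
      split_ifs with h1 h2
      · rw [map_neg, tabLift_stdVec _ hT, stdVec_neg hT', neg_zero]
      · rw [map_zero]
      · have hr : rowOf st T ⟨i, by omega⟩ < rowOf st T ⟨i + 1, hi⟩ := by
          simp only at h1 h2; omega
        rw [tabLift_stdVec _ (isStd_swap hT i hi hr)]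
        refine stdVec_neg (fun hS => hT' ?_)
        have hd := row_lt_of_lt hr
        intro e he
        refine ⟨fun hs => ?_, fun hs => ?_⟩
        · have h3 := (hS e he).1 hs
          have h4 := swap_lt_swap hi h3 (by
            rintro ⟨e1, e2⟩
            have e1' : Equiv.swap (⟨i, by omega⟩ : Fin N) ⟨i + 1, hi⟩ (T ⟨e, by omega⟩)
              = ⟨i, by omega⟩ := Fin.ext e1
            have e2' : Equiv.swap (⟨i, by omega⟩ : Fin N) ⟨i + 1, hi⟩ (T ⟨e + 1, he⟩)
              = ⟨i + 1, hi⟩ := Fin.ext e2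
            rw [← Equiv.eq_symm_apply, Equiv.symm_swap, Equiv.swap_apply_left,
              ← Equiv.eq_symm_apply] at e1'
            rw [← Equiv.eq_symm_apply, Equiv.symm_swap, Equiv.swap_apply_right,
              ← Equiv.eq_symm_apply] at e2'
            rw [← e1', ← e2'] at hd
            simp only at hd
            omega)
          simpa only [Equiv.Perm.mul_apply, Equiv.swap_apply_self] using h4
        · refine (hT e he).2 ?_
          rcases h e he with h5 | ⟨-, h5⟩
          · rw [← h5, hs]
          · rw [hs] at h5; cases h5)

/-! ## Juxtaposition of tableaux -/

/-- The filling of a disconnected shape whose lower part (`p` cells) is filled by `T` and whose upper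
part (`q` cells) is filled by `U` with all entries raised by `p`. -/
def juxta {p q n : ℕ} (h : p + q = n) (T : Equiv.Perm (Fin p)) (U : Equiv.Perm (Fin q)) :
    Equiv.Perm (Fin n) :=
  (finSumFinEquiv.trans (finCongr h)).permCongr (Equiv.Perm.sumCongr T U)

/-- `st` is the disjoint union of the shape `st₁` (`p` cells, below) and `st₂` (`q` cells, above). -/
def IsJuxta (p q : ℕ) (st₁ st₂ st : ℕ → Step) : Prop :=
  (∀ c, c + 1 < p → st c = st₁ c) ∧ (∀ c, c + 1 = p → st c = Step.diag) ∧
    (∀ c, c + 1 < q → st (p + c) = st₂ c)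

theorem juxta_left {p q n : ℕ} (h : p + q = n) (T : Equiv.Perm (Fin p)) (U : Equiv.Perm (Fin q))
    {c : ℕ} (hc : c < p) : juxta h T U ⟨c, by omega⟩ = ⟨(T ⟨c, hc⟩).1, by omega⟩ := by
  subst h
  have : finSumFinEquiv.symm (⟨c, by omega⟩ : Fin (p + q)) = Sum.inl ⟨c, hc⟩ := by
    rw [Equiv.symm_apply_eq]; rfl
  simp [juxta, Equiv.permCongr_apply, this, Fin.castAdd, Fin.castLE]

theorem juxta_right {p q n : ℕ} (h : p + q = n) (T : Equiv.Perm (Fin p)) (U : Equiv.Perm (Fin q))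
    {c : ℕ} (hc : c < q) : juxta h T U ⟨p + c, by omega⟩ = ⟨p + (U ⟨c, hc⟩).1, by omega⟩ := by
  subst h
  have : finSumFinEquiv.symm (⟨p + c, by omega⟩ : Fin (p + q)) = Sum.inr ⟨c, hc⟩ := by
    rw [Equiv.symm_apply_eq]; rfl
  simp [juxta, Equiv.permCongr_apply, this, Fin.natAdd]

theorem juxta_symm {p q n : ℕ} (h : p + q = n) (T : Equiv.Perm (Fin p)) (U : Equiv.Perm (Fin q)) :
    (juxta h T U).symm = juxta h T.symm U.symm := rfl

theorem swap_mul_juxta_left {p q n : ℕ} (h : p + q = n) (T : Equiv.Perm (Fin p))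
    (U : Equiv.Perm (Fin q)) {i j : ℕ} (hi : i < p) (hj : j < p) :
    Equiv.swap ⟨i, by omega⟩ ⟨j, by omega⟩ * juxta h T U
      = juxta h (Equiv.swap ⟨i, hi⟩ ⟨j, hj⟩ * T) U := by
  subst h
  refine Equiv.ext (fun c => ?_)
  rw [Equiv.Perm.mul_apply]
  by_cases hc : c.1 < p
  · have h1 := juxta_left rfl T U hc
    have h2 := juxta_left rfl (Equiv.swap ⟨i, hi⟩ ⟨j, hj⟩ * T) U hc
    simp only [Fin.eta] at h1 h2
    rw [h1, h2]
    simp only [Equiv.Perm.mul_apply, Equiv.swap_apply_def, Fin.ext_iff]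
    split_ifs <;> rfl
  · obtain ⟨d, hd⟩ : ∃ d, c.1 = p + d := ⟨c.1 - p, by omega⟩
    have hdq : d < q := by have := c.2; omega
    have hcd : c = ⟨p + d, by omega⟩ := Fin.ext hd
    rw [hcd, juxta_right rfl T U hdq, juxta_right rfl _ U hdq]
    refine Equiv.swap_apply_of_ne_of_ne ?_ ?_ <;> rw [Ne, Fin.ext_iff] <;> dsimp only <;> omega

theorem swap_mul_juxta_right {p q n : ℕ} (h : p + q = n) (T : Equiv.Perm (Fin p))
    (U : Equiv.Perm (Fin q)) {i j : ℕ} (hi : i < q) (hj : j < q) :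
    Equiv.swap ⟨p + i, by omega⟩ ⟨p + j, by omega⟩ * juxta h T U
      = juxta h T (Equiv.swap ⟨i, hi⟩ ⟨j, hj⟩ * U) := by
  subst h
  refine Equiv.ext (fun c => ?_)
  rw [Equiv.Perm.mul_apply]
  by_cases hc : c.1 < p
  · have h1 := juxta_left rfl T U hc
    have h2 := juxta_left rfl T (Equiv.swap ⟨i, hi⟩ ⟨j, hj⟩ * U) hc
    simp only [Fin.eta] at h1 h2
    rw [h1, h2]
    refine Equiv.swap_apply_of_ne_of_ne ?_ ?_ <;> rw [Ne, Fin.ext_iff] <;> dsimp only <;> omega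
  · obtain ⟨d, hd⟩ : ∃ d, c.1 = p + d := ⟨c.1 - p, by omega⟩
    have hdq : d < q := by have := c.2; omega
    have hcd : c = ⟨p + d, by omega⟩ := Fin.ext hd
    rw [hcd, juxta_right rfl T U hdq, juxta_right rfl T _ hdq]
    simp only [Equiv.Perm.mul_apply, Equiv.swap_apply_def, Fin.ext_iff, Nat.add_left_cancel_iff]
    split_ifs <;> rfl

theorem IsJuxta.isStd {p q n : ℕ} {st₁ st₂ st : ℕ → Step} (hs : IsJuxta p q st₁ st₂ st)
    (h : p + q = n) {T : Equiv.Perm (Fin p)} {U : Equiv.Perm (Fin q)} (hT : IsStd st₁ T)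
    (hU : IsStd st₂ U) : IsStd st (juxta h T U) := by
  intro c hc
  obtain ⟨h1, h2, h3⟩ := hs
  rcases lt_trichotomy (c + 1) p with hp | hp | hp
  · rw [juxta_left h T U (show c < p by omega), juxta_left h T U hp, h1 c hp]
    exact hT c hp
  · rw [h2 c hp]
    refine ⟨fun e => ?_, fun e => ?_⟩ <;> cases e
  · obtain ⟨d, rfl⟩ : ∃ d, c = p + d := ⟨c - p, by omega⟩
    have e : (⟨p + d + 1, hc⟩ : Fin n) = ⟨p + (d + 1), by omega⟩ := rfl
    rw [e, juxta_right h T U (show d < q by omega), juxta_right h T U (show d + 1 < q by omega),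
      h3 d (by omega)]
    have := hU d (by omega)
    simpa only [Fin.lt_def, Nat.add_lt_add_iff_left] using this

theorem IsJuxta.row_left {p q : ℕ} {st₁ st₂ st : ℕ → Step} (hs : IsJuxta p q st₁ st₂ st) {c : ℕ}
    (hc : c < p) : row st c = row st₁ c := by
  classical
  rw [row, row]
  congr 1
  refine Finset.filter_congr (fun d hd => ?_)
  rw [hs.1 d (by rw [Finset.mem_range] at hd; omega)]

theorem IsJuxta.row_right {p q : ℕ} {st₁ st₂ st : ℕ → Step} (hs : IsJuxta p q st₁ st₂ st) {c : ℕ}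
    (hc : c < q) : row st (p + c) = row st p + row st₂ c := by
  induction c with
  | zero => simp [row]
  | succ c ih =>
    have h1 := ih (by omega)
    have h2 := hs.2.2 c hc
    by_cases h3 : st₂ c = Step.right
    · rw [← Nat.add_assoc, row_succ_right (h2.trans h3), row_succ_right h3, h1]
    · rw [← Nat.add_assoc, row_succ_ne (h2.trans_ne h3), row_succ_ne h3, h1, Nat.add_assoc]

/-- The bilinear map `(T, U) ↦ T * U` given by juxtaposition of tableaux. -/
def juxtaMap (k : Type u) [Field k] {p q n : ℕ} (h : p + q = n) (st₁ st₂ st : ℕ → Step) :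
    TabMod k p st₁ →ₗ[k] TabMod k q st₂ →ₗ[k] TabMod k n st :=
  tabLift (fun T => tabLift (fun U => stdVec k st (juxta h T.1 U.1)))

theorem juxtaMap_stdVec {p q n : ℕ} (h : p + q = n) {st₁ st₂ st : ℕ → Step}
    {T : Equiv.Perm (Fin p)} {U : Equiv.Perm (Fin q)} (hT : IsStd st₁ T) (hU : IsStd st₂ U) :
    juxtaMap k h st₁ st₂ st (stdVec k st₁ T) (stdVec k st₂ U) = stdVec k st (juxta h T U) := by
  rw [juxtaMap, tabLift_stdVec _ hT, tabLift_stdVec _ hU]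

theorem juxtaMap_bar_left {p q n : ℕ} (h : p + q = n) {st₁ st₂ st : ℕ → Step}
    (hs : IsJuxta p q st₁ st₂ st) (i : {i : ℕ // i + 1 < p}) (x : TabMod k p st₁)
    (y : TabMod k q st₂) :
    juxtaMap k h st₁ st₂ st (heckeBar k p i • x) y
      = heckeBar k n ⟨0 + i.1, by have := i.2; omega⟩ • juxtaMap k h st₁ st₂ st x y := by
  rw [heckeBar_smul, heckeBar_smul]
  suffices hh : ((juxtaMap k h st₁ st₂ st).flip y) ∘ₗ barOp k p st₁ i
      = barOp k n st ⟨0 + i.1, by have := i.2; omega⟩ ∘ₗ ((juxtaMap k h st₁ st₂ st).flip y) from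
    LinearMap.congr_fun hh x
  refine tab_hom_ext (fun T hT => ?_)
  simp only [LinearMap.comp_apply, LinearMap.flip_apply]
  suffices hh : juxtaMap k h st₁ st₂ st (barOp k p st₁ i (stdVec k st₁ T))
      = barOp k n st ⟨0 + i.1, by have := i.2; omega⟩ ∘ₗ
        juxtaMap k h st₁ st₂ st (stdVec k st₁ T) from LinearMap.congr_fun hh y
  refine tab_hom_ext (fun U hU => ?_)
  obtain ⟨i, hi⟩ := i
  have hr : ∀ j (hj : j < p), rowOf st (juxta h T U) ⟨j, by omega⟩ = rowOf st₁ T ⟨j, hj⟩ := by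
    intro j hj
    rw [rowOf, juxta_symm, juxta_left h T.symm U.symm hj, rowOf]
    exact hs.row_left (T.symm ⟨j, hj⟩).2
  rw [LinearMap.comp_apply, juxtaMap_stdVec h hT hU, barOp_stdVec _ (hs.isStd h hT hU),
    barOp_stdVec _ hT]
  simp only [Nat.zero_add, hr i (by omega), hr (i + 1) hi]
  split_ifs with h1 h2
  · rw [map_neg, LinearMap.neg_apply, juxtaMap_stdVec h hT hU]
  · rw [map_zero, LinearMap.zero_apply]
  · rw [juxtaMap_stdVec h (isStd_swap hT i hi (by omega)) hU,
      swap_mul_juxta_left h T U (show i < p by omega) hi]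

theorem juxtaMap_bar_right {p q n : ℕ} (h : p + q = n) {st₁ st₂ st : ℕ → Step}
    (hs : IsJuxta p q st₁ st₂ st) (i : {i : ℕ // i + 1 < q}) (x : TabMod k p st₁)
    (y : TabMod k q st₂) :
    juxtaMap k h st₁ st₂ st x (heckeBar k q i • y)
      = heckeBar k n ⟨p + i.1, by have := i.2; omega⟩ • juxtaMap k h st₁ st₂ st x y := by
  rw [heckeBar_smul, heckeBar_smul]
  suffices hh : ((juxtaMap k h st₁ st₂ st).flip (barOp k q st₂ i y))
      = barOp k n st ⟨p + i.1, by have := i.2; omega⟩ ∘ₗ ((juxtaMap k h st₁ st₂ st).flip y) from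
    LinearMap.congr_fun hh x
  refine tab_hom_ext (fun T hT => ?_)
  simp only [LinearMap.comp_apply, LinearMap.flip_apply]
  suffices hh : juxtaMap k h st₁ st₂ st (stdVec k st₁ T) ∘ₗ barOp k q st₂ i
      = barOp k n st ⟨p + i.1, by have := i.2; omega⟩ ∘ₗ
        juxtaMap k h st₁ st₂ st (stdVec k st₁ T) from LinearMap.congr_fun hh y
  refine tab_hom_ext (fun U hU => ?_)
  obtain ⟨i, hi⟩ := i
  have hr : ∀ j (hj : j < q), rowOf st (juxta h T U) ⟨p + j, by omega⟩
      = row st p + rowOf st₂ U ⟨j, hj⟩ := by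
    intro j hj
    rw [rowOf, juxta_symm, juxta_right h T.symm U.symm hj, rowOf]
    exact hs.row_right (U.symm ⟨j, hj⟩).2
  have hr1 := hr i (by omega)
  have hr2 := hr (i + 1) hi
  simp only [← Nat.add_assoc] at hr2
  rw [LinearMap.comp_apply, LinearMap.comp_apply, juxtaMap_stdVec h hT hU,
    barOp_stdVec _ (hs.isStd h hT hU), barOp_stdVec _ hU]
  simp only [hr1, hr2, Nat.add_lt_add_iff_left, Nat.add_left_cancel_iff]
  split_ifs with h1 h2
  · rw [map_neg, juxtaMap_stdVec h hT hU]
  · rw [map_zero]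
  · rw [juxtaMap_stdVec h hT (isStd_swap hU i hi (by omega)),
      ← swap_mul_juxta_right h T U (show i < q by omega) hi]
    rfl

/-- A `k`-linear map intertwining each `π̄_i` with `π̄_{s+i}` is equivariant along the shift. -/
theorem map_smul_of_bar {m n : ℕ} {M Y : Type*} [AddCommGroup M] [Module k M]
    [Module (Hecke k m) M] [IsScalarTower k (Hecke k m) M] [AddCommGroup Y] [Module k Y]
    [Module (Hecke k n) Y] [IsScalarTower k (Hecke k n) Y] (s : ℕ) (h : s + m ≤ n)
    (f : M →ₗ[k] Y)
    (hf : ∀ (i : {i : ℕ // i + 1 < m}) x,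
      f (heckeBar k m i • x) = heckeBar k n ⟨s + i.1, by have := i.2; omega⟩ • f x)
    (a : Hecke k m) (x : M) : f (a • x) = heckeShift s h a • f x := by
  revert x
  induction a using hecke_induction with
  | hk r => intro x; simp
  | hg i => intro x; rw [hf, heckeShift_bar]
  | hadd a b ha hb => intro x; rw [add_smul, map_add, ha, hb, map_add, add_smul]
  | hmul a b ha hb => intro x; rw [mul_smul, ha, hb, map_mul, mul_smul]

theorem juxtaMap_smul {p q n : ℕ} (h : p + q = n) {st₁ st₂ st : ℕ → Step}
    (hs : IsJuxta p q st₁ st₂ st) (a : Hecke k p) (b : Hecke k q) (x : TabMod k p st₁)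
    (y : TabMod k q st₂) :
    juxtaMap k h st₁ st₂ st (a • x) (b • y)
      = (heckeShift (n := n) 0 (by omega) a * heckeShift (n := n) p (by omega) b) •
        juxtaMap k h st₁ st₂ st x y := by
  rw [mul_smul, ← map_smul_of_bar p (by omega) (juxtaMap k h st₁ st₂ st x)
    (fun i y => juxtaMap_bar_right h hs i x y) b y]
  exact map_smul_of_bar 0 (by omega) ((juxtaMap k h st₁ st₂ st).flip (b • y))
    (fun i x => juxtaMap_bar_left h hs i x (b • y)) a x

end TabMaps

/-! ## Induction products -/

set_option linter.unusedSectionVars false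

section Induction

variable {k : Type u} [Field k]

theorem heckeShift_shift {l m n : ℕ} (s t : ℕ) (hs : s + m ≤ n) (ht : t + l ≤ m) (a : Hecke k l) :
    heckeShift s hs (heckeShift t ht a) = heckeShift (s + t) (by omega) a := by
  induction a using hecke_induction with
  | hk r => simp
  | hg i => simp only [heckeShift_bar, Nat.add_assoc]
  | hadd a b ha hb => simp only [map_add, ha, hb]
  | hmul a b ha hb => simp only [map_mul, ha, hb]

theorem heckeShift_comm {p q n : ℕ} (h : p + q = n) (a : Hecke k p) (b : Hecke k q) :
    heckeShift (n := n) 0 (by omega) a * heckeShift (n := n) p (by omega) b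
      = heckeShift (n := n) p (by omega) b * heckeShift (n := n) 0 (by omega) a := by
  change Commute (heckeShift (n := n) 0 (by omega) a) (heckeShift (n := n) p (by omega) b)
  induction a using hecke_induction with
  | hk r => rw [AlgHom.commutes]; exact Algebra.commute_algebraMap_left r _
  | hg i =>
    induction b using hecke_induction with
    | hk r => rw [AlgHom.commutes]; exact Algebra.commute_algebraMap_right r _
    | hg j =>
      rw [heckeShift_bar, heckeShift_bar, heckeBar, heckeBar]
      have hi := i.2
      have : Commute (heckeGen k n ⟨0 + i.1, by omega⟩)
          (heckeGen k n ⟨p + j.1, by have := j.2; omega⟩) :=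
        heckeGen_comm _ _ (by dsimp only; omega)
      exact (this.sub_left (Commute.one_left _)).sub_right
        ((Commute.one_right _).sub_left (Commute.one_right _))
    | hadd c d hc hd => rw [map_add]; exact hc.add_right hd
    | hmul c d hc hd => rw [map_mul]; exact hc.mul_right hd
  | hadd c d hc hd => rw [map_add]; exact hc.add_left hd
  | hmul c d hc hd => rw [map_mul]; exact hc.mul_left hd

variable {p q n : ℕ} (h : p + q = n)
variable (M N : Type u) [AddCommGroup M] [Module k M] [Module (Hecke k p) M]
  [IsScalarTower k (Hecke k p) M] [AddCommGroup N] [Module k N] [Module (Hecke k q) N]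
  [IsScalarTower k (Hecke k q) N]

/-- The relations that turn `H_n(0) ⊗_k (M ⊗_k N)` into the tensor product over the parabolic
subalgebra `H_p(0) ⊗_k H_q(0)` of `H_n(0)`, where `n = p + q`. -/
def indRel : Submodule (Hecke k n) (Hecke k n ⊗[k] (M ⊗[k] N)) :=
  Submodule.span (Hecke k n)
    {z | ∃ (a : Hecke k p) (b : Hecke k q) (x : M) (y : N),
      z = (heckeShift (n := n) 0 (by omega) a * heckeShift (n := n) p (by omega) b) ⊗ₜ[k]
            (x ⊗ₜ[k] y)
          - (1 : Hecke k n) ⊗ₜ[k] ((a • x) ⊗ₜ[k] (b • y))}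

variable (k) in
/-- The induced module `(M ⊗_k N)↑` from `H_p(0) ⊗_k H_q(0)` to `H_n(0)`, where `n = p + q`. -/
def Ind : Type u := (Hecke k n ⊗[k] (M ⊗[k] N)) ⧸ indRel h M N

instance : AddCommGroup (Ind k h M N) :=
  inferInstanceAs (AddCommGroup ((Hecke k n ⊗[k] (M ⊗[k] N)) ⧸ indRel h M N))

instance : Module (Hecke k n) (Ind k h M N) :=
  inferInstanceAs (Module (Hecke k n) ((Hecke k n ⊗[k] (M ⊗[k] N)) ⧸ indRel h M N))

instance : Module k (Ind k h M N) :=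
  inferInstanceAs (Module k ((Hecke k n ⊗[k] (M ⊗[k] N)) ⧸ indRel h M N))

instance : IsScalarTower k (Hecke k n) (Ind k h M N) :=
  inferInstanceAs (IsScalarTower k (Hecke k n) ((Hecke k n ⊗[k] (M ⊗[k] N)) ⧸ indRel h M N))

variable (k) in
/-- The quotient map onto the induced module. -/
def indQuot : (Hecke k n ⊗[k] (M ⊗[k] N)) →ₗ[Hecke k n] Ind k h M N := (indRel h M N).mkQ

variable (k) in
theorem indQuot_surjective : Function.Surjective (indQuot k h M N) :=
  Submodule.mkQ_surjective _

variable (k) in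
/-- The map `(x, y) ↦ 1 ⊗ (x ⊗ y)`. -/
def indMk : M →ₗ[k] N →ₗ[k] Ind k h M N :=
  (TensorProduct.mk k M N).compr₂
    ((indQuot k h M N).restrictScalars k ∘ₗ TensorProduct.mk k (Hecke k n) (M ⊗[k] N) 1)

variable (k) in
theorem indMk_apply (x : M) (y : N) : indMk k h M N x y = indQuot k h M N (1 ⊗ₜ (x ⊗ₜ y)) := rfl

variable (k) in
theorem indQuot_tmul (c : Hecke k n) (x : M) (y : N) :
    indQuot k h M N (c ⊗ₜ (x ⊗ₜ y)) = c • indMk k h M N x y := by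
  rw [indMk_apply, ← map_smul, TensorProduct.smul_tmul', smul_eq_mul, mul_one]

variable (k) in
theorem indMk_smul (a : Hecke k p) (b : Hecke k q) (x : M) (y : N) :
    indMk k h M N (a • x) (b • y)
      = (heckeShift (n := n) 0 (by omega) a * heckeShift (n := n) p (by omega) b) •
        indMk k h M N x y := by
  rw [← indQuot_tmul, indMk_apply, eq_comm, ← sub_eq_zero, ← map_sub]
  exact (Submodule.Quotient.mk_eq_zero _).mpr (Submodule.subset_span ⟨a, b, x, y, rfl⟩)

variable {h M N}

theorem ind_induction {C : Ind k h M N → Prop} (hadd : ∀ z w, C z → C w → C (z + w))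
    (hmk : ∀ (c : Hecke k n) x y, C (c • indMk k h M N x y)) (z : Ind k h M N) : C z := by
  have h0 : C 0 := by
    have := hmk 0 0 0
    rwa [zero_smul] at this
  obtain ⟨w, rfl⟩ := indQuot_surjective k h M N z
  induction w using TensorProduct.induction_on with
  | zero => rw [map_zero]; exact h0
  | add a b ha hb => rw [map_add]; exact hadd _ _ ha hb
  | tmul c v =>
    induction v using TensorProduct.induction_on with
    | zero => rw [TensorProduct.tmul_zero, map_zero]; exact h0
    | add a b ha hb => rw [TensorProduct.tmul_add, map_add]; exact hadd _ _ ha hb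
    | tmul x y => rw [indQuot_tmul]; exact hmk c x y


/-- The universal property of the induced module, along an algebra map `φ` out of `H_n(0)`: the map
`c ⊗ (x ⊗ y) ↦ φ(c) f(x, y)`. -/
def indLiftAlong {m : ℕ} {Y : Type u} [AddCommGroup Y] [Module k Y] [Module (Hecke k m) Y]
    [IsScalarTower k (Hecke k m) Y] (φ : Hecke k n →ₐ[k] Hecke k m) (f : M →ₗ[k] N →ₗ[k] Y)
    (hf : ∀ (a : Hecke k p) (b : Hecke k q) x y, f (a • x) (b • y)
      = φ (heckeShift (n := n) 0 (by omega) a * heckeShift (n := n) p (by omega) b) • f x y) :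
    Ind k h M N →ₛₗ[φ.toRingHom] Y :=
  let F : (Hecke k n ⊗[k] (M ⊗[k] N)) →ₗ[k] Y :=
    TensorProduct.lift (LinearMap.lcomp k Y (TensorProduct.lift f) ∘ₗ
      (Algebra.lsmul k k Y).toLinearMap ∘ₗ φ.toLinearMap)
  have hF : ∀ c v, F (c ⊗ₜ v) = φ c • TensorProduct.lift f v := fun _ _ => rfl
  Submodule.liftQ (indRel h M N)
    { toFun := F
      map_add' := F.map_add
      map_smul' := fun c z => by
        induction z using TensorProduct.induction_on with
        | zero => simp
        | add a b ha hb => rw [smul_add, map_add, ha, hb, map_add, smul_add]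
        | tmul d v =>
          rw [TensorProduct.smul_tmul', hF, hF, smul_eq_mul, map_mul, mul_smul]
          rfl }
    (Submodule.span_le.mpr (by
      rintro _ ⟨a, b, x, y, rfl⟩
      rw [SetLike.mem_coe, LinearMap.mem_ker]
      change F _ = 0
      rw [map_sub, hF, hF, TensorProduct.lift.tmul, TensorProduct.lift.tmul, map_one, one_smul, hf,
        sub_self]))

theorem indLiftAlong_mk {m : ℕ} {Y : Type u} [AddCommGroup Y] [Module k Y] [Module (Hecke k m) Y]
    [IsScalarTower k (Hecke k m) Y] (φ : Hecke k n →ₐ[k] Hecke k m) (f : M →ₗ[k] N →ₗ[k] Y)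
    (hf : ∀ (a : Hecke k p) (b : Hecke k q) x y, f (a • x) (b • y)
      = φ (heckeShift (n := n) 0 (by omega) a * heckeShift (n := n) p (by omega) b) • f x y)
    (x : M) (y : N) : indLiftAlong (h := h) φ f hf (indMk k h M N x y) = f x y := by
  change φ 1 • f x y = f x y
  rw [map_one, one_smul]

theorem smul_along {m : ℕ} {Y Z : Type*} [AddCommGroup Y] [Module k Y] [Module (Hecke k m) Y]
    [IsScalarTower k (Hecke k m) Y] [AddCommGroup Z] [Module k Z] [Module (Hecke k n) Z]
    [IsScalarTower k (Hecke k n) Z] (φ : Hecke k n →ₐ[k] Hecke k m)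
    (f : Z →ₛₗ[φ.toRingHom] Y) (r : k) (z : Z) : f (r • z) = r • f z := by
  rw [← algebraMap_smul (Hecke k n) r z, map_smulₛₗ]
  change φ _ • _ = _
  rw [AlgHom.commutes, algebraMap_smul]

/-- The universal property of the induced module: the `H_n(0)`-linear map
`c ⊗ (x ⊗ y) ↦ c f(x, y)`. -/
def indLift {Y : Type u} [AddCommGroup Y] [Module k Y] [Module (Hecke k n) Y]
    [IsScalarTower k (Hecke k n) Y] (f : M →ₗ[k] N →ₗ[k] Y)
    (hf : ∀ (a : Hecke k p) (b : Hecke k q) x y, f (a • x) (b • y)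
      = (heckeShift (n := n) 0 (by omega) a * heckeShift (n := n) p (by omega) b) • f x y) :
    Ind k h M N →ₗ[Hecke k n] Y :=
  { indLiftAlong (AlgHom.id k (Hecke k n)) f hf with
    map_smul' := fun c z => (indLiftAlong (AlgHom.id k (Hecke k n)) f hf).map_smulₛₗ c z }

theorem indLift_mk {Y : Type u} [AddCommGroup Y] [Module k Y] [Module (Hecke k n) Y]
    [IsScalarTower k (Hecke k n) Y] (f : M →ₗ[k] N →ₗ[k] Y)
    (hf : ∀ (a : Hecke k p) (b : Hecke k q) x y, f (a • x) (b • y)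
      = (heckeShift (n := n) 0 (by omega) a * heckeShift (n := n) p (by omega) b) • f x y)
    (x : M) (y : N) : indLift (h := h) f hf (indMk k h M N x y) = f x y :=
  indLiftAlong_mk _ f hf x y

end Induction

/-! ## Externally graded modules over the tower of 0-Hecke algebras -/

/-- A module over the tower of 0-Hecke algebras: its component of external degree `n` is an
`H_n(0)`-module. -/
structure TowerMod (k : Type u) [Field k] where
  /-- The component of external degree `n`. -/
  X : ℕ → Type u
  [grp : ∀ n, AddCommGroup (X n)]
  [modk : ∀ n, Module k (X n)]
  [modH : ∀ n, Module (Hecke k n) (X n)]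
  [tower : ∀ n, IsScalarTower k (Hecke k n) (X n)]

attribute [instance] TowerMod.grp TowerMod.modk TowerMod.modH TowerMod.tower

/-- Morphisms: `H_n(0)`-linear maps in each external degree `n`. -/
abbrev TowerHom {k : Type u} [Field k] (M N : TowerMod k) : Type u :=
  ∀ n, M.X n →ₗ[Hecke k n] N.X n

/-- The induction product `M ⊗̂ N`, whose component of external degree `n` is the direct sum over
`p + q = n` of the modules induced from `M_p ⊗_k N_q`. -/
def indProd {k : Type u} [Field k] (M N : TowerMod k) : TowerMod k where
  X n := ⨁ d : {d : ℕ × ℕ // d.1 + d.2 = n}, Ind k d.2 (M.X d.1.1) (N.X d.1.2)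
  tower n := inferInstanceAs (IsScalarTower k (Hecke k n) (Π₀ d : {d : ℕ × ℕ // d.1 + d.2 = n},
    Ind k d.2 (M.X d.1.1) (N.X d.1.2)))

section TowerMaps

variable {k : Type u} [Field k]

theorem tower_linear {n : ℕ} {M N : Type*} [AddCommGroup M] [Module k M] [Module (Hecke k n) M]
    [IsScalarTower k (Hecke k n) M] [AddCommGroup N] [Module k N] [Module (Hecke k n) N]
    [IsScalarTower k (Hecke k n) N] (f : M →ₗ[Hecke k n] N) (r : k) (x : M) :
    f (r • x) = r • f x := by
  rw [← algebraMap_smul (Hecke k n) r x, map_smul, algebraMap_smul]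

/-- An `H_n(0)`-linear map, regarded as a `k`-linear map. -/
def toK {n : ℕ} {M N : Type*} [AddCommGroup M] [Module k M] [Module (Hecke k n) M]
    [IsScalarTower k (Hecke k n) M] [AddCommGroup N] [Module k N] [Module (Hecke k n) N]
    [IsScalarTower k (Hecke k n) N] (f : M →ₗ[Hecke k n] N) : M →ₗ[k] N :=
  { toFun := f, map_add' := f.map_add, map_smul' := tower_linear f }

@[simp] theorem toK_apply {n : ℕ} {M N : Type*} [AddCommGroup M] [Module k M]
    [Module (Hecke k n) M] [IsScalarTower k (Hecke k n) M] [AddCommGroup N] [Module k N]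
    [Module (Hecke k n) N] [IsScalarTower k (Hecke k n) N] (f : M →ₗ[Hecke k n] N) (x : M) :
    toK f x = f x := rfl

/-- The inclusion of `(M_p ⊗ N_q)↑` into the component of degree `p + q` of `M ⊗̂ N`. -/
def indProdOf (M N : TowerMod k) {p q n : ℕ} (h : p + q = n) :
    Ind k h (M.X p) (N.X q) →ₗ[Hecke k n] (indProd M N).X n :=
  DirectSum.lof (Hecke k n) {d : ℕ × ℕ // d.1 + d.2 = n}
    (fun d => Ind k d.2 (M.X d.1.1) (N.X d.1.2)) ⟨(p, q), h⟩

/-- A map out of `M ⊗̂ N` in degree `n` from its restrictions to the summands. -/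
def indProdLift (M N : TowerMod k) {n : ℕ} {Y : Type u} [AddCommGroup Y] [Module k Y]
    [Module (Hecke k n) Y] [IsScalarTower k (Hecke k n) Y]
    (f : ∀ p q : ℕ, (h : p + q = n) → Ind k h (M.X p) (N.X q) →ₗ[Hecke k n] Y) :
    (indProd M N).X n →ₗ[Hecke k n] Y :=
  DirectSum.toModule (Hecke k n) {d : ℕ × ℕ // d.1 + d.2 = n} Y (fun d => f d.1.1 d.1.2 d.2)

/-- The pure element `1 ⊗ (x ⊗ y)` of `M ⊗̂ N`. -/
def indProdMk (M N : TowerMod k) {p q n : ℕ} (h : p + q = n) :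
    M.X p →ₗ[k] N.X q →ₗ[k] (indProd M N).X n :=
  (indMk k h (M.X p) (N.X q)).compr₂ (toK (indProdOf M N h))

theorem indProdMk_smul (M N : TowerMod k) {p q n : ℕ} (h : p + q = n) (a : Hecke k p)
    (b : Hecke k q) (x : M.X p) (y : N.X q) :
    indProdMk M N h (a • x) (b • y)
      = (heckeShift (n := n) 0 (by omega) a * heckeShift (n := n) p (by omega) b) •
        indProdMk M N h x y := by
  change indProdOf M N h (indMk k h _ _ _ _) = _ • indProdOf M N h (indMk k h _ _ _ _)
  rw [indMk_smul, map_smul]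

/-- Functoriality of the induction product. -/
def indProdMap {M M' N N' : TowerMod k} (f : TowerHom M M') (g : TowerHom N N') :
    TowerHom (indProd M N) (indProd M' N') := fun n =>
  indProdLift M N (fun p q h =>
    indLift ((indProdMk M' N' h).compl₁₂ (toK (f p)) (toK (g q))) (by
      intro a b x y
      simp only [LinearMap.compl₁₂_apply, toK_apply, map_smul]
      exact indProdMk_smul M' N' h a b _ _))


/-- Auxiliary: the trilinear map `(y, z, x) ↦ (1 ⊗ (x ⊗ y)) ⊗ z`. -/
def assocTri (M N K : TowerMod k) {p q₁ q₂ n : ℕ} (h : p + q₁ + q₂ = n) :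
    N.X q₁ →ₗ[k] K.X q₂ →ₗ[k] (M.X p →ₗ[k] (indProd (indProd M N) K).X n) :=
  LinearMap.mk₂ k
    (fun y z => ((indProdMk (indProd M N) K h).flip z) ∘ₗ ((indProdMk M N rfl).flip y))
    (fun _ _ _ => by ext; simp) (fun _ _ _ => by ext; simp) (fun _ _ _ => by ext; simp)
    (fun _ _ _ => by ext; simp)

theorem assocTri_apply (M N K : TowerMod k) {p q₁ q₂ n : ℕ} (h : p + q₁ + q₂ = n)
    (x : M.X p) (y : N.X q₁) (z : K.X q₂) :
    assocTri M N K h y z x = indProdMk (indProd M N) K h (indProdMk M N rfl x y) z := rfl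

theorem indProdMk_smul_left (M N : TowerMod k) {p q n : ℕ} (h : p + q = n) (a : Hecke k p)
    (x : M.X p) (y : N.X q) :
    indProdMk M N h (a • x) y = heckeShift (n := n) 0 (by omega) a • indProdMk M N h x y := by
  have := indProdMk_smul M N h a 1 x y
  rwa [one_smul, map_one, mul_one] at this

theorem indProdMk_smul_right (M N : TowerMod k) {p q n : ℕ} (h : p + q = n) (b : Hecke k q)
    (x : M.X p) (y : N.X q) :
    indProdMk M N h x (b • y) = heckeShift (n := n) p (by omega) b • indProdMk M N h x y := by
  have := indProdMk_smul M N h 1 b x y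
  rwa [one_smul, map_one, one_mul] at this

theorem assocTri_smul (M N K : TowerMod k) {p q q₁ q₂ n : ℕ} (hq : q₁ + q₂ = q) (h : p + q = n)
    (a : Hecke k q₁) (b : Hecke k q₂) (y : N.X q₁) (z : K.X q₂) :
    assocTri M N K (p := p) (show p + q₁ + q₂ = n by omega) (a • y) (b • z)
      = heckeShift (n := n) p (by omega)
          (heckeShift (n := q) 0 (by omega) a * heckeShift (n := q) q₁ (by omega) b) •
        assocTri M N K (p := p) (show p + q₁ + q₂ = n by omega) y z := by
  refine LinearMap.ext (fun x => ?_)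
  rw [LinearMap.smul_apply, assocTri_apply, assocTri_apply, indProdMk_smul_right M N,
    indProdMk_smul, map_mul, heckeShift_shift, heckeShift_shift, heckeShift_shift]
  simp only [Nat.zero_add, Nat.add_zero]

/-- A `k`-linear map out of `M ⊗̂ N` in degree `n` from its restrictions to the summands. -/
def indProdLiftK (M N : TowerMod k) {n : ℕ} {Y : Type u} [AddCommGroup Y] [Module k Y]
    (f : ∀ p q : ℕ, (h : p + q = n) → Ind k h (M.X p) (N.X q) →ₗ[k] Y) :
    (indProd M N).X n →ₗ[k] Y :=
  DirectSum.toModule k {d : ℕ × ℕ // d.1 + d.2 = n} Y (fun d => f d.1.1 d.1.2 d.2)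

theorem indProdLiftK_of (M N : TowerMod k) {n : ℕ} {Y : Type u} [AddCommGroup Y] [Module k Y]
    (f : ∀ p q : ℕ, (h : p + q = n) → Ind k h (M.X p) (N.X q) →ₗ[k] Y) {p q : ℕ} (h : p + q = n)
    (w : Ind k h (M.X p) (N.X q)) :
    indProdLiftK M N f (indProdOf M N h w) = f p q h w :=
  DirectSum.toModule_lof k (φ := fun d : {d : ℕ × ℕ // d.1 + d.2 = n} => f d.1.1 d.1.2 d.2)
    ⟨(p, q), h⟩ w

/-- Auxiliary: the map `c' ⊗ (y ⊗ z) ↦ (x ↦ c' ((1 ⊗ (x ⊗ y)) ⊗ z))`. -/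
def assocTriLift (M N K : TowerMod k) {p q q₁ q₂ n : ℕ} (h : p + q = n) (hq : q₁ + q₂ = q) :
    Ind k hq (N.X q₁) (K.X q₂) →ₗ[k] (M.X p →ₗ[k] (indProd (indProd M N) K).X n) :=
  let g := indLiftAlong (h := hq) (heckeShift (n := n) p (by omega))
    (assocTri M N K (p := p) (show p + q₁ + q₂ = n by omega)) (assocTri_smul M N K hq h)
  { toFun := g, map_add' := g.map_add, map_smul' := smul_along _ g }

theorem assocTriLift_mk (M N K : TowerMod k) {p q q₁ q₂ n : ℕ} (h : p + q = n)
    (hq : q₁ + q₂ = q) (c : Hecke k q) (y : N.X q₁) (z : K.X q₂) :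
    assocTriLift M N K h hq (c • indMk k hq _ _ y z)
      = heckeShift (n := n) p (by omega) c •
        assocTri M N K (p := p) (show p + q₁ + q₂ = n by omega) y z := by
  refine ((indLiftAlong (h := hq) (heckeShift (n := n) p (by omega))
    (assocTri M N K (p := p) (show p + q₁ + q₂ = n by omega))
    (assocTri_smul M N K hq h)).map_smulₛₗ c (indMk k hq _ _ y z)).trans ?_
  rw [indLiftAlong_mk]
  rfl

/-- Auxiliary: for `x` in `M_p` and `w` in `(N ⊗̂ K)_q`, the image of `1 ⊗ (x ⊗ w)` under the
associativity map. -/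
def assocBi (M N K : TowerMod k) {p q n : ℕ} (h : p + q = n) :
    M.X p →ₗ[k] (indProd N K).X q →ₗ[k] (indProd (indProd M N) K).X n :=
  (indProdLiftK N K (fun _ _ hq => assocTriLift M N K h hq)).flip

theorem tower_induction (N K : TowerMod k) {q : ℕ} {C : (indProd N K).X q → Prop}
    (hadd : ∀ z w, C z → C w → C (z + w))
    (hmk : ∀ (q₁ q₂ : ℕ) (hq : q₁ + q₂ = q) (c : Hecke k q) y z, C (c • indProdMk N K hq y z))
    (h0 : C 0) (w : (indProd N K).X q) : C w := by
  induction w using DirectSum.induction_on with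
  | zero => exact h0
  | add a b ha hb => exact hadd a b ha hb
  | of d w =>
    change C (indProdOf N K d.2 w)
    induction w using ind_induction with
    | hadd a b ha hb => rw [map_add]; exact hadd _ _ ha hb
    | hmk c y z => rw [map_smul]; exact hmk _ _ d.2 c y z

theorem assocBi_mk (M N K : TowerMod k) {p q q₁ q₂ n : ℕ} (h : p + q = n) (hq : q₁ + q₂ = q)
    (x : M.X p) (c : Hecke k q) (y : N.X q₁) (z : K.X q₂) :
    assocBi M N K h x (c • indProdMk N K hq y z)
      = heckeShift (n := n) p (by omega) c •
        indProdMk (indProd M N) K (by omega) (indProdMk M N rfl x y) z := by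
  have e : c • indProdMk N K hq y z = indProdOf N K hq (c • indMk k hq _ _ y z) := by
    rw [map_smul]; rfl
  rw [e, assocBi, LinearMap.flip_apply, indProdLiftK_of, assocTriLift_mk, LinearMap.smul_apply,
    assocTri_apply]

theorem assocBi_smul (M N K : TowerMod k) {p q n : ℕ} (h : p + q = n) (a : Hecke k p)
    (b : Hecke k q) (x : M.X p) (w : (indProd N K).X q) :
    assocBi M N K h (a • x) (b • w)
      = (heckeShift (n := n) 0 (by omega) a * heckeShift (n := n) p (by omega) b) •
        assocBi M N K h x w := by
  induction w using tower_induction with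
  | h0 => simp
  | hadd z w hz hw => rw [smul_add, map_add, hz, hw, map_add, smul_add]
  | hmk q₁ q₂ hq c y z =>
    rw [smul_smul, assocBi_mk, assocBi_mk, indProdMk_smul_left M N, indProdMk_smul_left,
      heckeShift_shift, heckeShift_comm h, map_mul, smul_smul, smul_smul, mul_assoc, mul_assoc,
      heckeShift_comm h]

/-- The associativity map `M ⊗̂ (N ⊗̂ K) → (M ⊗̂ N) ⊗̂ K`, which sends
`c ⊗ (x ⊗ (c' ⊗ (y ⊗ z)))` to `c c' ⊗ ((1 ⊗ (x ⊗ y)) ⊗ z)`, where `c'` is regarded as an element of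
the algebra in which `c` lies. -/
def indProdAssoc (M N K : TowerMod k) :
    TowerHom (indProd M (indProd N K)) (indProd (indProd M N) K) := fun _ =>
  indProdLift M (indProd N K) (fun _ _ h => indLift (assocBi M N K h) (assocBi_smul M N K h))

end TowerMaps

/-! ## Combinatorics of near-concatenation -/

theorem Comp.near_nil (γ : Comp) : Comp.near γ [] = γ := by
  induction γ with
  | nil => rfl
  | cons a γ ih =>
    cases γ with
    | nil => rfl
    | cons b γ => rw [Comp.near, ih]

theorem Comp.near_eq_nil {γ δ : Comp} : Comp.near γ δ = [] ↔ γ = [] ∧ δ = [] := by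
  match γ, δ with
  | [], δ => simp [Comp.near]
  | [a], [] => simp [Comp.near]
  | [a], b :: δ => simp [Comp.near]
  | a :: a' :: γ, δ => simp [Comp.near]

theorem Comp.size_near (γ δ : Comp) :
    Comp.size (Comp.near γ δ) = Comp.size γ + Comp.size δ := by
  induction γ with
  | nil => simp [Comp.near, Comp.size]
  | cons a γ ih =>
    cases γ with
    | nil =>
      cases δ with
      | nil => simp [Comp.near, Comp.size]
      | cons b δ => simp [Comp.near, Comp.size, Nat.add_assoc]
    | cons b γ =>
      simp only [Comp.near, Comp.size, List.map_cons, List.sum_cons] at ih ⊢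
      rw [ih]
      omega

theorem Comp.numCols_near (γ δ : Comp) :
    Comp.numCols (Comp.near γ δ) = Comp.numCols γ + Comp.numCols δ := by
  induction γ with
  | nil => simp [Comp.near, Comp.numCols]
  | cons a γ ih =>
    cases γ with
    | nil =>
      match δ with
      | [] => simp [Comp.near, Comp.numCols]
      | [b] => simp [Comp.near, Comp.numCols]
      | b :: c :: δ =>
        have := b.pos
        simp only [Comp.near, Comp.numCols, PNat.add_coe]
        omega
    | cons b γ =>
      rw [Comp.near]
      have hne : Comp.near (b :: γ) δ ≠ [] := by simp [Comp.near_eq_nil]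
      obtain ⟨c, ε, hc⟩ := List.exists_cons_of_ne_nil hne
      rw [hc, Comp.numCols, ← hc, ih, Comp.numCols, Nat.add_assoc]

/-- The steps of a ribbon with the step out of its last cell replaced by `right`. -/
def Comp.gluedSteps : Comp → List Step
  | [] => []
  | a :: γ => List.replicate ((a : ℕ) - 1) Step.right ++
      (if γ = [] then Step.right else Step.up) :: Comp.gluedSteps γ

theorem Comp.steps_near (γ δ : Comp) (hδ : δ ≠ []) :
    Comp.steps (Comp.near γ δ) = Comp.gluedSteps γ ++ Comp.steps δ := by
  induction γ with
  | nil => simp [Comp.near, Comp.gluedSteps]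
  | cons a γ ih =>
    cases γ with
    | nil =>
      cases δ with
      | nil => exact absurd rfl hδ
      | cons b δ =>
        have ha := a.pos
        have hb := b.pos
        have e : (a : ℕ) + b - 1 = ((a : ℕ) - 1) + (1 + ((b : ℕ) - 1)) := by omega
        simp only [Comp.near, Comp.steps, Comp.gluedSteps, PNat.add_coe, e, List.replicate_add,
          if_true, List.append_assoc, List.cons_append, List.nil_append, List.replicate_one]
    | cons b γ =>
      have hne : Comp.near (b :: γ) δ ≠ [] := by simp [Comp.near_eq_nil]
      rw [Comp.near, Comp.steps, if_neg hne, ih]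
      change _ = (_ ++ (if b :: γ = [] then Step.right else Step.up) :: Comp.gluedSteps (b :: γ)) ++ _
      rw [if_neg (by simp), List.append_assoc, List.cons_append]

theorem Comp.length_steps (γ : Comp) : γ.steps.length = γ.size := by
  induction γ with
  | nil => rfl
  | cons a γ ih =>
    have ha := a.pos
    simp only [Comp.steps, List.length_append, List.length_replicate, List.length_cons, ih,
      Comp.size, List.map_cons, List.sum_cons]
    change _ = (a : ℕ) + _
    omega

theorem Comp.steps_last (γ : Comp) (c : ℕ) (hc : c + 1 = γ.size) :
    γ.steps.getD c Step.diag = Step.diag := by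
  induction γ generalizing c with
  | nil => simp [Comp.steps]
  | cons a γ ih =>
    have ha := a.pos
    have hs : Comp.size (a :: γ) = (a : ℕ) + Comp.size γ := by simp [Comp.size]
    rw [Comp.steps]
    by_cases hγ : γ = []
    · subst hγ
      have : c = (a : ℕ) - 1 := by rw [hs] at hc; simp [Comp.size] at hc; omega
      subst this
      rw [List.getD_append_right _ _ _ _ (by simp)]
      simp
    · obtain ⟨b, ε, rfl⟩ := List.exists_cons_of_ne_nil hγ
      have hb := b.pos
      have hs' : Comp.size (b :: ε) = (b : ℕ) + Comp.size ε := by simp [Comp.size]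
      rw [List.getD_append_right _ _ _ _ (by simp; omega), List.length_replicate]
      obtain ⟨e, he⟩ : ∃ e, c - ((a : ℕ) - 1) = e + 1 := ⟨c - a, by omega⟩
      rw [he, List.getD_cons_succ]
      exact ih e (by omega)

/-- Elementwise, some steps `diag` are replaced by `right`. -/
def StepsGlue : List Step → List Step → Prop :=
  List.Forall₂ (fun s s' => s' = s ∨ (s = Step.diag ∧ s' = Step.right))

theorem StepsGlue.refl (s : List Step) : StepsGlue s s := by
  induction s with
  | nil => exact List.Forall₂.nil
  | cons a s ih => exact List.Forall₂.cons (Or.inl rfl) ih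

theorem StepsGlue.append {s s' t t' : List Step} (h : StepsGlue s s') (h' : StepsGlue t t') :
    StepsGlue (s ++ t) (s' ++ t') :=
  List.rel_append h h'

theorem stepsGlue_gluedSteps (γ : Comp) : StepsGlue γ.steps γ.gluedSteps := by
  induction γ with
  | nil => exact List.Forall₂.nil
  | cons a γ ih =>
    refine (StepsGlue.refl _).append (List.Forall₂.cons ?_ ih)
    by_cases hγ : γ = [] <;> simp [hγ]

theorem stepsGlue_near (γ δ : Comp) :
    StepsGlue (γ.steps ++ δ.steps) (Comp.steps (Comp.near γ δ)) := by
  by_cases hδ : δ = []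
  · subst hδ
    rw [Comp.near_nil, Comp.steps, List.append_nil]
    exact StepsGlue.refl _
  · rw [Comp.steps_near γ δ hδ]
    exact (stepsGlue_gluedSteps γ).append (StepsGlue.refl _)

theorem StepsGlue.isGluing {L L' : List Comp}
    (h : StepsGlue (L.flatMap Comp.steps) (L'.flatMap Comp.steps)) (N : ℕ) :
    IsGluing N (shape L) (shape L') := by
  intro c _
  rw [shape, shape]
  have hl := h.length_eq
  by_cases hc : c < (L.flatMap Comp.steps).length
  · rw [List.getD_eq_getElem _ _ hc, List.getD_eq_getElem _ _ (hl ▸ hc)]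
    exact h.get hc (hl ▸ hc)
  · rw [List.getD_eq_default _ _ (not_lt.mp hc), List.getD_eq_default _ _ (hl ▸ not_lt.mp hc)]
    exact Or.inl rfl

theorem isGluing_near (N : ℕ) (γ δ : Comp) :
    IsGluing N (shape [γ, δ]) (shape [Comp.near γ δ]) := by
  refine StepsGlue.isGluing ?_ N
  simpa using stepsGlue_near γ δ

theorem isJuxta_cons {p : ℕ} (q : ℕ) (γ : Comp) (L : List Comp) (hp : γ.size = p) :
    IsJuxta p q (shape [γ]) (shape L) (shape (γ :: L)) := by
  subst hp
  have hl := γ.length_steps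
  have h1 : ∀ c, c < γ.size → shape (γ :: L) c = γ.steps.getD c Step.diag := fun c hc => by
    rw [shape, List.flatMap_cons, List.getD_append _ _ _ _ (by omega)]
  have h2 : ∀ c, shape [γ] c = γ.steps.getD c Step.diag := fun c => by simp [shape]
  refine ⟨fun c hc => ?_, fun c hc => ?_, fun c _ => ?_⟩
  · rw [h1 c (by omega), h2]
  · rw [h1 c (by omega), Comp.steps_last γ c hc]
  · rw [shape, shape, List.flatMap_cons, List.getD_append_right _ _ _ _ (by omega), hl,
      Nat.add_sub_cancel_left]

/-- For a sequence `L` of compositions, replace the commas whose index lies in `I` by `⊙`; the first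
comma has index `i`. -/
def glueAt (I : Finset ℕ) : ℕ → List Comp → List Comp
  | _, [] => []
  | i, γ :: L =>
    match glueAt I (i + 1) L with
    | [] => [γ]
    | δ :: L' => if i ∈ I then Comp.near γ δ :: L' else γ :: δ :: L'

theorem glueAt_empty (i : ℕ) (L : List Comp) : glueAt ∅ i L = L := by
  induction L generalizing i with
  | nil => rfl
  | cons γ L ih =>
    rw [glueAt, ih]
    cases L <;> simp

theorem stepsGlue_glueAt {I I' : Finset ℕ} (hI : I ⊆ I') (i : ℕ) (L : List Comp) :
    StepsGlue ((glueAt I i L).flatMap Comp.steps) ((glueAt I' i L).flatMap Comp.steps) ∧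
      (glueAt I i L = [] ↔ glueAt I' i L = []) ∧
      ∀ δ L₁ δ' L₁', glueAt I i L = δ :: L₁ → glueAt I' i L = δ' :: L₁' → δ ≠ [] → δ' ≠ [] := by
  induction L generalizing i with
  | nil => simp [glueAt, StepsGlue]
  | cons γ L ih =>
    obtain ⟨h1, h2, h3⟩ := ih (i + 1)
    rw [glueAt, glueAt]
    rcases hX : glueAt I (i + 1) L with _ | ⟨δ, M⟩ <;>
    rcases hX' : glueAt I' (i + 1) L with _ | ⟨δ', M'⟩
    · refine ⟨StepsGlue.refl _, Iff.rfl, ?_⟩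
      rintro _ _ _ _ ⟨rfl, rfl⟩ ⟨rfl, rfl⟩ hne
      exact hne
    · rw [hX, hX'] at h2; simp at h2
    · rw [hX, hX'] at h2; simp at h2
    · have h3' := h3 δ M δ' M' hX hX'
      rw [hX, hX'] at h1
      simp only [List.flatMap_cons] at h1
      have hn : ∀ ε : Comp, ε = [] → Comp.steps (Comp.near γ ε) = γ.steps := by
        rintro ε rfl; rw [Comp.near_nil]
      by_cases hi : i ∈ I
      · have hi' := hI hi
        simp only [hi, hi', if_true, List.flatMap_cons]
        refine ⟨?_, by simp, ?_⟩
        · by_cases hδ : δ = []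
          · rw [hn δ hδ]
            subst hδ
            rw [Comp.steps, List.nil_append] at h1
            by_cases hδ' : δ' = []
            · rw [hn δ' hδ']
              subst hδ'
              rw [Comp.steps, List.nil_append] at h1
              exact (StepsGlue.refl _).append h1
            · rw [Comp.steps_near _ _ hδ', List.append_assoc]
              exact (stepsGlue_gluedSteps γ).append h1
          · rw [Comp.steps_near _ _ hδ, Comp.steps_near _ _ (h3' hδ), List.append_assoc,
              List.append_assoc]
            exact (StepsGlue.refl _).append h1
        · rintro _ _ _ _ ⟨rfl, rfl⟩ ⟨rfl, rfl⟩ hne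
          rw [Ne, Comp.near_eq_nil] at hne ⊢
          rintro ⟨e1, e2⟩
          exact hne ⟨e1, by_contra fun e3 => h3' e3 e2⟩
      · by_cases hi' : i ∈ I'
        · simp only [hi, hi', if_true, if_false, List.flatMap_cons]
          refine ⟨?_, by simp, ?_⟩
          · by_cases hδ' : δ' = []
            · rw [hn δ' hδ']
              subst hδ'
              rw [Comp.steps, List.nil_append] at h1
              exact (StepsGlue.refl _).append h1
            · rw [Comp.steps_near _ _ hδ', List.append_assoc]
              exact (stepsGlue_gluedSteps γ).append h1
          · rintro _ _ _ _ ⟨rfl, rfl⟩ ⟨rfl, rfl⟩ hne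
            rw [Ne, Comp.near_eq_nil]
            exact fun h => hne h.1
        · simp only [hi, hi', if_false, List.flatMap_cons]
          refine ⟨(StepsGlue.refl _).append h1, by simp, ?_⟩
          rintro _ _ _ _ ⟨rfl, rfl⟩ ⟨rfl, rfl⟩ hne
          exact hne

/-! ## The projective modules of generalized ribbons and the complexes of near-concatenations -/

/-- The `H_N(0)`-module of the generalized ribbon with components `L` (of total size `N`); for a
single composition `γ`, the module `P_γ` is the case `L = [γ]`. -/
abbrev ribbonMod (k : Type u) [Field k] (N : ℕ) (L : List Comp) : Type u := TabMod k N (shape L)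

/-- The near-concatenation map `μ : P_(γ,δ) → P_{γ⊙δ}`. -/
def nearMap (k : Type u) [Field k] (N : ℕ) (γ δ : Comp) :
    ribbonMod k N [γ, δ] →ₗ[Hecke k N] ribbonMod k N [Comp.near γ δ] :=
  glueMap k (isGluing_near N γ δ)

/-- The gluing map `P_{L(I)} → P_{L(I')}` for `I ⊆ I'`. -/
def glueAtMap (k : Type u) [Field k] (N : ℕ) (L : List Comp) {I I' : Finset ℕ} (h : I ⊆ I') :
    ribbonMod k N (glueAt I 0 L) →ₗ[Hecke k N] ribbonMod k N (glueAt I' 0 L) :=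
  glueMap k ((stepsGlue_glueAt h 0 L).1.isGluing N)

/-- The sets of `i` commas of the sequence `L` (numbered from `0`). -/
abbrev CommaSet (L : List Comp) (i : ℕ) : Type :=
  {I : Finset ℕ // I ⊆ Finset.range (L.length - 1) ∧ I.card = i}

/-- The term `C_i(L)` of the cochain complex `C(L)`, the direct sum of the `P_{L(I)}`, `|I| = i`. -/
abbrev ribbonComplex (k : Type u) [Field k] (N : ℕ) (L : List Comp) (i : ℕ) : Type u :=
  ⨁ I : CommaSet L i, ribbonMod k N (glueAt I.1 0 L)

/-- The differential `C_i(L) → C_{i+1}(L)`: on `P_{L(I)}` it is the sum over the commas `j ∉ I` of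
`(-1)^#{i ∈ I | i < j}` times the gluing map at `j`. -/
def ribbonDiff (k : Type u) [Field k] (N : ℕ) (L : List Comp) (i : ℕ) :
    ribbonComplex k N L i →ₗ[Hecke k N] ribbonComplex k N L (i + 1) :=
  DirectSum.toModule (Hecke k N) (CommaSet L i) (ribbonComplex k N L (i + 1)) (fun I =>
    ∑ j : {j : ℕ // j ∈ Finset.range (L.length - 1) \ I.1},
      ((-1 : ℤ) ^ (I.1.filter (fun i => i < j.1)).card) •
        (DirectSum.lof (Hecke k N) (CommaSet L (i + 1)) (fun I => ribbonMod k N (glueAt I.1 0 L))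
            ⟨insert j.1 I.1, by
              have hj := Finset.mem_sdiff.mp j.2
              exact ⟨Finset.insert_subset hj.1 I.2.1, by
                rw [Finset.card_insert_of_notMem hj.2, I.2.2]⟩⟩ ∘ₗ
          glueAtMap k N L (Finset.subset_insert j.1 I.1)))

/-- The identification `P_L = C_0(L)`. -/
def ribbonZero (k : Type u) [Field k] (N : ℕ) (L : List Comp) :
    ribbonMod k N L →ₗ[Hecke k N] ribbonComplex k N L 0 :=
  DirectSum.lof (Hecke k N) (CommaSet L 0) (fun I => ribbonMod k N (glueAt I.1 0 L))
      ⟨∅, Finset.empty_subset _, Finset.card_empty⟩ ∘ₗ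
    glueMap k (st := shape L) (fun _ _ => Or.inl (by rw [glueAt_empty]))

/-- The cohomology `H⁰(C(L))`, the kernel of the differential `C_0(L) → C_1(L)`, as a submodule of
`P_L = C_0(L)`. -/
def ribbonH0 (k : Type u) [Field k] (N : ℕ) (L : List Comp) :
    Submodule (Hecke k N) (ribbonMod k N L) :=
  (LinearMap.ker (ribbonDiff k N L 0)).comap (ribbonZero k N L)

/-! ## The algebra `A` and its ribbon Schur modules -/

/-- The compositions of `n` whose ribbon has `d` columns. -/
abbrev CompIdx (d n : ℕ) : Type := {γ : Comp // γ.numCols = d ∧ γ.size = n}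

/-- The sequences of compositions whose ribbons have `α₁, …, α_r` columns, of total size `N`. -/
abbrev SeqIdx (α : List ℕ) (N : ℕ) : Type :=
  {L : List Comp // L.map Comp.numCols = α ∧ (L.map Comp.size).sum = N}

/-- The component `A_d` of internal degree `d` of `A`; in external degree `n` it is the direct sum of
the `P_γ` over the compositions `γ` of `n` whose ribbon has `d` columns. -/
def algA (k : Type u) [Field k] (d : ℕ) : TowerMod k where
  X n := ⨁ γ : CompIdx d n, ribbonMod k n [γ.1]
  tower n := inferInstanceAs (IsScalarTower k (Hecke k n) (Π₀ γ : CompIdx d n, ribbonMod k n [γ.1]))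

/-- In external degree `N`, the direct sum of the generalized ribbon modules `P_L` over all sequences
`L` with `α₁, …, α_r` columns and total size `N`. -/
def seqSum (k : Type u) [Field k] (α : List ℕ) : TowerMod k where
  X N := ⨁ L : SeqIdx α N, ribbonMod k N L.1
  tower N := inferInstanceAs (IsScalarTower k (Hecke k N) (Π₀ L : SeqIdx α N, ribbonMod k N L.1))

section AlgebraA

variable (k : Type u) [Field k]

/-- The inclusion of `P_γ` into `A_d`. -/
def algAOf {d n : ℕ} (γ : CompIdx d n) : ribbonMod k n [γ.1] →ₗ[Hecke k n] (algA k d).X n :=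
  DirectSum.lof (Hecke k n) (CompIdx d n) (fun γ => ribbonMod k n [γ.1]) γ

/-- The inclusion of the summand `P_L`. -/
def seqSumOf {α : List ℕ} {N : ℕ} (L : SeqIdx α N) :
    ribbonMod k N L.1 →ₗ[Hecke k N] (seqSum k α).X N :=
  DirectSum.lof (Hecke k N) (SeqIdx α N) (fun L => ribbonMod k N L.1) L

/-- The sequence `L` with a composition `γ` put in front of it. -/
def SeqIdx.cons {d p q n : ℕ} {α : List ℕ} (h : p + q = n) (γ : CompIdx d p) (L : SeqIdx α q) :
    SeqIdx (d :: α) n :=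
  ⟨γ.1 :: L.1, by rw [List.map_cons, γ.2.1, L.2.1], by
    rw [List.map_cons, List.sum_cons, γ.2.2, L.2.2, h]⟩

variable {k} in
/-- A `k`-linear map out of `A_d` from its restrictions to the summands. -/
def algALiftK {d n : ℕ} {Y : Type u} [AddCommGroup Y] [Module k Y]
    (f : ∀ γ : CompIdx d n, ribbonMod k n [γ.1] →ₗ[k] Y) : (algA k d).X n →ₗ[k] Y :=
  DirectSum.toModule k (CompIdx d n) Y f

theorem algALiftK_of {d n : ℕ} {Y : Type u} [AddCommGroup Y] [Module k Y]
    (f : ∀ γ : CompIdx d n, ribbonMod k n [γ.1] →ₗ[k] Y) (γ : CompIdx d n)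
    (x : ribbonMod k n [γ.1]) : algALiftK f (algAOf k γ x) = f γ x :=
  DirectSum.toModule_lof k (φ := f) γ x

variable {k} in
/-- A `k`-linear map out of `⊕ P_L` from its restrictions to the summands. -/
def seqSumLiftK {α : List ℕ} {n : ℕ} {Y : Type u} [AddCommGroup Y] [Module k Y]
    (f : ∀ L : SeqIdx α n, ribbonMod k n L.1 →ₗ[k] Y) : (seqSum k α).X n →ₗ[k] Y :=
  DirectSum.toModule k (SeqIdx α n) Y f

theorem seqSumLiftK_of {α : List ℕ} {n : ℕ} {Y : Type u} [AddCommGroup Y] [Module k Y]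
    (f : ∀ L : SeqIdx α n, ribbonMod k n L.1 →ₗ[k] Y) (L : SeqIdx α n)
    (x : ribbonMod k n L.1) : seqSumLiftK f (seqSumOf k L x) = f L x :=
  DirectSum.toModule_lof k (φ := f) L x

/-- The bilinear map given on `P_γ × P_L` by juxtaposition of tableaux, with values in
`P_(γ, L)`. -/
def juxtaBi (d : ℕ) (α : List ℕ) {p q n : ℕ} (h : p + q = n) :
    (algA k d).X p →ₗ[k] (seqSum k α).X q →ₗ[k] (seqSum k (d :: α)).X n :=
  algALiftK (fun γ => (seqSumLiftK (fun L =>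
    ((juxtaMap k h (shape [γ.1]) (shape L.1) (shape (SeqIdx.cons h γ L).1)).compr₂
        (toK (seqSumOf k (SeqIdx.cons h γ L)))).flip)).flip)

theorem juxtaBi_of (d : ℕ) (α : List ℕ) {p q n : ℕ} (h : p + q = n) (γ : CompIdx d p)
    (L : SeqIdx α q) (x : ribbonMod k p [γ.1]) (y : ribbonMod k q L.1) :
    juxtaBi k d α h (algAOf k γ x) (seqSumOf k L y)
      = seqSumOf k (SeqIdx.cons h γ L)
          (juxtaMap k h (shape [γ.1]) (shape L.1) (shape (SeqIdx.cons h γ L).1) x y) := by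
  rw [juxtaBi, algALiftK_of, LinearMap.flip_apply, seqSumLiftK_of]
  rfl

theorem algA_induction {d n : ℕ} {C : (algA k d).X n → Prop} (h0 : C 0)
    (hadd : ∀ x y, C x → C y → C (x + y)) (hof : ∀ γ x, C (algAOf k γ x)) (x) : C x := by
  induction x using DirectSum.induction_on with
  | zero => exact h0
  | add a b ha hb => exact hadd a b ha hb
  | of γ x => exact hof γ x

theorem seqSum_induction {α : List ℕ} {n : ℕ} {C : (seqSum k α).X n → Prop} (h0 : C 0)
    (hadd : ∀ x y, C x → C y → C (x + y)) (hof : ∀ L x, C (seqSumOf k L x)) (x) : C x := by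
  induction x using DirectSum.induction_on with
  | zero => exact h0
  | add a b ha hb => exact hadd a b ha hb
  | of L x => exact hof L x

theorem juxtaBi_smul (d : ℕ) (α : List ℕ) {p q n : ℕ} (h : p + q = n) (a : Hecke k p)
    (b : Hecke k q) (x : (algA k d).X p) (y : (seqSum k α).X q) :
    juxtaBi k d α h (a • x) (b • y)
      = (heckeShift (n := n) 0 (by omega) a * heckeShift (n := n) p (by omega) b) •
        juxtaBi k d α h x y := by
  induction x using algA_induction with
  | h0 => simp
  | hadd x x' hx hx' =>
    rw [smul_add, map_add, LinearMap.add_apply, hx, hx', map_add, LinearMap.add_apply, smul_add]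
  | hof γ x =>
    induction y using seqSum_induction with
    | h0 => simp
    | hadd y y' hy hy' => rw [smul_add, map_add, hy, hy', map_add, smul_add]
    | hof L y =>
      rw [← map_smul, ← map_smul, juxtaBi_of, juxtaBi_of, ← map_smul]
      congr 1
      exact juxtaMap_smul h (isJuxta_cons q γ.1 L.1 γ.2.2) a b x y

/-- The canonical map `A_d ⊗̂ (⊕ P_L) → ⊕ P_(γ, L)`, sending `c ⊗ (T ⊗ U)` to `c` times the
juxtaposition of the tableaux `T` and `U`. -/
def identCons (d : ℕ) (α : List ℕ) :
    TowerHom (indProd (algA k d) (seqSum k α)) (seqSum k (d :: α)) := fun _ =>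
  indProdLift _ _ (fun _ _ h => indLift (juxtaBi k d α h) (juxtaBi_smul k d α h))

/-- A single composition, as a sequence of length one. -/
def SeqIdx.single {d n : ℕ} (γ : CompIdx d n) : SeqIdx [d] n :=
  ⟨[γ.1], by rw [List.map_cons, γ.2.1, List.map_nil], by
    rw [List.map_cons, List.map_nil, List.sum_singleton, γ.2.2]⟩

/-- The canonical map from `A_d` to the direct sum of the `P_L` over the sequences `L` of length one,
the identity on each summand `P_γ`. -/
def identOne (d : ℕ) : TowerHom (algA k d) (seqSum k [d]) := fun n =>
  DirectSum.toModule (Hecke k n) (CompIdx d n) ((seqSum k [d]).X n)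
    (fun γ => seqSumOf k (SeqIdx.single γ))

/-- The iterated induction product `A_{d} ⊗̂ A_{α₁} ⊗̂ ⋯ ⊗̂ A_{α_r}`, where `α = (α₁, …, α_r)`. -/
def algPow : ℕ → List ℕ → TowerMod k
  | d, [] => algA k d
  | d, e :: α => indProd (algA k d) (algPow e α)

/-- The canonical map from `A_{d} ⊗̂ A_{α₁} ⊗̂ ⋯ ⊗̂ A_{α_r}` to the direct sum of the generalized
ribbon modules; it sends a pure tensor of tableaux to their juxtaposition. -/
def ident : (d : ℕ) → (α : List ℕ) → TowerHom (algPow k d α) (seqSum k (d :: α))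
  | d, [] => identOne k d
  | d, e :: α => fun n =>
    identCons k d (e :: α) n ∘ₗ indProdMap (fun _ => LinearMap.id) (ident e α) n

/-- The map `⊕ P_(γ,δ) → A_{a+b}` that is the near-concatenation map
`μ : P_(γ,δ) → P_{γ⊙δ} ⊆ A_{a+b}` on each summand. -/
def nearSum (a b : ℕ) : TowerHom (seqSum k [a, b]) (algA k (a + b)) := fun n =>
  DirectSum.toModule (Hecke k n) (SeqIdx [a, b] n) ((algA k (a + b)).X n) (fun L =>
    match L with
    | ⟨[γ, δ], h⟩ =>
      algAOf k (⟨Comp.near γ δ, by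
        have h1 := h.1
        have h2 := h.2
        simp only [List.map_cons, List.map_nil, List.cons.injEq, and_true] at h1
        simp only [List.map_cons, List.map_nil, List.sum_cons, List.sum_nil, Nat.add_zero] at h2
        rw [Comp.numCols_near, Comp.size_near, h1.1, h1.2, h2]
        exact ⟨rfl, rfl⟩⟩ : CompIdx (a + b) n) ∘ₗ nearMap k n γ δ
    | ⟨[], _⟩ => 0
    | ⟨[_], _⟩ => 0
    | ⟨_ :: _ :: _ :: _, _⟩ => 0)

/-- The multiplication `A_a ⊗̂ A_b → A_{a+b}`: on the summand `P_γ ⊗̂ P_δ = P_(γ,δ)` it is the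
near-concatenation map. -/
def algMul (a b : ℕ) : TowerHom (indProd (algA k a) (algA k b)) (algA k (a + b)) := fun n =>
  nearSum k a b n ∘ₗ ident k a [b] n

/-- The sequence obtained from `(d, α₁, …, α_r)` by adding up the entries number `i` and `i + 1`
(counted from `0`), as a pair of its first entry and the rest. -/
def mergeAt : ℕ → List ℕ → ℕ → ℕ × List ℕ
  | d, [], _ => (d, [])
  | d, e :: α, 0 => (d + e, α)
  | d, e :: α, i + 1 => (d, (mergeAt e α i).1 :: (mergeAt e α i).2)

/-- The map between induction products that multiplies the factors number `i` and `i + 1` (counted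
from `0`) and is the identity on the other factors; it is meaningful for `i` less than the length of
`α` only. -/
def mergeMap : (d : ℕ) → (α : List ℕ) → (i : ℕ) →
    TowerHom (algPow k d α) (algPow k (mergeAt d α i).1 (mergeAt d α i).2)
  | _, [], _ => fun _ => 0
  | d, [e], 0 => algMul k d e
  | d, e :: f :: α, 0 => fun n =>
    indProdMap (algMul k d e) (fun _ => LinearMap.id) n ∘ₗ
      indProdAssoc (algA k d) (algA k e) (algPow k f α) n
  | _, e :: α, i + 1 => indProdMap (fun _ => LinearMap.id) (mergeMap e α i)

/-- The component of external degree `N` of the ribbon Schur module of `A` for the sequence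
`(d, α₁, …, α_r)`: the kernel of the map whose components multiply two adjacent factors. -/
def ribbonSchur (d : ℕ) (α : List ℕ) (N : ℕ) : Submodule (Hecke k N) ((algPow k d α).X N) :=
  LinearMap.ker (LinearMap.pi (fun i : Fin α.length => mergeMap k d α i N))

end AlgebraA

end

end ZeroHecke

namespace ZeroHecke

noncomputable section

/-! ## Elements of the 0-Hecke algebra attached to permutations -/

section PermElements

variable {k : Type u} [Field k] {N : ℕ} {st : ℕ → Step}

/-! All modules involved have bases of tableaux on which the algebra acts by explicit exchanges, and
the proof reduces each claim to a statement about these bases.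

The regular module. Sorting words along cosets shows that `H_N(0)` has dimension at most `N!`
(`hecke_finite`). It acts on the `N!` fillings of the shape without adjacent cells, and the filling
`1` generates them. Hence that module is the regular one (`regMap_bijective`), and the elements
`permElt k w` attached to permutations form a basis of the algebra.

Induction products. A permutation of `p + q` letters is uniquely `u * juxta h v₁ v₂` with `u`
increasing on both blocks, and `permElt` is multiplicative along this factorization
(`permElt_mul_juxta`). So a tableau of a disconnected shape amounts to such a `u` and a tableau on
each part. This produces the inverse of the canonical map (`identCons_bijective`); iteration gives
`ident_bijective`.

The kernel. Under `ident`, multiplying two neighbouring factors becomes gluing at a comma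
(`ident_mergeMap`). Since the numbers of columns are prescribed, the glued sequence determines the
original one (`mergeComp_injective`), so different summands do not interfere and the kernel is
computed inside each `P_L`. There, gluing keeps the tableaux that increase across the comma and
kills those that decrease. A vector killed at every comma is thus a combination of tableaux that
decrease at every comma, and these are the standard tableaux of the concatenation
(`isStd_flatten_iff`). Gluing vertically moves no cell to another row, so the two actions agree
(`upIncl`). The same common kernel is `H⁰` of the complex (`mem_ribbonH0_iff`).

Projectivity. Replacing one `up` step by `diag` and by `right` gives an exact sequence `0 → P_up →
P_diag → P_right → 0` (`range_upIncl_update`). By induction on the number of `up` steps the last two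
terms are projective, the sequence splits, and `P_up` is projective. A shape consisting of rows only
gives a direct summand of the regular module, split off by means of the sum of all row-preserving
fillings (`tabMod_projective_of_no_up`). -/

theorem perm_eq_one_of_strictMono {w : Equiv.Perm (Fin N)} (hw : StrictMono w) : w = 1 :=
  Equiv.ext fun x => congrFun (StrictMono.eq_id hw) x

/-- If the inverse had no descent, it would be increasing, hence trivial. The descent provides a
left factor exchanging `i` and `i + 1` for inductions on length. -/
theorem exists_descent {w : Equiv.Perm (Fin N)} (hw : w ≠ 1) :
    ∃ (i : ℕ) (h : i + 1 < N), w.symm ⟨i + 1, h⟩ < w.symm ⟨i, by omega⟩ := by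
  by_contra! hcon
  apply hw
  have hs : StrictMono w.symm := by
    cases N with
    | zero => exact fun x => x.elim0
    | succ N =>
      refine Fin.strictMono_iff_lt_succ.mpr fun i => ?_
      refine lt_of_le_of_ne (hcon i.1 (by omega)) fun he => ?_
      have := congrArg Fin.val (w.symm.injective he)
      simp at this
  have := perm_eq_one_of_strictMono hs
  rw [← Equiv.symm_symm w, this]
  rfl

/-- The set of inversions of a permutation. -/
def inversions (w : Equiv.Perm (Fin N)) : Finset (Fin N × Fin N) :=
  Finset.univ.filter fun p => p.1 < p.2 ∧ w p.2 < w p.1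

theorem mem_inversions {w : Equiv.Perm (Fin N)} {a b : Fin N} :
    (a, b) ∈ inversions w ↔ a < b ∧ w b < w a := by
  simp [inversions]

/-- Left multiplication by the exchange changes the relative order of the values `i` and `i + 1`
only, which form an inversion of `w`. The inclusion of sets, not just the drop in cardinality, lets
`IsReducedAt` pass to the shorter permutation. -/
theorem inversions_swap_ssubset {w : Equiv.Perm (Fin N)} {i : ℕ} (h : i + 1 < N)
    (hi : w.symm ⟨i + 1, h⟩ < w.symm ⟨i, by omega⟩) :
    inversions (Equiv.swap ⟨i, by omega⟩ ⟨i + 1, h⟩ * w) ⊂ inversions w := by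
  refine Finset.ssubset_iff_subset_ne.mpr ⟨?_, fun he => ?_⟩
  · rintro ⟨a, b⟩ hab
    rw [mem_inversions] at hab ⊢
    refine ⟨hab.1, ?_⟩
    by_contra hlt
    have hlt' : w a < w b := lt_of_le_of_ne (not_lt.mp hlt) (w.injective.ne hab.1.ne)
    refine absurd hab.2 (not_lt.mpr (swap_lt_swap h hlt' ?_).le)
    rintro ⟨e1, e2⟩
    have e1' : w.symm ⟨i, by omega⟩ = a := by rw [Equiv.symm_apply_eq]; exact Fin.ext e1.symm
    have e2' : w.symm ⟨i + 1, h⟩ = b := by rw [Equiv.symm_apply_eq]; exact Fin.ext e2.symm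
    rw [e1', e2'] at hi
    exact absurd hi (not_lt.mpr hab.1.le)
  · have hmem : (w.symm ⟨i + 1, h⟩, w.symm ⟨i, by omega⟩) ∈ inversions w := by
      rw [mem_inversions]
      refine ⟨hi, ?_⟩
      rw [Equiv.apply_symm_apply, Equiv.apply_symm_apply, Fin.lt_def]
      exact Nat.lt_succ_self i
    rw [← he, mem_inversions] at hmem
    have := hmem.2
    simp [Fin.lt_def] at this

/-- `w * T` can be reached from `T` by exchanges of `i` and `i + 1` that each raise `i + 1`. -/
def IsReducedAt (st : ℕ → Step) (T w : Equiv.Perm (Fin N)) : Prop :=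
  ∀ a b, a < b → w b < w a → rowOf st T a < rowOf st T b

variable (k) in
-- Induction on the number of inversions: split off an exchange on the left and multiply by `π̄_i`.
-- The element is chosen before the shape and the tableau, so the same element works for all shapes;
-- identities found in the regular module can therefore be used on every tableau.
theorem exists_permElt (w : Equiv.Perm (Fin N)) :
    ∃ h : Hecke k N, ∀ (st : ℕ → Step) (T : Equiv.Perm (Fin N)), IsStd st T → IsReducedAt st T w →
      IsStd st (w * T) ∧ h • stdVec k st T = stdVec k st (w * T) := by
  generalize hn : (inversions w).card = n
  induction n using Nat.strong_induction_on generalizing w with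
  | h n ih =>
    by_cases hw : w = 1
    · subst hw
      exact ⟨1, fun st T hT _ => by simpa using hT⟩
    · obtain ⟨i, hi, hlt⟩ := exists_descent hw
      have hss := inversions_swap_ssubset hi hlt
      obtain ⟨h, hh⟩ := ih _ (hn ▸ Finset.card_lt_card hss)
        (Equiv.swap ⟨i, by omega⟩ ⟨i + 1, hi⟩ * w) rfl
      refine ⟨heckeBar k N ⟨i, hi⟩ * h, fun st T hT hr => ?_⟩
      obtain ⟨h1, h2⟩ := hh st T hT (fun a b hab hwab => hr a b hab
        (mem_inversions.mp (hss.1 (mem_inversions.mpr ⟨hab, hwab⟩))).2)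
      have e : w * T = Equiv.swap ⟨i, by omega⟩ ⟨i + 1, hi⟩ *
          (Equiv.swap ⟨i, by omega⟩ ⟨i + 1, hi⟩ * w * T) := by
        rw [← mul_assoc, ← mul_assoc, Equiv.swap_mul_self, one_mul]
      -- In the shorter product the entries `i` and `i + 1` occupy the cells where `T` has `w⁻¹(i +
      -- 1)` and `w⁻¹(i)`, so the rows compare as `hr` says for this inversion.
      have hrow : rowOf st (Equiv.swap ⟨i, by omega⟩ ⟨i + 1, hi⟩ * w * T) ⟨i, by omega⟩ <
          rowOf st (Equiv.swap ⟨i, by omega⟩ ⟨i + 1, hi⟩ * w * T) ⟨i + 1, hi⟩ := by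
        rw [mul_assoc, rowOf_swap, rowOf_swap, Equiv.swap_apply_left, Equiv.swap_apply_right]
        refine hr _ _ hlt ?_
        rw [Equiv.apply_symm_apply, Equiv.apply_symm_apply, Fin.lt_def]
        exact Nat.lt_succ_self i
      rw [e]
      refine ⟨isStd_swap h1 i hi hrow, ?_⟩
      rw [mul_smul, h2, heckeBar_smul, barOp_stdVec _ h1, if_neg hrow.not_gt, if_neg hrow.ne]

variable (k) in
/-- An element of `H_N(0)` that acts as `w` wherever this is possible by raising exchanges. -/
def permElt (w : Equiv.Perm (Fin N)) : Hecke k N := (exists_permElt k w).choose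

theorem IsReducedAt.isStd {T w : Equiv.Perm (Fin N)} (hr : IsReducedAt st T w) (hT : IsStd st T) :
    IsStd st (w * T) :=
  -- Standardness does not involve the field, so any field serves here.
  ((exists_permElt ℚ w).choose_spec st T hT hr).1

theorem permElt_smul {T w : Equiv.Perm (Fin N)} (hT : IsStd st T) (hr : IsReducedAt st T w) :
    permElt k w • stdVec k st T = stdVec k st (w * T) :=
  ((exists_permElt k w).choose_spec st T hT hr).2

end PermElements

/-! ## The dimension of the 0-Hecke algebra -/

section Dimension

variable {k : Type u} [Field k]

variable (k) in
/-- The generator `π_i` of `H_{n+1}(0)` for `i < n`, and `1` otherwise. -/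
def genNat (n i : ℕ) : Hecke k (n + 1) := if h : i + 1 < n + 1 then heckeGen k (n + 1) ⟨i, h⟩ else 1

theorem genNat_comm (n : ℕ) {i j : ℕ} (hij : i + 1 < j) :
    genNat k n i * genNat k n j = genNat k n j * genNat k n i := by
  rw [genNat, genNat]
  split_ifs
  · exact heckeGen_comm _ _ hij
  all_goals simp

theorem genNat_idem (n i : ℕ) : genNat k n i * genNat k n i = genNat k n i := by
  rw [genNat]
  split_ifs
  · exact heckeGen_idem _
  · simp

theorem genNat_braid {n i : ℕ} (hi : i + 1 < n) :
    genNat k n i * genNat k n (i + 1) * genNat k n i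
      = genNat k n (i + 1) * genNat k n i * genNat k n (i + 1) := by
  rw [genNat, genNat, dif_pos (by omega), dif_pos (by omega)]
  exact heckeGen_braid _ _ rfl

theorem genNat_eq_shift {n i : ℕ} (hi : i + 1 < n) :
    genNat k n i = heckeShift (n := n + 1) 0 (by omega) (heckeGen k n ⟨i, hi⟩) := by
  rw [genNat, dif_pos (by omega), heckeShift, heckeLift_gen]
  simp

variable (k) in
/-- The element `π_{n-m} π_{n-m+1} ⋯ π_{n-1}` of `H_{n+1}(0)`. -/
def descElt (n : ℕ) : ℕ → Hecke k (n + 1)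
  | 0 => 1
  | m + 1 => genNat k n (n - 1 - m) * descElt n m

theorem genNat_mul_descElt_of_lt {n m i : ℕ} (hi : i + m + 1 < n) :
    genNat k n i * descElt k n m = descElt k n m * genNat k n i := by
  induction m with
  | zero => simp [descElt]
  | succ m ih =>
    rw [descElt, ← mul_assoc, genNat_comm n (by omega), mul_assoc, ih (by omega), mul_assoc]

/-- The factor `π_{i+1}` commutes past the factors of index below `i`, meets `π_i π_{i+1}`, and the
braid relation turns it into a `π_i` on the right, which commutes with all later factors. -/
theorem genNat_mul_descElt_of_gt {n m i : ℕ} (hm : m ≤ n) (hi : n < i + 1 + m) (hin : i + 1 < n) :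
    genNat k n (i + 1) * descElt k n m = descElt k n m * genNat k n i := by
  induction m with
  | zero => omega
  | succ m ih =>
    rw [descElt, ← mul_assoc]
    rcases Nat.lt_or_ge (n - 1 - m) i with h | h
    · rw [← genNat_comm n (by omega), mul_assoc, ih (by omega) (by omega), mul_assoc]
    · obtain ⟨m, rfl⟩ : ∃ l, m = l + 1 := ⟨m - 1, by omega⟩
      have e1 : n - 1 - (m + 1) = i := by omega
      have e2 : n - 1 - m = i + 1 := by omega
      rw [descElt, e1, e2, ← mul_assoc, ← genNat_braid hin, mul_assoc, mul_assoc,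
        genNat_mul_descElt_of_lt (by omega)]
      simp only [mul_assoc]

/-- Compare `i` with the index `n - m` of the first factor: far below it `π_i` commutes through,
just below it the product gets longer, at it idempotence absorbs `π_i`, and above it the braid
relation applies. This mirrors how the exchanges permute the cosets of `S_n` in `S_{n+1}`. -/
theorem genNat_mul_descElt {n m i : ℕ} (hm : m ≤ n) (hi : i < n) :
    ∃ m' ≤ n, ∃ a : Hecke k n,
      genNat k n i * descElt k n m = descElt k n m' * heckeShift (n := n + 1) 0 (by omega) a := by
  rcases lt_trichotomy (i + m + 1) n with h | h | h
  · exact ⟨m, hm, heckeGen k n ⟨i, by omega⟩, by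
      rw [genNat_mul_descElt_of_lt h, genNat_eq_shift]⟩
  · refine ⟨m + 1, by omega, 1, ?_⟩
    rw [descElt, map_one, mul_one, show n - 1 - m = i by omega]
  · obtain ⟨m, rfl⟩ : ∃ l, m = l + 1 := ⟨m - 1, by omega⟩
    by_cases h' : i + m + 1 = n
    · refine ⟨m + 1, hm, 1, ?_⟩
      rw [descElt, map_one, mul_one, show n - 1 - m = i by omega, ← mul_assoc, genNat_idem]
    · obtain ⟨i, rfl⟩ : ∃ l, i = l + 1 := ⟨i - 1, by omega⟩
      exact ⟨m + 1, hm, heckeGen k n ⟨i, by omega⟩, by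
        rw [genNat_mul_descElt_of_gt hm (by omega) (by omega), genNat_eq_shift]⟩

variable (k) in
/-- The map `(a_m) ↦ ∑ π_{n-m} ⋯ π_{n-1} a_m` from `H_n(0)^{n+1}` onto `H_{n+1}(0)`. -/
def descMap (n : ℕ) : (Fin (n + 1) → Hecke k n) →ₗ[k] Hecke k (n + 1) :=
  ∑ m : Fin (n + 1), LinearMap.mulLeft k (descElt k n m) ∘ₗ
    (heckeShift (n := n + 1) 0 (by omega)).toLinearMap ∘ₗ LinearMap.proj m

theorem descMap_apply (n : ℕ) (f : Fin (n + 1) → Hecke k n) :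
    descMap k n f = ∑ m : Fin (n + 1), descElt k n m * heckeShift (n := n + 1) 0 (by omega) (f m) := by
  simp [descMap]

theorem descElt_mul_mem {n m : ℕ} (hm : m ≤ n) (a : Hecke k n) :
    descElt k n m * heckeShift (n := n + 1) 0 (by omega) a ∈ LinearMap.range (descMap k n) := by
  classical
  refine ⟨Pi.single ⟨m, by omega⟩ a, ?_⟩
  rw [descMap_apply, Finset.sum_eq_single ⟨m, by omega⟩]
  · rw [Pi.single_eq_same]
  · intro b _ hb
    rw [Pi.single_eq_of_ne hb, map_zero, mul_zero]
  · simp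

/-- The image is a left ideal by `genNat_mul_descElt`, and it contains `1`. -/
theorem descMap_surjective (n : ℕ) : Function.Surjective (descMap k n) := by
  have key : ∀ h x : Hecke k (n + 1), x ∈ LinearMap.range (descMap k n) →
      h * x ∈ LinearMap.range (descMap k n) := by
    intro h
    induction h using hecke_induction with
    | hk r =>
      intro x hx
      rw [← Algebra.smul_def]
      exact Submodule.smul_mem _ r hx
    | hg i =>
      intro x hx
      rw [heckeBar, sub_mul, one_mul]
      refine Submodule.sub_mem _ ?_ hx
      obtain ⟨f, rfl⟩ := hx
      rw [descMap_apply, Finset.mul_sum]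
      refine Submodule.sum_mem _ fun m _ => ?_
      obtain ⟨m', hm', a, ha⟩ := genNat_mul_descElt (k := k) (n := n) (m := m) (i := i.1)
        (by omega) (by have := i.2; omega)
      rw [genNat, dif_pos i.2] at ha
      rw [← mul_assoc, ha, mul_assoc, ← map_mul]
      exact descElt_mul_mem hm' _
    | hadd a b ha hb => intro x hx; rw [add_mul]; exact Submodule.add_mem _ (ha x hx) (hb x hx)
    | hmul a b ha hb => intro x hx; rw [mul_assoc]; exact ha _ (hb x hx)
  intro h
  have h1 : (1 : Hecke k (n + 1)) ∈ LinearMap.range (descMap k n) := by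
    have := descElt_mul_mem (k := k) (Nat.zero_le n) 1
    rwa [descElt, map_one, one_mul] at this
  have := key h 1 h1
  rwa [mul_one] at this

/-- Each step of the tower multiplies the bound by `n + 1`. Only the upper bound is obtained here;
equality follows from the action on fillings. -/
theorem hecke_finite (n : ℕ) :
    Module.Finite k (Hecke k n) ∧ Module.finrank k (Hecke k n) ≤ n.factorial := by
  induction n with
  | zero =>
    have hs : Function.Surjective (Algebra.linearMap k (Hecke k 0)) := by
      intro h
      induction h using hecke_induction with
      | hk r => exact ⟨r, rfl⟩
      | hg i => exact absurd i.2 (by omega)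
      | hadd a b ha hb =>
        obtain ⟨x, rfl⟩ := ha
        obtain ⟨y, rfl⟩ := hb
        exact ⟨x + y, map_add _ _ _⟩
      | hmul a b ha hb =>
        obtain ⟨x, rfl⟩ := ha
        obtain ⟨y, rfl⟩ := hb
        exact ⟨x * y, map_mul (algebraMap k (Hecke k 0)) _ _⟩
    refine ⟨Module.Finite.of_surjective _ hs, ?_⟩
    have := LinearMap.finrank_le_finrank_of_surjective hs
    simpa using this
  | succ n ih =>
    obtain ⟨h1, h2⟩ := ih
    refine ⟨Module.Finite.of_surjective _ (descMap_surjective n), ?_⟩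
    have := LinearMap.finrank_le_finrank_of_surjective (descMap_surjective (k := k) n)
    rw [Module.finrank_pi_fintype, Finset.sum_const, Finset.card_univ, Fintype.card_fin,
      smul_eq_mul] at this
    rw [Nat.factorial_succ]
    exact this.trans (Nat.mul_le_mul_left _ h2)

instance (n : ℕ) : Module.Finite k (Hecke k n) := (hecke_finite n).1

end Dimension

/-! ## Coefficients, and the inclusion of tableaux with additional vertical conditions -/

section Coefficients

variable {k : Type u} [Field k] {N : ℕ} {st st' : ℕ → Step}

theorem tab_induction {C : TabMod k N st → Prop} (h0 : C 0) (hadd : ∀ x y, C x → C y → C (x + y))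
    (hsmul : ∀ (r : k) x, C x → C (r • x)) (hstd : ∀ T, IsStd st T → C (stdVec k st T))
    (x : TabMod k N st) : C x := by
  induction x using Finsupp.induction_linear with
  | zero => exact h0
  | add f g hf hg => exact hadd f g hf hg
  | single T r =>
    have h := hsmul r _ (hstd T.1 T.2)
    rw [stdVec_pos T.2] at h
    have e : r • (Finsupp.single T (1 : k)) = Finsupp.single T r := by simp
    rw [← e]
    exact h

/-- The coefficient of the filling `T`. -/
def tabCoeff (k : Type u) [Field k] {N : ℕ} (st : ℕ → Step) (T : Equiv.Perm (Fin N)) :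
    TabMod k N st →ₗ[k] k :=
  tabLift fun T' => if T'.1 = T then 1 else 0

theorem tabCoeff_stdVec {T T' : Equiv.Perm (Fin N)} (h : IsStd st T') :
    tabCoeff k st T (stdVec k st T') = if T' = T then 1 else 0 :=
  tabLift_stdVec _ h

theorem sum_tabCoeff (x : TabMod k N st) :
    ∑ T : Equiv.Perm (Fin N), tabCoeff k st T x • stdVec k st T = x := by
  induction x using tab_induction with
  | h0 => simp
  | hadd x y hx hy => simp only [map_add, add_smul, Finset.sum_add_distrib, hx, hy]
  | hsmul r x hx => simp only [map_smul, smul_eq_mul, mul_smul, ← Finset.smul_sum, hx]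
  | hstd T hT => simp [tabCoeff_stdVec hT]

theorem glueMap_stdVec (h : IsGluing N st st') {T : Equiv.Perm (Fin N)} (hT : IsStd st T) :
    glueMap k h (stdVec k st T) = stdVec k st' T :=
  tabLift_stdVec _ hT

/-- Gluing deletes some basis vectors and leaves the coefficients of the surviving ones alone. -/
theorem tabCoeff_glueMap (h : IsGluing N st st') {T : Equiv.Perm (Fin N)} (hT : IsStd st' T)
    (x : TabMod k N st) : tabCoeff k st' T (glueMap k h x) = tabCoeff k st T x := by
  induction x using tab_induction with
  | h0 => simp
  | hadd x y hx hy => simp only [map_add, hx, hy]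
  | hsmul r x hx => rw [tower_linear, map_smul, map_smul, hx]
  | hstd T' hT' =>
    rw [glueMap_stdVec h hT', tabCoeff_stdVec hT']
    by_cases h' : IsStd st' T'
    · rw [tabCoeff_stdVec h']
    · rw [stdVec_neg h', map_zero, if_neg]
      rintro rfl
      exact h' hT

theorem glueMap_surjective (h : IsGluing N st st') : Function.Surjective (glueMap k h) := by
  intro x
  induction x using tab_induction with
  | h0 => exact ⟨0, map_zero _⟩
  | hadd x y hx hy =>
    obtain ⟨x, rfl⟩ := hx
    obtain ⟨y, rfl⟩ := hy
    exact ⟨x + y, map_add _ _ _⟩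
  | hsmul r x hx =>
    obtain ⟨x, rfl⟩ := hx
    exact ⟨r • x, tower_linear _ _ _⟩
  | hstd T hT => exact ⟨stdVec k st T, glueMap_stdVec h (h.isStd hT)⟩

/-! ### Vertical gluing, and kernels and images in terms of coefficients -/

/-- `st'` is obtained from `st` by gluing some consecutive components vertically. -/
def IsUpGluing (N : ℕ) (st st' : ℕ → Step) : Prop :=
  ∀ c, c + 1 < N → st' c = st c ∨ (st c = Step.diag ∧ st' c = Step.up)

theorem IsUpGluing.isStd (h : IsUpGluing N st st') {T : Equiv.Perm (Fin N)} (hT : IsStd st' T) :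
    IsStd st T := by
  intro c hc
  rcases h c hc with e | ⟨e, -⟩
  · rw [← e]; exact hT c hc
  · simp [e]

/-- Both `diag` and `up` lead into the next row, so replacing one by the other does not affect row
numbers, unlike horizontal gluing. -/
theorem IsUpGluing.row_eq (h : IsUpGluing N st st') {c : ℕ} (hc : c < N) :
    row st' c = row st c := by
  classical
  rw [row, row]
  congr 1
  refine Finset.filter_congr fun q hq => ?_
  rw [Finset.mem_range] at hq
  rcases h q (by omega) with e | ⟨e, e'⟩
  · rw [e]
  · rw [e, e']; simp

theorem IsUpGluing.rowOf_eq (h : IsUpGluing N st st') (T : Equiv.Perm (Fin N)) (x : Fin N) :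
    rowOf st' T x = rowOf st T x :=
  h.row_eq (T.symm x).2

/-- The inclusion of the tableaux of a shape glued vertically. -/
def upIncl (k : Type u) [Field k] {N : ℕ} {st st' : ℕ → Step} (h : IsUpGluing N st st') :
    TabMod k N st' →ₗ[Hecke k N] TabMod k N st :=
  heckeLinear (tabLift (fun T => stdVec k st T.1)) (by
    intro i x
    rw [heckeBar_smul, heckeBar_smul]
    suffices hs : tabLift (fun T => stdVec k st T.1) ∘ₗ barOp k N st' i
        = barOp k N st i ∘ₗ tabLift (fun T => stdVec k st T.1) from LinearMap.congr_fun hs x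
    refine tab_hom_ext (fun T hT => ?_)
    rw [LinearMap.comp_apply, LinearMap.comp_apply, tabLift_stdVec _ hT, barOp_stdVec i hT,
      barOp_stdVec i (h.isStd hT), h.rowOf_eq, h.rowOf_eq]
    -- The three cases coincide for the two shapes, and in the exchange case `isStd_swap` keeps the
    -- stronger standardness; hence the span of the tableaux of `st'` is stable.
    split_ifs with h1 h2
    · rw [map_neg, tabLift_stdVec _ hT]
    · rw [map_zero]
    · rw [tabLift_stdVec _ (isStd_swap hT i.1 i.2 (by rw [h.rowOf_eq, h.rowOf_eq]; omega))])

theorem upIncl_stdVec (h : IsUpGluing N st st') {T : Equiv.Perm (Fin N)} (hT : IsStd st' T) :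
    upIncl k h (stdVec k st' T) = stdVec k st T :=
  tabLift_stdVec _ hT

theorem tabCoeff_upIncl (h : IsUpGluing N st st') (T : Equiv.Perm (Fin N)) (x : TabMod k N st') :
    tabCoeff k st T (upIncl k h x) = tabCoeff k st' T x := by
  induction x using tab_induction with
  | h0 => simp
  | hadd x y hx hy => simp only [map_add, hx, hy]
  | hsmul r x hx => rw [tower_linear, map_smul, map_smul, hx]
  | hstd T' hT' => rw [upIncl_stdVec h hT', tabCoeff_stdVec hT', tabCoeff_stdVec (h.isStd hT')]

theorem tabCoeff_of_not_isStd {T : Equiv.Perm (Fin N)} (hT : ¬ IsStd st T) (x : TabMod k N st) :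
    tabCoeff k st T x = 0 := by
  induction x using tab_induction with
  | h0 => simp
  | hadd x y hx hy => rw [map_add, hx, hy, add_zero]
  | hsmul r x hx => rw [map_smul, hx, smul_zero]
  | hstd T' hT' =>
    rw [tabCoeff_stdVec hT', if_neg]
    rintro rfl
    exact hT hT'

theorem upIncl_injective (h : IsUpGluing N st st') : Function.Injective (upIncl k h) := by
  intro x y hxy
  rw [← sum_tabCoeff x, ← sum_tabCoeff y]
  simp only [← tabCoeff_upIncl h, hxy]

/-- The image is spanned by part of the basis, so membership means that the remaining coefficients
vanish. Together with `glueMap_eq_zero_iff` this turns comparisons of images and kernels into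
comparisons of sets of tableaux. -/
theorem mem_range_upIncl (h : IsUpGluing N st st') (x : TabMod k N st) :
    x ∈ LinearMap.range (upIncl k h) ↔
      ∀ T, IsStd st T → ¬ IsStd st' T → tabCoeff k st T x = 0 := by
  constructor
  · rintro ⟨y, rfl⟩ T - hT'
    rw [tabCoeff_upIncl, tabCoeff_of_not_isStd hT']
  · intro hx
    refine ⟨∑ T, tabCoeff k st T x • stdVec k st' T, ?_⟩
    conv_rhs => rw [← sum_tabCoeff x]
    rw [map_sum]
    refine Finset.sum_congr rfl fun T _ => ?_
    rw [tower_linear]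
    by_cases hT' : IsStd st' T
    · rw [upIncl_stdVec h hT']
    · by_cases hT : IsStd st T
      · rw [hx T hT hT', zero_smul, zero_smul]
      · rw [stdVec_neg hT, stdVec_neg hT', map_zero]

theorem glueMap_eq_zero_iff (h : IsGluing N st st') (x : TabMod k N st) :
    glueMap k h x = 0 ↔ ∀ T, IsStd st' T → tabCoeff k st T x = 0 := by
  constructor
  · intro hx T hT
    rw [← tabCoeff_glueMap h hT, hx, map_zero]
  · intro hx
    rw [← sum_tabCoeff (glueMap k h x)]
    refine Finset.sum_eq_zero fun T _ => ?_
    by_cases hT : IsStd st' T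
    · rw [tabCoeff_glueMap h hT, hx T hT, zero_smul]
    · rw [stdVec_neg hT, smul_zero]

end Coefficients

/-! ## The regular representation -/

section Regular

variable {k : Type u} [Field k] {N : ℕ} {st : ℕ → Step}

/-- The shape in which no two cells are adjacent. -/
def allDiag : ℕ → Step := fun _ => Step.diag

theorem isStd_allDiag (T : Equiv.Perm (Fin N)) : IsStd allDiag T :=
  fun _ _ => ⟨fun h => (nomatch h), fun h => (nomatch h)⟩

theorem row_allDiag (c : ℕ) : row allDiag c = c := by
  simp [row, allDiag]

theorem rowOf_allDiag (T : Equiv.Perm (Fin N)) (x : Fin N) : rowOf allDiag T x = (T.symm x).1 :=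
  row_allDiag _

/-- Without adjacent cells every cell has its own row, and in the filling `1` larger entries lie
higher, so every permutation is reduced there. -/
theorem permElt_smul_one (w : Equiv.Perm (Fin N)) :
    permElt k w • stdVec k allDiag 1 = stdVec k allDiag w := by
  rw [permElt_smul (isStd_allDiag 1), mul_one]
  intro a b hab _
  rw [rowOf_allDiag, rowOf_allDiag]
  exact hab

/-- The map `a ↦ a • 1` from `H_N(0)` to the module of all fillings. -/
def regMap (k : Type u) [Field k] (N : ℕ) : Hecke k N →ₗ[Hecke k N] TabMod k N allDiag :=
  LinearMap.toSpanSingleton (Hecke k N) _ (stdVec k allDiag 1)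

theorem regMap_apply (a : Hecke k N) : regMap k N a = a • stdVec k allDiag 1 := rfl

theorem regMap_surjective : Function.Surjective (regMap k N) := by
  intro x
  refine ⟨∑ T, tabCoeff k allDiag T x • permElt k T, ?_⟩
  rw [map_sum]
  conv_rhs => rw [← sum_tabCoeff x]
  refine Finset.sum_congr rfl fun T _ => ?_
  rw [tower_linear, regMap_apply, permElt_smul_one]

theorem finrank_allDiag : Module.finrank k (TabMod k N allDiag) = N.factorial := by
  have h : Module.finrank k (Tab N allDiag →₀ k) = Nat.card (Tab N allDiag) := by
    have := Fintype.ofFinite (Tab N allDiag)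
    rw [Module.finrank_finsupp_self, Nat.card_eq_fintype_card]
  refine Eq.trans h ?_
  rw [Nat.card_congr (Equiv.subtypeUnivEquiv (fun T => isStd_allDiag (N := N) T)),
    Nat.card_eq_fintype_card, Fintype.card_perm, Fintype.card_fin]

instance : Module.Finite k (TabMod k N st) :=
  inferInstanceAs (Module.Finite k (Tab N st →₀ k))

/-- A surjection from a space of dimension at most `N!` onto one of dimension `N!`. -/
theorem regMap_bijective : Function.Bijective (regMap k N) := by
  refine ⟨?_, regMap_surjective⟩
  have hs : Function.Surjective (toK (regMap k N)) := regMap_surjective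
  have h1 := LinearMap.finrank_le_finrank_of_surjective hs
  rw [finrank_allDiag] at h1
  have h2 : Module.finrank k (Hecke k N) = Module.finrank k (TabMod k N allDiag) := by
    rw [finrank_allDiag]
    exact le_antisymm (hecke_finite N).2 h1
  exact (LinearMap.injective_iff_surjective_of_finrank_eq_finrank h2).mpr hs

/-- The module of all fillings is the regular representation. -/
def regEquiv (k : Type u) [Field k] (N : ℕ) : Hecke k N ≃ₗ[Hecke k N] TabMod k N allDiag :=
  LinearEquiv.ofBijective (regMap k N) regMap_bijective

theorem regMap_permElt (w : Equiv.Perm (Fin N)) :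
    regMap k N (permElt k w) = stdVec k allDiag w := by
  rw [regMap_apply, permElt_smul_one]

theorem hecke_eq_sum_permElt (a : Hecke k N) :
    ∃ r : Equiv.Perm (Fin N) → k, a = ∑ w, r w • permElt k w := by
  refine ⟨fun w => tabCoeff k allDiag w (regMap k N a), regMap_bijective.1 ?_⟩
  rw [map_sum]
  conv_lhs => rw [← sum_tabCoeff (regMap k N a)]
  refine Finset.sum_congr rfl fun T _ => ?_
  rw [tower_linear, regMap_permElt]

end Regular

/-! ## Projectivity of the modules of tableaux -/

section Projective

variable {k : Type u} [Field k] {N : ℕ} {st : ℕ → Step}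

open Classical in
/-- The sum of all fillings that keep every entry of the filling `1` in its row. -/
def rowSum (k : Type u) [Field k] (N : ℕ) (st : ℕ → Step) : TabMod k N allDiag :=
  ∑ w ∈ Finset.univ.filter (fun w : Equiv.Perm (Fin N) => ∀ x, row st (w x) = row st x),
    stdVec k allDiag w

/-- The summands pair off as `w` and `s * w`. On a pair, `π̄_i` sends the filling with `i` before `i
+ 1` to its partner and the partner to its own negative. The step `right` at `i` ensures that `s`
preserves rows, so partners belong to the same sum. -/
theorem heckeBar_smul_rowSum {i : ℕ} (hi : i + 1 < N) (hst : st i = Step.right) :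
    heckeBar k N ⟨i, hi⟩ • rowSum k N st = 0 := by
  classical
  rw [rowSum, heckeBar_smul, map_sum]
  set s : Equiv.Perm (Fin N) := Equiv.swap ⟨i, by omega⟩ ⟨i + 1, hi⟩ with hs
  have hss : ∀ w, s * (s * w) = w := fun w => by
    rw [← mul_assoc, hs, Equiv.swap_mul_self, one_mul]
  have hrow : ∀ x, row st (s x) = row st x := fun x => by
    rw [hs, Equiv.swap_apply_def]
    split_ifs with h1 h2
    · rw [h1]; exact row_succ_right hst
    · rw [h2]; exact (row_succ_right hst).symm
    · rfl
  have hne : ∀ w, s * w ≠ w := fun w he => by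
    have h1 : s = 1 := mul_eq_right.mp he
    have h2 : s ⟨i, by omega⟩ = ⟨i + 1, hi⟩ := Equiv.swap_apply_left _ _
    rw [h1] at h2
    simp at h2
  refine Finset.sum_involution (fun w _ => s * w) (fun w hw => ?_) (fun w _ _ => hne w)
    (fun w hw => ?_) (fun w _ => hss w)
  · rw [barOp_stdVec _ (isStd_allDiag _), barOp_stdVec _ (isStd_allDiag _)]
    simp only [← hs, hss]
    rw [hs, rowOf_swap, rowOf_swap, Equiv.swap_apply_left, Equiv.swap_apply_right]
    rcases lt_trichotomy (rowOf allDiag w ⟨i, by omega⟩) (rowOf allDiag w ⟨i + 1, hi⟩)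
      with h | h | h
    · rw [if_neg h.not_gt, if_neg h.ne, if_pos h, ← hs, add_neg_cancel]
    · rw [rowOf_allDiag, rowOf_allDiag, ← Fin.ext_iff] at h
      have := w.symm.injective h
      simp at this
    · rw [if_pos h, if_neg h.not_gt, if_neg h.ne, neg_add_cancel]
  · simp only [Finset.mem_filter, Finset.mem_univ, true_and] at hw ⊢
    intro x
    rw [Equiv.Perm.mul_apply, hrow, hw]

theorem isGluing_allDiag (h : ∀ c, c + 1 < N → st c ≠ Step.up) : IsGluing N allDiag st := by
  intro c hc
  have := h c hc
  rcases e : st c with _ | _ | _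
  · exact Or.inr ⟨rfl, rfl⟩
  · exact absurd e this
  · exact Or.inl rfl

/-- A filling that keeps all entries in their rows and increases along rows is increasing, so only
the filling `1` survives. -/
theorem glueMap_rowSum (h : ∀ c, c + 1 < N → st c ≠ Step.up) :
    glueMap k (isGluing_allDiag h) (rowSum k N st) = stdVec k st 1 := by
  classical
  rw [rowSum, map_sum, Finset.sum_eq_single 1]
  · rw [glueMap_stdVec _ (isStd_allDiag _)]
  · intro w hw hne
    rw [glueMap_stdVec _ (isStd_allDiag _)]
    refine stdVec_neg fun hstd => hne (perm_eq_one_of_strictMono fun a b hab => ?_)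
    simp only [Finset.mem_filter, Finset.mem_univ, true_and] at hw
    rcases (row_mono st hab.le).eq_or_lt with he | hlt
    · exact hstd.lt_of_row_eq hab b.2 he
    · rw [← hw a, ← hw b] at hlt
      exact row_lt_of_lt hlt
  · intro h1
    simp at h1

/-- A descent of `w` at `c` means that `w` is longer than `w s_c`. So `w` is obtained from the
filling `1` by applying `π̄_c` first, and elements annihilated by `π̄_c` will detect such fillings.
-/
theorem permElt_smul_swap {w : Equiv.Perm (Fin N)} {c : ℕ} (hc : c + 1 < N)
    (hw : w ⟨c + 1, hc⟩ < w ⟨c, by omega⟩) :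
    permElt k (w * Equiv.swap ⟨c, by omega⟩ ⟨c + 1, hc⟩) •
      (heckeBar k N ⟨c, hc⟩ • stdVec k allDiag 1) = stdVec k allDiag w := by
  rw [heckeBar_smul, barOp_stdVec _ (isStd_allDiag _), rowOf_allDiag, rowOf_allDiag]
  simp only [show ∀ x : Fin N, (Equiv.symm 1 : Equiv.Perm (Fin N)) x = x from fun _ => rfl]
  rw [if_neg (Nat.not_succ_lt_self), if_neg (Nat.succ_ne_self c).symm, mul_one,
    permElt_smul (isStd_allDiag _), mul_assoc, Equiv.swap_mul_self, mul_one]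
  intro a b hab hba
  rw [rowOf_allDiag, rowOf_allDiag, Equiv.symm_swap]
  refine swap_lt_swap hc hab ?_
  rintro ⟨e1, e2⟩
  have e3 : a = ⟨c, Nat.lt_of_succ_lt hc⟩ := Fin.ext e1
  have e4 : b = ⟨c + 1, hc⟩ := Fin.ext e2
  rw [e3, e4, Equiv.Perm.mul_apply, Equiv.Perm.mul_apply, Equiv.swap_apply_left,
    Equiv.swap_apply_right] at hba
  exact absurd hw hba.not_gt

/-- The gluing map exhibits the module as a quotient of the regular one. A section comes from right
multiplication by the row sum: this kills the fillings killed by gluing, hence factors through the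
quotient, and gluing sends the row sum back to the generator. -/
theorem tabMod_projective_of_no_up (h : ∀ c, c + 1 < N → st c ≠ Step.up) :
    Module.Projective (Hecke k N) (TabMod k N st) := by
  have hg := isGluing_allDiag h
  -- In terms of the regular representation this is right multiplication by the element of the
  -- algebra corresponding to `rowSum`.
  let ρ : TabMod k N allDiag →ₗ[Hecke k N] TabMod k N allDiag :=
    LinearMap.toSpanSingleton (Hecke k N) _ (rowSum k N st) ∘ₗ (regEquiv k N).symm.toLinearMap
  have hρ : ∀ a : Hecke k N, ρ (a • stdVec k allDiag 1) = a • rowSum k N st := fun a => by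
    have e : (regEquiv k N).symm (a • stdVec k allDiag 1) = a := (regEquiv k N).symm_apply_apply a
    change (regEquiv k N).symm (a • stdVec k allDiag 1) • rowSum k N st = _
    rw [e]
  -- Without `up` steps a filling fails to be standard only through a descent inside a row, at a
  -- cell `c` with step `right`. It is then a multiple of `π̄_c • 1`, and `π̄_c` annihilates the row
  -- sum.
  have hker : ∀ w, ¬ IsStd st w → ρ (stdVec k allDiag w) = 0 := by
    intro w hw
    obtain ⟨c, hc, hst, hlt⟩ : ∃ (c : ℕ) (hc : c + 1 < N), st c = Step.right ∧
        w ⟨c + 1, hc⟩ < w ⟨c, by omega⟩ := by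
      by_contra! hcon
      refine hw fun c hc => ⟨fun hs => lt_of_le_of_ne (hcon c hc hs) fun he => ?_,
        fun hs => absurd hs (h c hc)⟩
      have := congrArg Fin.val (w.injective he)
      simp at this
    rw [← permElt_smul_swap hc hlt, map_smul, hρ, heckeBar_smul_rowSum hc hst, smul_zero]
  -- This is the factorization of `ρ` through the gluing map. Its equivariance is inherited from `ρ`
  -- because gluing is surjective.
  let σ₀ : TabMod k N st →ₗ[k] TabMod k N allDiag := tabLift fun T => ρ (stdVec k allDiag T.1)
  have hσ₀ : ∀ x, σ₀ (glueMap k hg x) = ρ x := by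
    intro x
    induction x using tab_induction with
    | h0 => simp
    | hadd x y hx hy => simp only [map_add, hx, hy]
    | hsmul r x hx => rw [tower_linear, tower_linear, map_smul, hx]
    | hstd T hT =>
      rw [glueMap_stdVec hg hT]
      by_cases hT' : IsStd st T
      · exact tabLift_stdVec _ hT'
      · rw [stdVec_neg hT', map_zero, hker T hT']
  let σ : TabMod k N st →ₗ[Hecke k N] TabMod k N allDiag := heckeLinear σ₀ (by
    intro i x
    obtain ⟨x, rfl⟩ := glueMap_surjective hg x
    rw [← map_smul, hσ₀, hσ₀, map_smul])
  have : Module.Projective (Hecke k N) (TabMod k N allDiag) :=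
    Module.Projective.of_equiv' (regEquiv k N)
  -- By surjectivity the splitting is tested on glued images of `a • 1`, where both sides are `a`
  -- times the tableau `1`.
  refine Module.Projective.of_split σ (glueMap k hg) (LinearMap.ext fun x => ?_)
  obtain ⟨x, rfl⟩ := glueMap_surjective hg x
  obtain ⟨a, rfl⟩ := regMap_surjective x
  change glueMap k hg (σ₀ (glueMap k hg (regMap k N a))) = glueMap k hg (regMap k N a)
  rw [hσ₀, regMap_apply, hρ, map_smul, map_smul, glueMap_rowSum h,
    glueMap_stdVec hg (isStd_allDiag _)]

/-! ### Removing one vertical adjacency -/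

theorem isUpGluing_update (c : ℕ) (h : st c = Step.up) :
    IsUpGluing N (Function.update st c Step.diag) st := by
  intro d _
  by_cases hd : d = c
  · subst hd; simp [h]
  · rw [Function.update_of_ne hd]; exact Or.inl rfl

theorem isGluing_update (c : ℕ) :
    IsGluing N (Function.update st c Step.diag) (Function.update st c Step.right) := by
  intro d _
  by_cases hd : d = c
  · subst hd; simp
  · rw [Function.update_of_ne hd, Function.update_of_ne hd]; exact Or.inl rfl

/-- A tableau of the shape cut after the cell `c` either decreases or increases from `c` to `c + 1`.
The first kind spans the image of the inclusion, and gluing horizontally kills exactly this kind. -/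
theorem range_upIncl_update {c : ℕ} (hc : c + 1 < N) (h : st c = Step.up) :
    LinearMap.range (upIncl k (N := N) (isUpGluing_update c h)) =
      LinearMap.ker (glueMap k (N := N) (isGluing_update (st := st) c)) := by
  ext x
  rw [mem_range_upIncl, LinearMap.mem_ker, glueMap_eq_zero_iff]
  refine ⟨fun hx T hT => hx T ((isGluing_update c).isStd hT) fun hT' => ?_,
    fun hx T hT hT' => hx T fun d hd => ?_⟩
  · exact absurd ((hT c hc).1 (by simp)) ((hT' c hc).2 h).not_gt
  · by_cases hdc : d = c
    · subst hdc
      refine ⟨fun _ => ?_, fun e => by simp at e⟩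
      by_contra hlt
      refine hT' fun e he => ?_
      by_cases hed : e = d
      · subst hed
        rw [h]
        refine ⟨fun e => (nomatch e), fun _ => lt_of_le_of_ne (not_lt.mp hlt) fun he' => ?_⟩
        have := congrArg Fin.val (T.injective he')
        simp at this
      · have := hT e he
        rwa [Function.update_of_ne hed] at this
    · have := hT d hd
      rwa [Function.update_of_ne hdc] at this ⊢

/-- The modules of standard tableaux of generalized ribbons are projective. -/
theorem tabMod_projective (k : Type u) [Field k] (N : ℕ) (st : ℕ → Step) :
    Module.Projective (Hecke k N) (TabMod k N st) := by
  classical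
  -- The induction is on the number of relevant `up` steps; replacing one of them by `diag` or
  -- `right` lowers it by one.
  generalize hn : ((Finset.range N).filter fun c => c + 1 < N ∧ st c = Step.up).card = n
  induction n generalizing st with
  | zero =>
    refine tabMod_projective_of_no_up fun c hc hup => ?_
    rw [Finset.card_eq_zero] at hn
    have : c ∈ (∅ : Finset ℕ) := hn ▸ Finset.mem_filter.mpr
      ⟨Finset.mem_range.mpr (by omega), hc, hup⟩
    simp at this
  | succ n ih =>
    obtain ⟨c, hcm⟩ := Finset.card_pos.mp (hn ▸ Nat.succ_pos n :
      0 < ((Finset.range N).filter fun c => c + 1 < N ∧ st c = Step.up).card)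
    obtain ⟨hcN, hc, hup⟩ : c < N ∧ c + 1 < N ∧ st c = Step.up := by simpa using hcm
    have hcount : ∀ s, s ≠ Step.up → ((Finset.range N).filter fun d =>
        d + 1 < N ∧ Function.update st c s d = Step.up).card = n := by
      intro s hs
      have : ((Finset.range N).filter fun d => d + 1 < N ∧ Function.update st c s d = Step.up)
          = ((Finset.range N).filter fun c => c + 1 < N ∧ st c = Step.up).erase c := by
        ext d
        by_cases hd : d = c
        · subst hd; simp [hs]
        · simp [hd]
      rw [this, Finset.card_erase_of_mem hcm, hn, Nat.add_sub_cancel]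
    have hD := ih (Function.update st c Step.diag) (hcount _ (by simp))
    have hR := ih (Function.update st c Step.right) (hcount _ (by simp))
    -- The target is projective by `hR`, so gluing has a section `s`. The map `p` below then
    -- projects onto the kernel, making the `up` shape a direct summand of the `diag` shape, which
    -- is projective by `hD`.
    obtain ⟨s, hs⟩ := (glueMap k (N := N) (isGluing_update (st := st) c)).exists_rightInverse_of_surjective
      (LinearMap.range_eq_top.mpr (glueMap_surjective _))
    have hinj := upIncl_injective (k := k) (N := N) (isUpGluing_update c hup)
    have hrange := range_upIncl_update (k := k) hc hup
    let p : TabMod k N (Function.update st c Step.diag) →ₗ[Hecke k N]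
        TabMod k N (Function.update st c Step.diag) :=
      LinearMap.id - s ∘ₗ glueMap k (isGluing_update c)
    have hp : ∀ x, p x ∈ LinearMap.range (upIncl k (N := N) (isUpGluing_update c hup)) := by
      intro x
      have := LinearMap.congr_fun hs (glueMap k (isGluing_update c) x)
      rw [hrange, LinearMap.mem_ker]
      simp only [LinearMap.comp_apply, LinearMap.id_apply] at this
      simp [p, this]
    refine Module.Projective.of_split (upIncl k (isUpGluing_update c hup))
      ((LinearEquiv.ofInjective _ hinj).symm.toLinearMap ∘ₗ p.codRestrict _ hp)
      (LinearMap.ext fun x => ?_)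
    have hx : glueMap k (isGluing_update c) (upIncl k (isUpGluing_update c hup) x) = 0 := by
      rw [← LinearMap.mem_ker, ← hrange]
      exact ⟨x, rfl⟩
    simp only [LinearMap.comp_apply, LinearMap.id_apply, LinearEquiv.coe_coe]
    rw [LinearEquiv.symm_apply_eq]
    ext
    simp [p, hx]

end Projective

/-! ## Maps between direct sums and out of induction products -/

section DirectSums

variable {R ι κ : Type*} [Ring R] [DecidableEq ι] [DecidableEq κ] {M : ι → Type*} {M' : κ → Type*}
  [∀ i, AddCommGroup (M i)] [∀ i, Module R (M i)] [∀ j, AddCommGroup (M' j)] [∀ j, Module R (M' j)]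
  {φ : ι → κ} {f : ∀ i, M i →ₗ[R] M' (φ i)} {F : (⨁ i, M i) →ₗ[R] (⨁ j, M' j)}

/-- Injectivity of `φ` ensures that no two summands meet in the target, so nothing cancels and the
kernel can be computed summand by summand. -/
theorem directSum_map_apply (hφ : Function.Injective φ)
    (hF : ∀ i x, F (DirectSum.lof R ι M i x) = DirectSum.lof R κ M' (φ i) (f i x))
    (x : ⨁ i, M i) (i : ι) : F x (φ i) = f i (x i) := by
  induction x using DirectSum.induction_on with
  | zero => simp
  | add x y hx hy => rw [map_add, DirectSum.add_apply, DirectSum.add_apply, hx, hy, map_add]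
  | of j y =>
    have h := hF j y
    rw [DirectSum.lof_eq_of, DirectSum.lof_eq_of] at h
    rw [h]
    by_cases hij : j = i
    · subst hij
      rw [DirectSum.of_eq_same, DirectSum.of_eq_same]
    · rw [DirectSum.of_eq_of_ne _ _ _ (Ne.symm hij),
        DirectSum.of_eq_of_ne _ _ _ (fun e => hij (hφ e.symm)), map_zero]

theorem directSum_map_eq_zero_iff (hφ : Function.Injective φ)
    (hF : ∀ i x, F (DirectSum.lof R ι M i x) = DirectSum.lof R κ M' (φ i) (f i x))
    (x : ⨁ i, M i) : F x = 0 ↔ ∀ i, f i (x i) = 0 := by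
  constructor
  · intro hx i
    rw [← directSum_map_apply hφ hF, hx, DirectSum.zero_apply]
  · intro hx
    classical
    rw [← DirectSum.sum_support_of x, map_sum]
    refine Finset.sum_eq_zero fun i _ => ?_
    rw [← DirectSum.lof_eq_of R, hF, hx, map_zero]

theorem directSum_map_injective (hφ : Function.Injective φ)
    (hF : ∀ i x, F (DirectSum.lof R ι M i x) = DirectSum.lof R κ M' (φ i) (f i x))
    (hf : ∀ i, Function.Injective (f i)) : Function.Injective F := by
  rw [injective_iff_map_eq_zero]
  intro x hx
  ext i
  exact hf i (((directSum_map_eq_zero_iff hφ hF x).mp hx i).trans (map_zero (f i)).symm)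

end DirectSums

section TowerMaps

variable {k : Type u} [Field k] {M N M' N' : TowerMod k}

theorem indProd_hom_ext {n : ℕ} {Y : Type*} [AddCommGroup Y] [Module (Hecke k n) Y]
    {f g : (indProd M N).X n →ₗ[Hecke k n] Y}
    (h : ∀ p q (h : p + q = n) x y, f (indProdMk M N h x y) = g (indProdMk M N h x y)) : f = g := by
  refine LinearMap.ext fun w => ?_
  induction w using tower_induction with
  | hadd z w hz hw => rw [map_add, map_add, hz, hw]
  | hmk p q hpq c x y => rw [map_smul, map_smul, h]
  | h0 => rw [map_zero, map_zero]

theorem indProdLift_mk {n : ℕ} {Y : Type u} [AddCommGroup Y] [Module k Y]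
    [Module (Hecke k n) Y] [IsScalarTower k (Hecke k n) Y]
    (f : ∀ p q : ℕ, (h : p + q = n) → Ind k h (M.X p) (N.X q) →ₗ[Hecke k n] Y) {p q : ℕ}
    (h : p + q = n) (x : M.X p) (y : N.X q) :
    indProdLift M N f (indProdMk M N h x y) = f p q h (indMk k h _ _ x y) :=
  DirectSum.toModule_lof (Hecke k n)
    (φ := fun d : {d : ℕ × ℕ // d.1 + d.2 = n} => f d.1.1 d.1.2 d.2) ⟨(p, q), h⟩ _

theorem indProdMap_mk (f : TowerHom M M') (g : TowerHom N N') {p q n : ℕ} (h : p + q = n)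
    (x : M.X p) (y : N.X q) :
    indProdMap f g n (indProdMk M N h x y) = indProdMk M' N' h (f p x) (g q y) := by
  rw [indProdMap, indProdLift_mk, indLift_mk]
  rfl

theorem indProdMap_bijective {f : TowerHom M M'} {g : TowerHom N N'}
    (hf : ∀ n, Function.Bijective (f n)) (hg : ∀ n, Function.Bijective (g n)) (n : ℕ) :
    Function.Bijective (indProdMap f g n) := by
  let f' : TowerHom M' M := fun n => (LinearEquiv.ofBijective (f n) (hf n)).symm.toLinearMap
  let g' : TowerHom N' N := fun n => (LinearEquiv.ofBijective (g n) (hg n)).symm.toLinearMap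
  have h1 : indProdMap f' g' n ∘ₗ indProdMap f g n = LinearMap.id := by
    refine indProd_hom_ext fun p q h x y => ?_
    rw [LinearMap.comp_apply, indProdMap_mk, indProdMap_mk, LinearMap.id_apply]
    congr 1
    · congr 1
      exact (LinearEquiv.ofBijective (f p) (hf p)).symm_apply_apply x
    · exact (LinearEquiv.ofBijective (g q) (hg q)).symm_apply_apply y
  have h2 : indProdMap f g n ∘ₗ indProdMap f' g' n = LinearMap.id := by
    refine indProd_hom_ext fun p q h x y => ?_
    rw [LinearMap.comp_apply, indProdMap_mk, indProdMap_mk, LinearMap.id_apply]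
    congr 1
    · congr 1
      exact (LinearEquiv.ofBijective (f p) (hf p)).apply_symm_apply x
    · exact (LinearEquiv.ofBijective (g q) (hg q)).apply_symm_apply y
  exact Function.bijective_iff_has_inverse.mpr
    ⟨indProdMap f' g' n, LinearMap.congr_fun h1, LinearMap.congr_fun h2⟩

theorem indProdAssoc_mk (K : TowerMod k) {p q q₁ q₂ n : ℕ} (h : p + q = n) (hq : q₁ + q₂ = q)
    (x : M.X p) (c : Hecke k q) (y : N.X q₁) (z : K.X q₂) :
    indProdAssoc M N K n (indProdMk M (indProd N K) h x (c • indProdMk N K hq y z))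
      = heckeShift (n := n) p (by omega) c •
        indProdMk (indProd M N) K (by omega) (indProdMk M N rfl x y) z := by
  rw [indProdAssoc, indProdLift_mk, indLift_mk, assocBi_mk]

end TowerMaps

/-! ## Factorization of permutations along two blocks -/

section Blocks

variable {k : Type u} [Field k] {p q n : ℕ} {st₁ st₂ st : ℕ → Step}

theorem juxta_mul (h : p + q = n) (T T' : Equiv.Perm (Fin p)) (U U' : Equiv.Perm (Fin q)) :
    juxta h T U * juxta h T' U' = juxta h (T * T') (U * U') := by
  refine Equiv.ext fun x => ?_
  simp only [Equiv.Perm.mul_apply, juxta, Equiv.permCongr_apply, Equiv.symm_apply_apply]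
  congr 1
  generalize (finSumFinEquiv.trans (finCongr h)).symm x = y
  cases y <;> rfl

theorem juxta_one (h : p + q = n) : juxta h (1 : Equiv.Perm (Fin p)) 1 = 1 := by
  refine Equiv.ext fun x => ?_
  rw [juxta, Equiv.permCongr_apply, Equiv.Perm.sumCongr_one, Equiv.Perm.one_apply,
    Equiv.apply_symm_apply]
  rfl

/-- The permutation `u` is increasing on the first `p` letters and on the other ones. -/
def BlockIncr (p : ℕ) (u : Equiv.Perm (Fin n)) : Prop :=
  ∀ a b : Fin n, a < b → (b.1 < p ∨ p ≤ a.1) → u a < u b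

theorem BlockIncr.lt_iff {u : Equiv.Perm (Fin n)} (hu : BlockIncr p u) {a b : Fin n}
    (h : (a.1 < p ∧ b.1 < p) ∨ (p ≤ a.1 ∧ p ≤ b.1)) : u a < u b ↔ a < b := by
  constructor
  · intro hlt
    by_contra hab
    rcases (not_lt.mp hab).eq_or_lt with e | e
    · rw [e] at hlt; exact lt_irrefl _ hlt
    · exact absurd hlt (hu b a e (by omega)).not_gt
  · intro hab
    exact hu a b hab (by omega)

/-- Sort the values of `w` separately on the two blocks: the sorted permutation is `u`, the
representative of shortest length of the coset of `w`, and the inverses of the sorting permutations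
are `v₁` and `v₂`. -/
theorem exists_blockIncr_mul_juxta (h : p + q = n) (w : Equiv.Perm (Fin n)) :
    ∃ (u : Equiv.Perm (Fin n)) (v₁ : Equiv.Perm (Fin p)) (v₂ : Equiv.Perm (Fin q)),
      BlockIncr p u ∧ w = u * juxta h v₁ v₂ := by
  let f₁ : Fin p → Fin n := fun c => w ⟨c.1, by omega⟩
  let f₂ : Fin q → Fin n := fun c => w ⟨p + c.1, by omega⟩
  refine ⟨w * juxta h (Tuple.sort f₁) (Tuple.sort f₂), (Tuple.sort f₁)⁻¹, (Tuple.sort f₂)⁻¹, ?_, ?_⟩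
  · intro a b hab hp
    refine lt_of_le_of_ne ?_ (Equiv.injective _ |>.ne hab.ne)
    rw [Equiv.Perm.mul_apply, Equiv.Perm.mul_apply]
    rcases hp with hp | hp
    · have ha : a.1 < p := lt_trans hab hp
      have h1 := juxta_left h (Tuple.sort f₁) (Tuple.sort f₂) ha
      have h2 := juxta_left h (Tuple.sort f₁) (Tuple.sort f₂) hp
      simp only [Fin.eta] at h1 h2
      rw [h1, h2]
      exact Tuple.monotone_sort f₁ (show (⟨a.1, ha⟩ : Fin p) ≤ ⟨b.1, hp⟩ from hab.le)
    · obtain ⟨a', ha'⟩ : ∃ d, a.1 = p + d := ⟨a.1 - p, by omega⟩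
      obtain ⟨b', hb'⟩ : ∃ d, b.1 = p + d := ⟨b.1 - p, by omega⟩
      have ea : a = ⟨p + a', ha' ▸ a.2⟩ := Fin.ext ha'
      have eb : b = ⟨p + b', hb' ▸ b.2⟩ := Fin.ext hb'
      rw [ea, eb, juxta_right h _ _ (show a' < q by omega), juxta_right h _ _ (show b' < q by omega)]
      refine Tuple.monotone_sort f₂ (show (⟨a', _⟩ : Fin q) ≤ ⟨b', _⟩ from ?_)
      rw [Fin.le_def]
      rw [Fin.lt_def] at hab
      dsimp only
      omega
  · rw [mul_assoc, juxta_mul, mul_inv_cancel, mul_inv_cancel, juxta_one, mul_one]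

/-- Inside a block `u` preserves and reflects the order, so if the product is increasing there, the
block permutation is increasing and hence trivial. -/
theorem BlockIncr.eq_one_of_mul {h : p + q = n} {u : Equiv.Perm (Fin n)} {x₁ : Equiv.Perm (Fin p)}
    {x₂ : Equiv.Perm (Fin q)} (hu : BlockIncr p u) (hu' : BlockIncr p (u * juxta h x₁ x₂)) :
    x₁ = 1 ∧ x₂ = 1 := by
  constructor
  · refine perm_eq_one_of_strictMono fun a b hab => ?_
    have h1 := hu' ⟨a.1, by omega⟩ ⟨b.1, by omega⟩ hab (Or.inl b.2)
    rw [Equiv.Perm.mul_apply, Equiv.Perm.mul_apply, juxta_left h x₁ x₂ a.2,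
      juxta_left h x₁ x₂ b.2, hu.lt_iff (Or.inl ⟨(x₁ a).2, (x₁ b).2⟩)] at h1
    exact h1
  · refine perm_eq_one_of_strictMono fun a b hab => ?_
    have h1 := hu' ⟨p + a.1, by omega⟩ ⟨p + b.1, by omega⟩ (Nat.add_lt_add_left hab p)
      (Or.inr (Nat.le_add_right _ _))
    rw [Equiv.Perm.mul_apply, Equiv.Perm.mul_apply, juxta_right h x₁ x₂ a.2,
      juxta_right h x₁ x₂ b.2,
      hu.lt_iff (Or.inr ⟨Nat.le_add_right _ _, Nat.le_add_right _ _⟩)] at h1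
    exact Nat.lt_of_add_lt_add_left h1

theorem BlockIncr.unique {h : p + q = n} {u u' : Equiv.Perm (Fin n)} {v₁ v₁' : Equiv.Perm (Fin p)}
    {v₂ v₂' : Equiv.Perm (Fin q)} (hu : BlockIncr p u) (hu' : BlockIncr p u')
    (he : u * juxta h v₁ v₂ = u' * juxta h v₁' v₂') : u = u' ∧ v₁ = v₁' ∧ v₂ = v₂' := by
  have h1 : u = u' * juxta h (v₁' * v₁⁻¹) (v₂' * v₂⁻¹) := by
    rw [← juxta_mul, ← mul_assoc, ← he, mul_assoc, juxta_mul, mul_inv_cancel, mul_inv_cancel,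
      juxta_one, mul_one]
  obtain ⟨e1, e2⟩ := hu'.eq_one_of_mul (h1 ▸ hu)
  rw [e1, e2, juxta_one, mul_one] at h1
  exact ⟨h1, (mul_inv_eq_one.mp e1).symm, (mul_inv_eq_one.mp e2).symm⟩

/-- Standardness compares only adjacent cells, which lie in the same block because the step between
the blocks is `diag`; and `u` respects the order of entries inside a block. -/
theorem IsJuxta.isStd_iff (hs : IsJuxta p q st₁ st₂ st) (h : p + q = n)
    {T : Equiv.Perm (Fin p)} {U : Equiv.Perm (Fin q)} {u : Equiv.Perm (Fin n)}
    (hu : BlockIncr p u) :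
    IsStd st (u * juxta h T U) ↔ IsStd st₁ T ∧ IsStd st₂ U := by
  have hl : ∀ a b (ha : a < p) (hb : b < p), (u * juxta h T U) ⟨a, by omega⟩ <
      (u * juxta h T U) ⟨b, by omega⟩ ↔ T ⟨a, ha⟩ < T ⟨b, hb⟩ := by
    intro a b ha hb
    rw [Equiv.Perm.mul_apply, Equiv.Perm.mul_apply, juxta_left h T U ha,
      juxta_left h T U hb, hu.lt_iff (Or.inl ⟨(T _).2, (T _).2⟩)]
    rfl
  have hr : ∀ a b (ha : a < q) (hb : b < q), (u * juxta h T U) ⟨p + a, by omega⟩ <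
      (u * juxta h T U) ⟨p + b, by omega⟩ ↔ U ⟨a, ha⟩ < U ⟨b, hb⟩ := by
    intro a b ha hb
    rw [Equiv.Perm.mul_apply, Equiv.Perm.mul_apply, juxta_right h T U ha, juxta_right h T U hb,
      hu.lt_iff (Or.inr ⟨Nat.le_add_right _ _, Nat.le_add_right _ _⟩)]
    exact Nat.add_lt_add_iff_left
  constructor
  · refine fun hS => ⟨fun c hc => ?_, fun c hc => ?_⟩
    · rw [← hs.1 c hc, ← hl, ← hl]
      exact hS c (by omega)
    · rw [← hs.2.2 c hc, ← hr, ← hr]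
      exact hS (p + c) (by omega)
  · rintro ⟨hT, hU⟩ c hc
    rcases lt_trichotomy (c + 1) p with hp | hp | hp
    · rw [hs.1 c hp, hl c (c + 1) (by omega) hp, hl (c + 1) c hp (by omega)]
      exact hT c hp
    · rw [hs.2.1 c hp]
      exact ⟨fun e => (nomatch e), fun e => (nomatch e)⟩
    · obtain ⟨d, rfl⟩ : ∃ d, c = p + d := ⟨c - p, by omega⟩
      have h1 := hr d (d + 1) (by omega) (by omega)
      have h2 := hr (d + 1) d (by omega) (by omega)
      simp only [← Nat.add_assoc] at h1 h2
      rw [hs.2.2 d (by omega), h1, h2]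
      exact hU d (by omega)

theorem blockIncr_one : BlockIncr p (1 : Equiv.Perm (Fin n)) := fun _ _ hab _ => hab

theorem juxtaMap_stdVec_stdVec (h : p + q = n) (hs : IsJuxta p q st₁ st₂ st)
    (T : Equiv.Perm (Fin p)) (U : Equiv.Perm (Fin q)) :
    juxtaMap k h st₁ st₂ st (stdVec k st₁ T) (stdVec k st₂ U) = stdVec k st (juxta h T U) := by
  have hiff := hs.isStd_iff h (T := T) (U := U) blockIncr_one
  rw [one_mul] at hiff
  by_cases hT : IsStd st₁ T
  · by_cases hU : IsStd st₂ U
    · exact juxtaMap_stdVec h hT hU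
    · rw [stdVec_neg hU, map_zero, stdVec_neg fun hS => hU (hiff.mp hS).2]
  · rw [stdVec_neg hT, map_zero, LinearMap.zero_apply, stdVec_neg fun hS => hT (hiff.mp hS).1]

/-- An inversion of `u` pairs an entry of the lower component with an entry of the upper one, and
every cell of the upper component lies in a strictly higher row. -/
theorem IsJuxta.isReducedAt (hs : IsJuxta p q st₁ st₂ st) (h : p + q = n)
    {u : Equiv.Perm (Fin n)} (hu : BlockIncr p u) (T : Equiv.Perm (Fin p))
    (U : Equiv.Perm (Fin q)) : IsReducedAt st (juxta h T U) u := by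
  intro a b hab hba
  have hpb : p ≤ b.1 := by
    by_contra hb
    exact absurd hba (hu a b hab (Or.inl (not_le.mp hb))).not_gt
  have hap : a.1 < p := by
    by_contra ha
    exact absurd hba (hu a b hab (Or.inr (not_lt.mp ha))).not_gt
  have h1 := juxta_left h T.symm U.symm hap
  obtain ⟨b', hb'⟩ : ∃ d, b.1 = p + d := ⟨b.1 - p, by omega⟩
  have h2 := juxta_right h T.symm U.symm (show b' < q by omega)
  have hb'' : b = ⟨p + b', by omega⟩ := Fin.ext hb'
  simp only [Fin.eta] at h1
  rw [rowOf, rowOf, juxta_symm, hb'', h1, h2]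
  have hlt := (T.symm ⟨a.1, hap⟩).2
  -- The lower component has a cell here, so it has a last one, and the `diag` step out of that cell
  -- opens a new row.
  obtain ⟨p, rfl⟩ : ∃ m, p = m + 1 := ⟨p - 1, by omega⟩
  calc row st (T.symm ⟨a.1, hap⟩) ≤ row st p := row_mono st (by omega)
    _ < row st (p + 1) := by rw [row_succ_ne (by rw [hs.2.1 p rfl]; simp)]; omega
    _ ≤ _ := row_mono st (Nat.le_add_right _ _)

theorem isJuxta_allDiag : IsJuxta p q allDiag allDiag allDiag :=
  ⟨fun _ _ => rfl, fun _ _ => rfl, fun _ _ => rfl⟩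

/-- It suffices to act on the filling `1` of the regular module, which is itself a juxtaposition.
This is the form in which the freeness of `H_n(0)` over its parabolic subalgebra enters. -/
theorem permElt_mul_juxta (h : p + q = n) {u : Equiv.Perm (Fin n)} (hu : BlockIncr p u)
    (v₁ : Equiv.Perm (Fin p)) (v₂ : Equiv.Perm (Fin q)) :
    permElt k (u * juxta h v₁ v₂) = permElt k u *
      (heckeShift (n := n) 0 (by omega) (permElt k v₁) *
        heckeShift (n := n) p (by omega) (permElt k v₂)) := by
  refine regMap_bijective.1 ?_
  rw [regMap_permElt, regMap_apply, mul_smul, ← juxta_one h,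
    ← juxtaMap_stdVec_stdVec h isJuxta_allDiag, ← juxtaMap_smul h isJuxta_allDiag,
    permElt_smul_one, permElt_smul_one, juxtaMap_stdVec_stdVec h isJuxta_allDiag,
    permElt_smul (isStd_allDiag _) (isJuxta_allDiag.isReducedAt h hu v₁ v₂)]

end Blocks

/-! ## The identification of induction products of ribbon modules -/

section Identification

variable {k : Type u} [Field k]

theorem identCons_mk (d : ℕ) (α : List ℕ) {p q n : ℕ} (h : p + q = n) (x : (algA k d).X p)
    (y : (seqSum k α).X q) :
    identCons k d α n (indProdMk _ _ h x y) = juxtaBi k d α h x y := by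
  rw [identCons, indProdLift_mk, indLift_mk]

/-- The generator of `A_d ⊗̂ (⊕ P_L)` that corresponds to the tableau `T` of shape `L`. -/
def IsFactor {d : ℕ} {α : List ℕ} {n : ℕ} (L : SeqIdx (d :: α) n) (T : Equiv.Perm (Fin n))
    (z : (indProd (algA k d) (seqSum k α)).X n) : Prop :=
  ∃ (p q : ℕ) (h : p + q = n) (γ : CompIdx d p) (L' : SeqIdx α q) (u : Equiv.Perm (Fin n))
    (T₁ : Equiv.Perm (Fin p)) (T₂ : Equiv.Perm (Fin q)),
    BlockIncr p u ∧ IsStd (shape [γ.1]) T₁ ∧ IsStd (shape L'.1) T₂ ∧ L = SeqIdx.cons h γ L' ∧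
      T = u * juxta h T₁ T₂ ∧
      z = permElt k u • indProdMk (algA k d) (seqSum k α) h (algAOf k γ (stdVec k _ T₁))
        (seqSumOf k L' (stdVec k _ T₂))

theorem isJuxta_seqIdx_cons {d p q n : ℕ} {α : List ℕ} (h : p + q = n) (γ : CompIdx d p)
    (L : SeqIdx α q) : IsJuxta p q (shape [γ.1]) (shape L.1) (shape (SeqIdx.cons h γ L).1) :=
  isJuxta_cons q γ.1 L.1 γ.2.2

variable {d : ℕ} {α : List ℕ} {n : ℕ}

theorem SeqIdx.exists_cons (L : SeqIdx (d :: α) n) :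
    ∃ (p q : ℕ) (h : p + q = n) (γ : CompIdx d p) (L' : SeqIdx α q), L = SeqIdx.cons h γ L' := by
  obtain ⟨L, hL, hN⟩ := L
  cases L with
  | nil => simp at hL
  | cons γ L =>
    simp only [List.map_cons, List.cons.injEq] at hL
    simp only [List.map_cons, List.sum_cons] at hN
    exact ⟨_, _, hN, ⟨γ, hL.1, rfl⟩, ⟨L, hL.2, rfl⟩, rfl⟩

variable (k) in
theorem exists_isFactor (L : SeqIdx (d :: α) n) {T : Equiv.Perm (Fin n)}
    (hT : IsStd (shape L.1) T) :
    ∃ z : (indProd (algA k d) (seqSum k α)).X n, IsFactor L T z := by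
  obtain ⟨p, q, h, γ, L', rfl⟩ := L.exists_cons
  obtain ⟨u, T₁, T₂, hu, rfl⟩ := exists_blockIncr_mul_juxta h T
  obtain ⟨h1, h2⟩ := ((isJuxta_seqIdx_cons h γ L').isStd_iff h hu).mp hT
  exact ⟨_, p, q, h, γ, L', u, T₁, T₂, hu, h1, h2, rfl, rfl, rfl⟩

/-- The sequence determines its first composition and thereby `p` and `q`; then `BlockIncr.unique`
recovers `u` and both tableaux from `T`. Hence a generator obtained by choice can be compared with
any explicit one. -/
theorem IsFactor.unique {L : SeqIdx (d :: α) n} {T : Equiv.Perm (Fin n)}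
    {z z' : (indProd (algA k d) (seqSum k α)).X n} (hz : IsFactor L T z) (hz' : IsFactor L T z') :
    z = z' := by
  obtain ⟨p, q, h, γ, L₁, u, T₁, T₂, hu, -, -, rfl, rfl, rfl⟩ := hz
  obtain ⟨p', q', h', γ', L₁', u', T₁', T₂', hu', -, -, hL, hT, rfl⟩ := hz'
  obtain ⟨γ, hγ, hγ'⟩ := γ
  obtain ⟨γ', hγ₁, hγ₁'⟩ := γ'
  obtain ⟨L₁, hL₁, hL₁'⟩ := L₁
  obtain ⟨L₁', hL₂, hL₂'⟩ := L₁'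
  have hL' := congrArg Subtype.val hL
  simp only [SeqIdx.cons, List.cons.injEq] at hL'
  obtain ⟨rfl, rfl⟩ := hL'
  obtain rfl : p = p' := hγ'.symm.trans hγ₁'
  obtain rfl : q = q' := by omega
  obtain ⟨rfl, rfl, rfl⟩ := hu.unique hu' hT
  rfl

theorem IsFactor.identCons_eq {L : SeqIdx (d :: α) n} {T : Equiv.Perm (Fin n)}
    {z : (indProd (algA k d) (seqSum k α)).X n} (hz : IsFactor L T z) :
    identCons k d α n z = seqSumOf k L (stdVec k _ T) := by
  obtain ⟨p, q, h, γ, L₁, u, T₁, T₂, hu, h1, h2, rfl, rfl, rfl⟩ := hz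
  have hj := isJuxta_seqIdx_cons h γ L₁
  rw [map_smul, identCons_mk, juxtaBi_of, juxtaMap_stdVec h h1 h2, ← map_smul,
    permElt_smul (hj.isStd h h1 h2) (hj.isReducedAt h hu _ _)]

variable (k d α n) in
/-- The inverse of the canonical map `A_d ⊗̂ (⊕ P_L) → ⊕ P_(γ, L)`. -/
def identConsInv : (seqSum k (d :: α)).X n →ₗ[k] (indProd (algA k d) (seqSum k α)).X n :=
  seqSumLiftK fun L => tabLift fun T => (exists_isFactor k L T.2).choose

theorem identConsInv_of (L : SeqIdx (d :: α) n) {T : Equiv.Perm (Fin n)}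
    (hT : IsStd (shape L.1) T) :
    IsFactor L T (identConsInv k d α n (seqSumOf k L (stdVec k _ T))) := by
  rw [identConsInv, seqSumLiftK_of, tabLift_stdVec _ hT]
  exact (exists_isFactor k L hT).choose_spec

theorem identCons_identConsInv (x : (seqSum k (d :: α)).X n) :
    identCons k d α n (identConsInv k d α n x) = x := by
  induction x using seqSum_induction with
  | h0 => simp
  | hadd x y hx hy => rw [map_add, map_add, hx, hy]
  | hof L x =>
    induction x using tab_induction with
    | h0 => simp
    | hadd x y hx hy => simp only [map_add, hx, hy]
    | hsmul r x hx => rw [tower_linear, map_smul, tower_linear, hx]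
    | hstd T hT => exact (identConsInv_of L hT).identCons_eq

/-- By bilinearity both arguments may be taken to be tableaux; the element is then a factor of a
tableau of the juxtaposed shape, so it equals the chosen value by uniqueness. -/
theorem permElt_smul_mk_mem {p q : ℕ} (h : p + q = n) {u : Equiv.Perm (Fin n)}
    (hu : BlockIncr p u) (x : (algA k d).X p) (y : (seqSum k α).X q) :
    permElt k u • indProdMk (algA k d) (seqSum k α) h x y ∈
      LinearMap.range (identConsInv k d α n) := by
  induction x using algA_induction with
  | h0 => simp
  | hadd x x' hx hx' =>
    rw [map_add, LinearMap.add_apply, smul_add]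
    exact Submodule.add_mem _ hx hx'
  | hof γ x =>
    induction y using seqSum_induction with
    | h0 => simp
    | hadd y y' hy hy' =>
      rw [map_add, smul_add]
      exact Submodule.add_mem _ hy hy'
    | hof L y =>
      induction x using tab_induction with
      | h0 => simp
      | hadd x x' hx hx' =>
        rw [map_add, map_add, LinearMap.add_apply, smul_add]
        exact Submodule.add_mem _ hx hx'
      | hsmul r x hx =>
        rw [tower_linear, map_smul, LinearMap.smul_apply, smul_algebra_smul_comm]
        exact Submodule.smul_mem _ r hx
      | hstd T hT =>
        induction y using tab_induction with
        | h0 => simp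
        | hadd x x' hx hx' =>
          rw [map_add, map_add, smul_add]
          exact Submodule.add_mem _ hx hx'
        | hsmul r x hx =>
          rw [tower_linear, map_smul, smul_algebra_smul_comm]
          exact Submodule.smul_mem _ r hx
        | hstd U hU =>
          have hj := isJuxta_seqIdx_cons h γ L
          have hz : IsFactor (k := k) (SeqIdx.cons h γ L) (u * juxta h T U) _ :=
            ⟨p, q, h, γ, L, u, T, U, hu, hT, hU, rfl, rfl, rfl⟩
          have hz' := identConsInv_of (k := k) _ ((hj.isStd_iff h hu).mpr ⟨hT, hU⟩)
          exact ⟨_, hz'.unique hz⟩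

/-- Expand the coefficient `c` in the elements `permElt`, factor each permutation along the two
blocks, and absorb the block part into the tensor factors; only a block-increasing `u` remains in
front. -/
theorem identConsInv_surjective : Function.Surjective (identConsInv k d α n) := by
  intro z
  change z ∈ LinearMap.range (identConsInv k d α n)
  induction z using tower_induction with
  | hadd z w hz hw => exact Submodule.add_mem _ hz hw
  | h0 => exact Submodule.zero_mem _
  | hmk p q h c x y =>
    obtain ⟨r, rfl⟩ := hecke_eq_sum_permElt c
    rw [Finset.sum_smul]
    refine Submodule.sum_mem _ fun w _ => ?_
    rw [smul_assoc]
    refine Submodule.smul_mem _ _ ?_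
    obtain ⟨u, v₁, v₂, hu, rfl⟩ := exists_blockIncr_mul_juxta h w
    rw [permElt_mul_juxta h hu, mul_smul, ← indProdMk_smul]
    exact permElt_smul_mk_mem h hu _ _

/-- A surjective right inverse is a two-sided inverse. That it is only constructed as a `k`-linear
map is harmless, since bijectivity is all that is claimed. -/
theorem identCons_bijective (d : ℕ) (α : List ℕ) (n : ℕ) :
    Function.Bijective (identCons k d α n) := by
  have h : Function.LeftInverse (identCons k d α n) (identConsInv k d α n) :=
    identCons_identConsInv (k := k)
  exact Function.bijective_iff_has_inverse.mpr
    ⟨_, h.rightInverse_of_surjective identConsInv_surjective, h⟩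

/-! ### A single factor and the iterated product -/

theorem identOne_of (γ : CompIdx d n) (x : ribbonMod k n [γ.1]) :
    identOne k d n (algAOf k γ x) = seqSumOf k (SeqIdx.single γ) x :=
  DirectSum.toModule_lof (Hecke k n) (φ := fun γ => seqSumOf k (SeqIdx.single γ)) γ x

theorem SeqIdx.exists_single (L : SeqIdx [d] n) : ∃ γ : CompIdx d n, L = SeqIdx.single γ := by
  obtain ⟨L, hL, hN⟩ := L
  match L, hL with
  | [γ], hL =>
    simp only [List.map_cons, List.map_nil, List.cons.injEq, and_true] at hL
    simp only [List.map_cons, List.map_nil, List.sum_singleton] at hN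
    exact ⟨⟨γ, hL, hN⟩, rfl⟩

theorem identOne_bijective (d n : ℕ) : Function.Bijective (identOne k d n) := by
  constructor
  · refine directSum_map_injective (R := Hecke k n) (φ := SeqIdx.single (d := d) (n := n))
      (M := fun γ : CompIdx d n => ribbonMod k n [γ.1]) (M' := fun L : SeqIdx [d] n => ribbonMod k n L.1)
      (f := fun γ => LinearMap.id) (F := identOne k d n) ?_ (fun γ x => identOne_of γ x) fun _ => Function.injective_id
    rintro ⟨γ, hγ⟩ ⟨γ', hγ'⟩ h
    have := congrArg Subtype.val h
    simp only [SeqIdx.single, List.cons.injEq, and_true] at this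
    exact Subtype.ext this
  · intro y
    induction y using seqSum_induction with
    | h0 => exact ⟨0, map_zero _⟩
    | hadd x y hx hy =>
      obtain ⟨x, rfl⟩ := hx
      obtain ⟨y, rfl⟩ := hy
      exact ⟨x + y, map_add _ _ _⟩
    | hof L x =>
      obtain ⟨γ, rfl⟩ := L.exists_single
      exact ⟨_, identOne_of γ x⟩

/-- The canonical map from the iterated induction product to the sum of the generalized ribbon
modules is an isomorphism. -/
theorem ident_bijective (d : ℕ) (α : List ℕ) (n : ℕ) : Function.Bijective (ident k d α n) := by
  induction α generalizing d n with
  | nil => exact identOne_bijective d n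
  | cons e α ih =>
    exact (identCons_bijective d (e :: α) n).comp
      (indProdMap_bijective (fun _ => Function.bijective_id) (ih e) n)

end Identification

/-! ## Merging two neighbours in a sequence of compositions -/

section Merging

/-- The sequence obtained from `L` by near-concatenating the entries number `i` and `i + 1`. -/
def mergeComp : List Comp → ℕ → List Comp
  | [], _ => []
  | [γ], _ => [γ]
  | γ :: δ :: L, 0 => Comp.near γ δ :: L
  | γ :: δ :: L, i + 1 => γ :: mergeComp (δ :: L) i

theorem map_numCols_mergeComp {L : List Comp} {d : ℕ} {α : List ℕ}
    (hL : L.map Comp.numCols = d :: α) (i : ℕ) :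
    (mergeComp L i).map Comp.numCols = (mergeAt d α i).1 :: (mergeAt d α i).2 := by
  induction L generalizing d α i with
  | nil => simp at hL
  | cons γ L ih =>
    rw [List.map_cons, List.cons.injEq] at hL
    obtain ⟨rfl, rfl⟩ := hL
    match L, i with
    | [], i => simp [mergeComp, mergeAt]
    | δ :: L, 0 =>
      simp only [mergeComp, List.map_cons, mergeAt, Comp.numCols_near]
    | δ :: L, i + 1 =>
      simp only [mergeComp, List.map_cons, mergeAt]
      rw [ih rfl]

theorem sum_size_mergeComp (L : List Comp) (i : ℕ) :
    ((mergeComp L i).map Comp.size).sum = (L.map Comp.size).sum := by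
  induction L generalizing i with
  | nil => rfl
  | cons γ L ih =>
    match L, i with
    | [], i => rfl
    | δ :: L, 0 =>
      simp only [mergeComp, List.map_cons, List.sum_cons, Comp.size_near, Nat.add_assoc]
    | δ :: L, i + 1 =>
      have := ih i
      simp only [mergeComp, List.map_cons, List.sum_cons] at this ⊢
      rw [this]

theorem stepsGlue_mergeComp (L : List Comp) (i : ℕ) :
    StepsGlue (L.flatMap Comp.steps) ((mergeComp L i).flatMap Comp.steps) := by
  induction L generalizing i with
  | nil => exact StepsGlue.refl _
  | cons γ L ih =>
    match L, i with
    | [], i => exact StepsGlue.refl _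
    | δ :: L, 0 =>
      simp only [mergeComp, List.flatMap_cons, ← List.append_assoc]
      exact (stepsGlue_near γ δ).append (StepsGlue.refl _)
    | δ :: L, i + 1 =>
      rw [mergeComp, List.flatMap_cons, List.flatMap_cons]
      exact (StepsGlue.refl _).append (ih i)

theorem isGluing_mergeComp (N : ℕ) (L : List Comp) (i : ℕ) :
    IsGluing N (shape L) (shape (mergeComp L i)) :=
  (stepsGlue_mergeComp L i).isGluing N

/-- Near-concatenating the entries number `i` and `i + 1` turns column numbers `α` into `β`. -/
def MergesTo (i : ℕ) (α β : List ℕ) : Prop :=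
  ∀ L : List Comp, L.map Comp.numCols = α → (mergeComp L i).map Comp.numCols = β

theorem mergesTo_mergeAt (d : ℕ) (α : List ℕ) (i : ℕ) :
    MergesTo i (d :: α) ((mergeAt d α i).1 :: (mergeAt d α i).2) :=
  fun _ hL => map_numCols_mergeComp hL i

/-- The sequence with the entries number `i` and `i + 1` near-concatenated. -/
def SeqIdx.merge {n i : ℕ} {α β : List ℕ} (hβ : MergesTo i α β) (L : SeqIdx α n) : SeqIdx β n :=
  ⟨mergeComp L.1 i, hβ L.1 L.2.1, (sum_size_mergeComp L.1 i).trans L.2.2⟩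

variable (k : Type u) [Field k]

/-- The map between sums of generalized ribbon modules that glues the components number `i` and
`i + 1`. -/
def nearAt {i : ℕ} {α β : List ℕ} (hβ : MergesTo i α β) : TowerHom (seqSum k α) (seqSum k β) :=
  fun n => DirectSum.toModule (Hecke k n) (SeqIdx α n) _
    (fun L => seqSumOf k (SeqIdx.merge hβ L) ∘ₗ glueMap k (isGluing_mergeComp n L.1 i))

variable {k}

theorem nearAt_of {n i : ℕ} {α β : List ℕ} (hβ : MergesTo i α β) (L : SeqIdx α n)
    (x : ribbonMod k n L.1) :
    nearAt k hβ n (seqSumOf k L x)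
      = seqSumOf k (SeqIdx.merge hβ L) (glueMap k (isGluing_mergeComp n L.1 i) x) :=
  DirectSum.toModule_lof (Hecke k n)
    (φ := fun L : SeqIdx α n =>
      seqSumOf k (SeqIdx.merge hβ L) ∘ₗ glueMap k (isGluing_mergeComp n L.1 i)) L x

end Merging

/-! ## Compatibility of gluing and juxtaposition -/

section Compatibility

variable {k : Type u} [Field k]

/-- Gluing only adds conditions, so for a nonstandard filling both sides vanish. This frees the
compatibility proofs below from tracking standardness. -/
theorem glueMap_stdVec' {N : ℕ} {st st' : ℕ → Step} (h : IsGluing N st st')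
    (T : Equiv.Perm (Fin N)) : glueMap k h (stdVec k st T) = stdVec k st' T := by
  by_cases hT : IsStd st T
  · exact glueMap_stdVec h hT
  · rw [stdVec_neg hT, map_zero, stdVec_neg fun hT' => hT (h.isStd hT')]

theorem juxta_assoc {p q₁ q₂ q p' n : ℕ} (h₁ : p' + q₂ = n) (h₂ : p + q₁ = p') (h₃ : p + q = n)
    (h₄ : q₁ + q₂ = q) (T : Equiv.Perm (Fin p)) (U : Equiv.Perm (Fin q₁))
    (V : Equiv.Perm (Fin q₂)) :
    juxta h₁ (juxta h₂ T U) V = juxta h₃ T (juxta h₄ U V) := by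
  have hl : ∀ {p q n c : ℕ} (h : p + q = n) (T : Equiv.Perm (Fin p)) (U : Equiv.Perm (Fin q))
      (hc : c < p) (hc' : c < n), (juxta h T U ⟨c, hc'⟩).1 = (T ⟨c, hc⟩).1 :=
    fun h T U hc _ => congrArg Fin.val (juxta_left h T U hc)
  have hr : ∀ {p q n c : ℕ} (h : p + q = n) (T : Equiv.Perm (Fin p)) (U : Equiv.Perm (Fin q))
      (hc : c < q) (hc' : p + c < n), (juxta h T U ⟨p + c, hc'⟩).1 = p + (U ⟨c, hc⟩).1 :=
    fun h T U hc _ => congrArg Fin.val (juxta_right h T U hc)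
  refine Equiv.ext fun c => Fin.ext ?_
  obtain ⟨c, hc⟩ := c
  rcases Nat.lt_or_ge c p with hp | hp
  · rw [hl h₁ _ V (show c < p' by omega), hl h₂ T U hp, hl h₃ T _ hp]
  · obtain ⟨c, rfl⟩ := Nat.exists_eq_add_of_le hp
    rw [hr h₃ T _ (show c < q by omega)]
    rcases Nat.lt_or_ge c q₁ with hq | hq
    · rw [hl h₁ _ V (show p + c < p' by omega), hr h₂ T U hq, hl h₄ U V hq]
    · obtain ⟨c, rfl⟩ := Nat.exists_eq_add_of_le hq
      subst h₂
      have h := hr h₁ (juxta rfl T U) V (show c < q₂ by omega) (by omega)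
      simp only [Nat.add_assoc] at h
      rw [h, hr h₄ U V (show c < q₂ by omega)]

theorem juxtaMap_glueMap {p q n : ℕ} (h : p + q = n) {st₁ st₂ st₂' st st' : ℕ → Step}
    (hs : IsJuxta p q st₁ st₂ st) (hs' : IsJuxta p q st₁ st₂' st') (hg : IsGluing q st₂ st₂')
    (hg' : IsGluing n st st') (x : TabMod k p st₁) (y : TabMod k q st₂) :
    juxtaMap k h st₁ st₂' st' x (glueMap k hg y) = glueMap k hg' (juxtaMap k h st₁ st₂ st x y) := by
  induction x using tab_induction with
  | h0 => simp
  | hadd x x' hx hx' => simp only [map_add, LinearMap.add_apply, hx, hx']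
  | hsmul r x hx => rw [map_smul, map_smul, LinearMap.smul_apply, LinearMap.smul_apply, hx,
      tower_linear]
  | hstd T _ =>
    induction y using tab_induction with
    | h0 => simp
    | hadd x x' hx hx' => simp only [map_add, hx, hx']
    | hsmul r x hx => rw [tower_linear, map_smul, map_smul, hx, tower_linear]
    | hstd U _ =>
      rw [glueMap_stdVec', juxtaMap_stdVec_stdVec h hs, juxtaMap_stdVec_stdVec h hs',
        glueMap_stdVec']

/-- On tableaux both sides are the same filling of the same final shape, read as `0` if it is not
standard, by associativity of juxtaposition. It is immaterial whether the gluing happens before or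
after the third component is added. -/
theorem juxtaMap_glueMap_juxtaMap {p q₁ q₂ q p' n : ℕ} (h₁ : p' + q₂ = n) (h₂ : p + q₁ = p')
    (h₃ : p + q = n) (h₄ : q₁ + q₂ = q) {st₁ st₂ st₃ st₁₂ st₂₃ st₁₂' st st' : ℕ → Step}
    (hs₁ : IsJuxta p' q₂ st₁₂' st₃ st') (hs₂ : IsJuxta p q₁ st₁ st₂ st₁₂)
    (hs₃ : IsJuxta p q st₁ st₂₃ st) (hs₄ : IsJuxta q₁ q₂ st₂ st₃ st₂₃)
    (hg : IsGluing p' st₁₂ st₁₂') (hg' : IsGluing n st st') (x : TabMod k p st₁)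
    (y : TabMod k q₁ st₂) (z : TabMod k q₂ st₃) :
    juxtaMap k h₁ st₁₂' st₃ st' (glueMap k hg (juxtaMap k h₂ st₁ st₂ st₁₂ x y)) z
      = glueMap k hg' (juxtaMap k h₃ st₁ st₂₃ st x (juxtaMap k h₄ st₂ st₃ st₂₃ y z)) := by
  induction x using tab_induction with
  | h0 => simp
  | hadd x x' hx hx' => simp only [map_add, LinearMap.add_apply, hx, hx']
  | hsmul r x hx =>
    simp only [map_smul, LinearMap.smul_apply, tower_linear (k := k), hx]
  | hstd T _ =>
    induction y using tab_induction with
    | h0 => simp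
    | hadd x x' hx hx' => simp only [map_add, LinearMap.add_apply, hx, hx']
    | hsmul r x hx =>
      simp only [map_smul, LinearMap.smul_apply, tower_linear (k := k), hx]
    | hstd U _ =>
      induction z using tab_induction with
      | h0 => simp
      | hadd x x' hx hx' => simp only [map_add, hx, hx']
      | hsmul r x hx =>
        simp only [map_smul, tower_linear (k := k), hx]
      | hstd V _ =>
        rw [juxtaMap_stdVec_stdVec h₂ hs₂, glueMap_stdVec', juxtaMap_stdVec_stdVec h₁ hs₁,
          juxtaMap_stdVec_stdVec h₄ hs₄, juxtaMap_stdVec_stdVec h₃ hs₃, glueMap_stdVec',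
          juxta_assoc h₁ h₂ h₃ h₄]

theorem juxtaBi_nearAt {d e i : ℕ} {α β : List ℕ} (hβ : MergesTo i (e :: α) β)
    (hβ' : MergesTo (i + 1) (d :: e :: α) (d :: β)) {p q n : ℕ} (h : p + q = n)
    (x : (algA k d).X p) (y : (seqSum k (e :: α)).X q) :
    juxtaBi k d β h x (nearAt k hβ q y) = nearAt k hβ' n (juxtaBi k d (e :: α) h x y) := by
  induction x using algA_induction with
  | h0 => simp
  | hadd x x' hx hx' => simp only [map_add, LinearMap.add_apply, hx, hx']
  | hof γ x =>
    induction y using seqSum_induction with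
    | h0 => simp
    | hadd x x' hx hx' => simp only [map_add, hx, hx']
    | hof L y =>
      obtain ⟨L, hL, hq⟩ := L
      -- The sequence must be visibly nonempty for merging at `i + 1` behind `γ` to unfold to `γ`
      -- followed by merging at `i`.
      cases L with
      | nil => simp at hL
      | cons δ L =>
        refine ((congrArg _ (nearAt_of hβ _ y)).trans (juxtaBi_of k d β h γ
          (SeqIdx.merge hβ ⟨δ :: L, hL, hq⟩) x _)).trans ?_
        refine Eq.trans ?_ ((congrArg _ (juxtaBi_of k d _ h γ ⟨δ :: L, hL, hq⟩ x y)).trans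
          (nearAt_of hβ' _ _)).symm
        exact congrArg (seqSumOf k (SeqIdx.cons h γ (SeqIdx.merge hβ ⟨δ :: L, hL, hq⟩)))
          (juxtaMap_glueMap h (isJuxta_seqIdx_cons h γ ⟨δ :: L, hL, hq⟩)
            (isJuxta_seqIdx_cons h γ (SeqIdx.merge hβ ⟨δ :: L, hL, hq⟩)) _ _ x y)

theorem numCols_size_near {d e p q n : ℕ} (h : p + q = n) (γ : CompIdx d p) (δ : CompIdx e q) :
    (Comp.near γ.1 δ.1).numCols = d + e ∧ (Comp.near γ.1 δ.1).size = n := by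
  rw [Comp.numCols_near, Comp.size_near, γ.2.1, γ.2.2, δ.2.1, δ.2.2, h]
  exact ⟨rfl, rfl⟩

/-- The near-concatenation of two compositions. -/
def CompIdx.near {d e p q n : ℕ} (h : p + q = n) (γ : CompIdx d p) (δ : CompIdx e q) :
    CompIdx (d + e) n :=
  ⟨Comp.near γ.1 δ.1, numCols_size_near h γ δ⟩

theorem nearSum_of {d e p q n : ℕ} (h : p + q = n) (γ : CompIdx d p) (δ : CompIdx e q)
    (x : ribbonMod k n [γ.1, δ.1]) :
    nearSum k d e n (seqSumOf k (SeqIdx.cons h γ (SeqIdx.single δ)) x)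
      = algAOf k (CompIdx.near h γ δ) (nearMap k n γ.1 δ.1 x) := by
  rw [nearSum]
  exact DirectSum.toModule_lof (Hecke k n) (ι := SeqIdx [d, e] n)
    (M := fun L => ribbonMod k n L.1) (SeqIdx.cons h γ (SeqIdx.single δ)) x

/-- The case of merging the first two factors: multiplying `x` and `y` and then juxtaposing `z` is
gluing the first comma of the juxtaposition of all three. -/
theorem juxtaBi_nearSum {d e : ℕ} {α : List ℕ} (hβ : MergesTo 0 (d :: e :: α) ((d + e) :: α))
    {p q₁ q₂ q p' n : ℕ} (h₁ : p' + q₂ = n)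
    (h₂ : p + q₁ = p') (h₃ : p + q = n) (h₄ : q₁ + q₂ = q) (x : (algA k d).X p)
    (y : (algA k e).X q₁) (z : (seqSum k α).X q₂) :
    juxtaBi k (d + e) α h₁ (nearSum k d e p' (juxtaBi k d [e] h₂ x (identOne k e q₁ y))) z
      = nearAt k hβ n (juxtaBi k d (e :: α) h₃ x (juxtaBi k e α h₄ y z)) := by
  induction x using algA_induction with
  | h0 => simp
  | hadd x x' hx hx' => simp only [map_add, LinearMap.add_apply, hx, hx']
  | hof γ x =>
    induction y using algA_induction with
    | h0 => simp
    | hadd x x' hx hx' => simp only [map_add, LinearMap.add_apply, hx, hx']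
    | hof δ y =>
      induction z using seqSum_induction with
      | h0 => simp
      | hadd x x' hx hx' => simp only [map_add, hx, hx']
      | hof L z =>
        have e1 : nearSum k d e p' (juxtaBi k d [e] h₂ (algAOf k γ x)
            (identOne k e q₁ (algAOf k δ y))) = algAOf k (CompIdx.near h₂ γ δ)
              (nearMap k p' γ.1 δ.1 (juxtaMap k h₂ _ _ (shape [γ.1, δ.1]) x y)) := by
          rw [identOne_of]
          refine (congrArg _ (juxtaBi_of k d [e] h₂ γ (SeqIdx.single δ) x y)).trans ?_
          exact nearSum_of h₂ γ δ _
        have e2 := nearAt_of (k := k) hβ (SeqIdx.cons h₃ γ (SeqIdx.cons h₄ δ L))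
          (juxtaMap k h₃ (shape [γ.1]) (shape (SeqIdx.cons h₄ δ L).1)
            (shape (SeqIdx.cons h₃ γ (SeqIdx.cons h₄ δ L)).1) x
            (juxtaMap k h₄ (shape [δ.1]) (shape L.1) (shape (SeqIdx.cons h₄ δ L).1) y z))
        rw [e1, juxtaBi_of, juxtaBi_of, e2]
        refine (juxtaBi_of k (d + e) α h₁ (CompIdx.near h₂ γ δ) L _ z).trans ?_
        exact congrArg (seqSumOf k (SeqIdx.cons h₁ (CompIdx.near h₂ γ δ) L))
          (juxtaMap_glueMap_juxtaMap h₁ h₂ h₃ h₄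
            (isJuxta_seqIdx_cons h₁ (CompIdx.near h₂ γ δ) L)
            (isJuxta_seqIdx_cons h₂ γ (SeqIdx.single δ))
            (isJuxta_seqIdx_cons h₃ γ (SeqIdx.cons h₄ δ L)) (isJuxta_seqIdx_cons h₄ δ L)
            (isGluing_near p' γ.1 δ.1)
            (isGluing_mergeComp n (SeqIdx.cons h₃ γ (SeqIdx.cons h₄ δ L)).1 0) x y z)

theorem identOne_nearSum {d e : ℕ} (hβ : MergesTo 0 [d, e] [d + e]) (n : ℕ)
    (x : (seqSum k [d, e]).X n) :
    identOne k (d + e) n (nearSum k d e n x) = nearAt k hβ n x := by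
  induction x using seqSum_induction with
  | h0 => simp
  | hadd x x' hx hx' => simp only [map_add, hx, hx']
  | hof L x =>
    obtain ⟨p, q, h, γ, L, rfl⟩ := L.exists_cons
    obtain ⟨δ, rfl⟩ := L.exists_single
    refine (congrArg _ (nearSum_of h γ δ x)).trans ?_
    exact (identOne_of _ _).trans (nearAt_of hβ (SeqIdx.cons h γ (SeqIdx.single δ)) x).symm

theorem algMul_mk (d e : ℕ) {p q n : ℕ} (h : p + q = n) (x : (algA k d).X p)
    (y : (algA k e).X q) :
    algMul k d e n (indProdMk (algA k d) (algA k e) h x y)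
      = nearSum k d e n (juxtaBi k d [e] h x (identOne k e q y)) := by
  refine congrArg (nearSum k d e n) ?_
  exact (congrArg (identCons k d [e] n)
    (indProdMap_mk (fun _ => LinearMap.id) (identOne k e) h x y)).trans (identCons_mk d [e] h x _)

/-- The remaining factors enter only through a map `I`, later `ident`. Both sides are linear over
the algebra, so they are compared on elements `x ⊗ (c • (y ⊗ z))`, where `c` comes out along the
shift on either side. -/
theorem identCons_algMul {d e : ℕ} {α : List ℕ}
    (hβ : MergesTo 0 (d :: e :: α) ((d + e) :: α)) {P : TowerMod k}
    (I : TowerHom P (seqSum k α)) (n : ℕ) :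
    identCons k (d + e) α n ∘ₗ indProdMap (fun _ => LinearMap.id) I n ∘ₗ
        indProdMap (algMul k d e) (fun _ => LinearMap.id) n ∘ₗ
        indProdAssoc (algA k d) (algA k e) P n
      = nearAt k hβ n ∘ₗ identCons k d (e :: α) n ∘ₗ indProdMap (fun _ => LinearMap.id)
        (fun q => identCons k e α q ∘ₗ indProdMap (fun _ => LinearMap.id) I q) n := by
  refine indProd_hom_ext fun p q h x w => ?_
  simp only [LinearMap.comp_apply]
  induction w using tower_induction with
  | hadd z w hz hw => simp only [map_add, hz, hw]
  | hmk q₁ q₂ hq c y z =>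
    -- Equivariance with `1` acting on the first argument moves the inner coefficient `c` in front.
    have e2 := juxtaBi_smul k d (e :: α) h 1 c x (juxtaBi k e α hq y (I q₂ z))
    rw [one_smul, map_one, one_mul] at e2
    rw [indProdAssoc_mk, map_smul, map_smul, map_smul, indProdMap_mk, indProdMap_mk, identCons_mk,
      algMul_mk, indProdMap_mk, identCons_mk, LinearMap.comp_apply, map_smul, map_smul,
      indProdMap_mk, identCons_mk]
    simp only [LinearMap.id_apply]
    rw [e2, map_smul, juxtaBi_nearSum hβ _ rfl h hq]
  | h0 => simp only [map_zero]

theorem identCons_indProdMap {d e i : ℕ} {α β : List ℕ} (hβ : MergesTo i (e :: α) β)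
    (hβ' : MergesTo (i + 1) (d :: e :: α) (d :: β)) {P P' : TowerMod k}
    (I : TowerHom P (seqSum k (e :: α))) (I' : TowerHom P' (seqSum k β)) (m : TowerHom P P')
    (hm : ∀ q w, I' q (m q w) = nearAt k hβ q (I q w)) (n : ℕ) :
    identCons k d β n ∘ₗ indProdMap (fun _ => LinearMap.id) I' n ∘ₗ
        indProdMap (fun _ => LinearMap.id) m n
      = nearAt k hβ' n ∘ₗ identCons k d (e :: α) n ∘ₗ
        indProdMap (fun _ => LinearMap.id) I n := by
  refine indProd_hom_ext fun p q h x w => ?_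
  simp only [LinearMap.comp_apply]
  rw [indProdMap_mk, indProdMap_mk, indProdMap_mk, identCons_mk, identCons_mk, hm,
    juxtaBi_nearAt hβ hβ']
  rfl

/-- Under the canonical identifications, the multiplication of two neighbouring factors is the gluing
of two neighbouring components. -/
theorem ident_mergeMap (d : ℕ) (α : List ℕ) (i : ℕ) (hi : i < α.length) (n : ℕ)
    (x : (algPow k d α).X n) :
    ident k (mergeAt d α i).1 (mergeAt d α i).2 n (mergeMap k d α i n x)
      = nearAt k (mergesTo_mergeAt d α i) n (ident k d α n x) := by
  induction α generalizing d i n with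
  | nil => simp at hi
  | cons e α ih =>
    cases i with
    | zero =>
      cases α with
      -- With two factors in all, merging leaves a single `A_{d+e}`, whose identification is
      -- `identOne` instead of a further juxtaposition.
      | nil => exact identOne_nearSum (mergesTo_mergeAt d [e] 0) n _
      | cons f α =>
        exact LinearMap.congr_fun (identCons_algMul (mergesTo_mergeAt d (e :: f :: α) 0)
          (ident k f α) n) x
    | succ i =>
      cases α with
      | nil => simp at hi
      | cons f α =>
        exact LinearMap.congr_fun (identCons_indProdMap (mergesTo_mergeAt e (f :: α) i)
          (mergesTo_mergeAt d (e :: f :: α) (i + 1)) (ident k e (f :: α)) (ident k _ _)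
          (mergeMap k e (f :: α) i) (fun q w => ih e i (by simpa using hi) q w) n) x

end Compatibility

/-! ## The commas of a sequence of compositions -/

section Commas

/-- Three words agree except for the step out of the last cell of `γ`: `diag` if a new component
follows, `right` after near-concatenation, `up` after concatenation. -/
theorem Comp.exists_steps_eq {γ : Comp} (hγ : γ ≠ []) :
    ∃ b : List Step, γ.steps = b ++ [Step.diag] ∧ γ.gluedSteps = b ++ [Step.right] ∧
      ∀ δ : Comp, δ ≠ [] → Comp.steps (γ ++ δ) = b ++ Step.up :: δ.steps := by
  induction γ with
  | nil => exact absurd rfl hγ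
  | cons a γ ih =>
    by_cases h : γ = []
    · subst h
      refine ⟨List.replicate ((a : ℕ) - 1) Step.right, by simp [Comp.steps],
        by simp [Comp.gluedSteps], fun δ hδ => ?_⟩
      rw [List.cons_append, List.nil_append, Comp.steps, if_neg hδ]
    · obtain ⟨b, h1, h2, h3⟩ := ih h
      refine ⟨List.replicate ((a : ℕ) - 1) Step.right ++ Step.up :: b, ?_, ?_, fun δ hδ => ?_⟩
      · rw [Comp.steps, if_neg h, h1]; simp
      · rw [Comp.gluedSteps, if_neg h, h2]; simp
      · rw [List.cons_append, Comp.steps, if_neg (by simp [h]), h3 δ hδ]; simp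

theorem flatten_ne_nil {L : List Comp} (hL : L ≠ []) (h : ∀ γ ∈ L, γ ≠ []) : L.flatten ≠ [] := by
  obtain ⟨γ, L, rfl⟩ := List.exists_cons_of_ne_nil hL
  rw [List.flatten_cons]
  simp [h γ]

/-- The cells after which the commas of `L` stand: there the generalized ribbon has a step `diag`, the
ribbon of the concatenation has a step `up`, and gluing at the comma produces a step `right`. -/
theorem exists_commaPos (L : List Comp) (hL : ∀ γ ∈ L, γ ≠ []) :
    ∃ pos : ℕ → ℕ,
      (∀ i, i + 1 < L.length → pos i + 1 < (L.map Comp.size).sum ∧ shape L (pos i) = Step.diag ∧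
        shape [L.flatten] (pos i) = Step.up ∧ shape (mergeComp L i) (pos i) = Step.right ∧
        ∀ c, c ≠ pos i → shape (mergeComp L i) c = shape L c) ∧
      ∀ c, shape [L.flatten] c = shape L c ∨ ∃ i, i + 1 < L.length ∧ c = pos i := by
  induction L with
  | nil => exact ⟨id, by simp, fun c => Or.inl (by simp [shape, Comp.steps])⟩
  | cons γ L ih =>
    cases L with
    | nil => exact ⟨id, by simp, fun c => Or.inl (by simp)⟩
    | cons δ L =>
      obtain ⟨pos, h1, h2⟩ := ih fun ε hε => hL ε (List.mem_cons_of_mem _ hε)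
      have hδ : δ ≠ [] := hL δ (by simp)
      have hfl : (δ :: L).flatten ≠ [] :=
        flatten_ne_nil (by simp) fun ε hε => hL ε (List.mem_cons_of_mem _ hε)
      obtain ⟨b, b1, b2, b3⟩ := Comp.exists_steps_eq (hL γ (by simp))
      have hsize : γ.size = b.length + 1 := by rw [← Comp.length_steps, b1]; simp
      have hδs : 0 < δ.size := by
        obtain ⟨b', b1', -, -⟩ := Comp.exists_steps_eq hδ
        rw [← Comp.length_steps, b1']; simp
      have e0 : ∀ M : List Comp, (γ :: M).flatMap Comp.steps
          = b ++ Step.diag :: M.flatMap Comp.steps := fun M => by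
        rw [List.flatMap_cons, b1]; simp
      have e1 : (mergeComp (γ :: δ :: L) 0).flatMap Comp.steps
          = b ++ Step.right :: (δ :: L).flatMap Comp.steps := by
        rw [mergeComp, List.flatMap_cons, Comp.steps_near _ _ hδ, b2]; simp
      have e2 : [(γ :: δ :: L).flatten].flatMap Comp.steps
          = b ++ Step.up :: [(δ :: L).flatten].flatMap Comp.steps := by
        rw [List.flatMap_singleton, List.flatten_cons, b3 _ hfl, List.flatMap_singleton]
      -- All the words have the form `b`, one letter at the first comma, and a tail; this reads off
      -- their letters in the three ranges.
      have g : ∀ (s : Step) (t : List Step) (c : ℕ), (b ++ s :: t).getD c Step.diag =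
          if c < b.length then b.getD c Step.diag else if c = b.length then s
          else t.getD (c - (b.length + 1)) Step.diag := by
        intro s t c
        split_ifs with hc hc'
        · exact List.getD_append _ _ _ _ hc
        · subst hc'
          rw [List.getD_append_right _ _ _ _ le_rfl]; simp
        · rw [List.getD_append_right _ _ _ _ (not_lt.mp hc),
            show c - b.length = c - (b.length + 1) + 1 by omega, List.getD_cons_succ]
      -- The first comma follows the last cell of `γ`, which has index `b.length`; the commas of the
      -- tail are shifted by the size `b.length + 1` of `γ`.
      refine ⟨fun i => Nat.casesOn i b.length fun i => b.length + 1 + pos i, fun i hi => ?_,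
        fun c => ?_⟩
      · cases i with
        | zero =>
          refine ⟨?_, ?_, ?_, ?_, fun c hc => ?_⟩
          · simp only [List.map_cons, List.sum_cons]
            change b.length + 1 < _
            omega
          · rw [shape, e0, g]; simp
          · rw [shape, e2, g]; simp
          · rw [shape, e1, g]; simp
          · change c ≠ b.length at hc
            rw [shape, shape, e0, e1, g, g, if_neg hc, if_neg hc]
        | succ i =>
          obtain ⟨p1, p2, p3, p4, p5⟩ := h1 i (by simpa using hi)
          have hn : ¬ b.length + 1 + pos i < b.length := by omega
          have hn' : ¬ b.length + 1 + pos i = b.length := by omega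
          have hs : b.length + 1 + pos i - (b.length + 1) = pos i := by omega
          refine ⟨?_, ?_, ?_, ?_, fun c hc => ?_⟩
          · rw [List.map_cons, List.sum_cons, hsize]
            simp only
            omega
          · simp only
            rw [shape, e0, g, if_neg hn, if_neg hn', hs]; exact p2
          · simp only
            rw [shape, e2, g, if_neg hn, if_neg hn', hs]; exact p3
          · simp only
            rw [shape, mergeComp, e0, g, if_neg hn, if_neg hn', hs]; exact p4
          · simp only at hc
            rw [shape, shape, mergeComp, e0, e0, g, g]
            split_ifs with hc1 hc2
            · rfl
            · rfl
            · exact p5 _ (by omega)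
      · rw [shape, shape, e0, e2, g, g]
        rcases lt_trichotomy c b.length with hc | hc | hc
        · rw [if_pos hc, if_pos hc]; exact Or.inl rfl
        · exact Or.inr ⟨0, by simp, hc⟩
        · rw [if_neg hc.not_gt, if_neg hc.ne', if_neg hc.not_gt, if_neg hc.ne']
          rcases h2 (c - (b.length + 1)) with h | ⟨i, hi, h⟩
          · exact Or.inl h
          · refine Or.inr ⟨i + 1, by simpa using hi, ?_⟩
            simp only
            omega

theorem isUpGluing_flatten (L : List Comp) (hL : ∀ γ ∈ L, γ ≠ []) (N : ℕ) :
    IsUpGluing N (shape L) (shape [L.flatten]) := by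
  intro c _
  obtain ⟨pos, h1, h2⟩ := exists_commaPos L hL
  rcases h2 c with h | ⟨i, hi, rfl⟩
  · exact Or.inl h
  · exact Or.inr ⟨(h1 i hi).2.1, (h1 i hi).2.2.1⟩

/-- At each comma the two neighbouring entries either decrease or increase. The concatenation
requires a decrease at every comma, while a merger at comma `i` adds just the requirement of an
increase there. -/
theorem isStd_flatten_iff {L : List Comp} (hL : ∀ γ ∈ L, γ ≠ []) {N : ℕ}
    (hN : (L.map Comp.size).sum = N) {T : Equiv.Perm (Fin N)} (hT : IsStd (shape L) T) :
    IsStd (shape [L.flatten]) T ↔ ∀ i, i + 1 < L.length → ¬ IsStd (shape (mergeComp L i)) T := by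
  obtain ⟨pos, h1, h2⟩ := exists_commaPos L hL
  rw [hN] at h1
  constructor
  · intro hS i hi hS'
    obtain ⟨p1, -, p3, p4, -⟩ := h1 i hi
    exact ((hS _ p1).2 p3).not_gt ((hS' _ p1).1 p4)
  · intro h c hc
    rcases h2 c with e | ⟨i, hi, rfl⟩
    · rw [e]; exact hT c hc
    · obtain ⟨p1, -, p3, p4, p5⟩ := h1 i hi
      rw [p3]
      refine ⟨fun e => (nomatch e), fun _ => ?_⟩
      by_contra hlt
      refine h i hi fun d hd => ?_
      by_cases hdp : d = pos i
      · subst hdp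
        rw [p4]
        refine ⟨fun _ => lt_of_le_of_ne (not_lt.mp hlt) fun he => ?_, fun e => (nomatch e)⟩
        have := congrArg Fin.val (T.injective he)
        simp at this
      · rw [p5 d hdp]; exact hT d hd

/-- The number of columns of `γ` tells where the row formed by gluing has to be cut. All
compositions must be nonempty, since the cut is not visible otherwise. -/
theorem Comp.near_injective {a : ℕ} {γ γ' δ δ' : Comp} (hγ : γ ≠ []) (hγ' : γ' ≠ [])
    (hδ : δ ≠ []) (hδ' : δ' ≠ []) (hc : γ.numCols = a) (hc' : γ'.numCols = a)
    (h : Comp.near γ δ = Comp.near γ' δ') : γ = γ' ∧ δ = δ' := by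
  have hpos : ∀ (x : ℕ+) (ε : Comp), 0 < Comp.numCols (x :: ε) := by
    intro x ε
    induction ε generalizing x with
    | nil => exact x.pos
    | cons y ε ih => rw [Comp.numCols]; have := ih y; omega
  obtain ⟨u, δ, rfl⟩ := List.exists_cons_of_ne_nil hδ
  obtain ⟨v, δ', rfl⟩ := List.exists_cons_of_ne_nil hδ'
  -- If one ribbon is a single row `x` and the other has several rows with the same number of
  -- columns, the first row `x'` of the latter is at most `x`, so it cannot equal a row that results
  -- from lengthening `x`.
  have key : ∀ (m : ℕ) (x x' y' : ℕ+) (ε' : Comp), Comp.numCols [x] = m →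
      Comp.numCols (x' :: y' :: ε') = m → x' ≠ x + u ∧ x' ≠ x + v := by
    intro m x x' y' ε' h1 h2
    have h3 := hpos y' ε'
    change (x : ℕ) = m at h1
    change ((x' : ℕ) - 1) + Comp.numCols (y' :: ε') = m at h2
    have hu := u.pos
    have hv := v.pos
    refine ⟨fun e => ?_, fun e => ?_⟩ <;> rw [← PNat.coe_inj, PNat.add_coe] at e <;> omega
  induction γ generalizing a γ' with
  | nil => exact absurd rfl hγ
  | cons x γ ih =>
    obtain ⟨x', γ', rfl⟩ := List.exists_cons_of_ne_nil hγ'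
    match γ, γ' with
    | [], [] =>
      obtain rfl : x = x' := PNat.coe_inj.mp (hc.trans hc'.symm)
      simp only [Comp.near, List.cons.injEq, add_right_inj] at h
      obtain ⟨rfl, rfl⟩ := h
      exact ⟨rfl, rfl⟩
    | [], y' :: ε' =>
      simp only [Comp.near, List.cons.injEq] at h
      exact absurd h.1.symm (key a x x' y' ε' hc hc').1
    | y :: ε, [] =>
      simp only [Comp.near, List.cons.injEq] at h
      exact absurd h.1 (key a x' x y ε hc' hc).2
    | y :: ε, y' :: ε' =>
      simp only [Comp.near, List.cons.injEq] at h
      obtain ⟨rfl, h⟩ := h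
      rw [Comp.numCols] at hc hc'
      obtain ⟨h1, h2⟩ := ih (a := Comp.numCols (y :: ε)) (γ' := y' :: ε') (by simp) (by simp) rfl
        (by omega) h
      exact ⟨by rw [h1], h2⟩

/-- Only the merged entry needs an argument, and there the column count of its left part decides.
Consequently different summands `P_L` are sent to different summands of the target. -/
theorem mergeComp_injective {L L' : List Comp} (hL : ∀ γ ∈ L, γ ≠ []) (hL' : ∀ γ ∈ L', γ ≠ [])
    (hc : L.map Comp.numCols = L'.map Comp.numCols) {i : ℕ}
    (h : mergeComp L i = mergeComp L' i) : L = L' := by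
  induction L generalizing L' i with
  | nil => exact (List.map_eq_nil_iff.mp hc.symm).symm
  | cons γ L ih =>
    obtain _ | ⟨γ', L'⟩ := L'
    · simp at hc
    rw [List.map_cons, List.map_cons, List.cons.injEq] at hc
    match L, L', i with
    | [], [], i => simpa [mergeComp] using h
    | [], δ' :: L', i => simp at hc
    | δ :: L, [], i => simp at hc
    | δ :: L, δ' :: L', 0 =>
      simp only [mergeComp, List.cons.injEq] at h
      obtain ⟨rfl, rfl⟩ := Comp.near_injective (hL γ (by simp)) (hL' γ' (by simp))
        (hL δ (by simp)) (hL' δ' (by simp)) rfl hc.1.symm h.1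
      rw [h.2]
    | δ :: L, δ' :: L', i + 1 =>
      simp only [mergeComp, List.cons.injEq] at h
      rw [h.1, ih (fun ε hε => hL ε (List.mem_cons_of_mem _ hε))
        (fun ε hε => hL' ε (List.mem_cons_of_mem _ hε)) hc.2 h.2]

theorem glueAt_eq_self {I : Finset ℕ} {i : ℕ} (hI : ∀ j ∈ I, j < i) (L : List Comp) :
    glueAt I i L = L := by
  induction L generalizing i with
  | nil => rfl
  | cons γ L ih =>
    rw [glueAt, ih fun j hj => (hI j hj).trans (Nat.lt_succ_self i)]
    cases L with
    | nil => rfl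
    | cons δ L => exact if_neg fun h => lt_irrefl _ (hI i h)

/-- This matches the terms of the complex in degree one with the mergers of two neighbours. The
index `j` of the first comma is kept free for the induction on the tail. -/
theorem glueAt_singleton (L : List Comp) (i j : ℕ) : glueAt {j + i} j L = mergeComp L i := by
  induction L generalizing i j with
  | nil => rfl
  | cons γ L ih =>
    match L, i with
    | [], i => rfl
    | δ :: L, 0 =>
      rw [glueAt, glueAt_eq_self (by simp)]
      simp [mergeComp]
    | δ :: L, i + 1 =>
      have h := ih i (j + 1)
      rw [show j + 1 + i = j + (i + 1) by omega] at h
      rw [glueAt, h, mergeComp]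
      have hne : mergeComp (δ :: L) i ≠ [] := by
        intro e
        have := congrArg List.length (congrArg (List.map Comp.numCols) e)
        rw [map_numCols_mergeComp rfl] at this
        simp at this
      obtain ⟨ε, M, hM⟩ := List.exists_cons_of_ne_nil hne
      rw [hM]
      exact if_neg (by simp)

end Commas

/-! ## The cohomology in degree zero and the ribbon Schur modules -/

section Cohomology

variable {k : Type u} [Field k]

theorem ribbonZero_apply (N : ℕ) (L : List Comp) (x : ribbonMod k N L) (h h') :
    ribbonZero k N L x = DirectSum.lof (Hecke k N) (CommaSet L 0)
      (fun I => ribbonMod k N (glueAt I.1 0 L)) ⟨∅, h⟩ (glueMap k h' x) := rfl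

/-- The sequences `glueAt ∅ 0 L` and `L` are equal by a theorem only, so the two maps live between
different types; comparing the coefficients of tableaux avoids transport between them. -/
theorem glueAtMap_glueMap_eq_zero_iff {N : ℕ} {L : List Comp} (i : ℕ)
    (h : IsGluing N (shape L) (shape (glueAt ∅ 0 L))) (x : ribbonMod k N L) :
    glueAtMap k N L (Finset.subset_insert i ∅) (glueMap k h x) = 0 ↔
      glueMap k (isGluing_mergeComp N L i) x = 0 := by
  rw [glueAtMap, glueMap_eq_zero_iff, glueMap_eq_zero_iff]
  have e : glueAt (insert i ∅) 0 L = mergeComp L i := by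
    have := glueAt_singleton L i 0
    rwa [Nat.zero_add] at this
  rw [e]
  refine forall₂_congr fun T hT => ?_
  rw [tabCoeff_glueMap h]
  rw [glueAt_empty]
  exact (isGluing_mergeComp N L i).isStd hT

/-- In degree zero all signs are `+1`, and the gluings at different commas take values in different
summands, so the differential vanishes only if each gluing does. -/
theorem mem_ribbonH0_iff {N : ℕ} {L : List Comp} (x : ribbonMod k N L) :
    x ∈ ribbonH0 k N L ↔ ∀ i, i + 1 < L.length → glueMap k (isGluing_mergeComp N L i) x = 0 := by
  have h0 : IsGluing N (shape L) (shape (glueAt ∅ 0 L)) := fun _ _ => Or.inl (by rw [glueAt_empty])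
  rw [ribbonH0, Submodule.mem_comap, LinearMap.mem_ker,
    ribbonZero_apply N L x ⟨Finset.empty_subset _, Finset.card_empty⟩ h0, ribbonDiff,
    DirectSum.toModule_lof, LinearMap.sum_apply]
  simp only [LinearMap.comp_apply, Finset.filter_empty, Finset.card_empty,
    pow_zero, one_smul]
  constructor
  · intro h i hi
    have hm : i ∈ Finset.range (L.length - 1) \ ∅ := by simp; omega
    -- Project to the summand of the set `{i}`; the terms of the other commas have no component
    -- there.
    have hc := congrArg (fun z => DirectSum.component (Hecke k N) (CommaSet L 1)
      (fun I => ribbonMod k N (glueAt I.1 0 L)) ⟨insert i ∅, by simp; omega, by simp⟩ z) h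
    simp only [map_sum, map_zero] at hc
    rw [Finset.sum_eq_single ⟨i, hm⟩] at hc
    · rw [DirectSum.component.lof_self] at hc
      exact (glueAtMap_glueMap_eq_zero_iff i h0 x).mp hc
    · intro j _ hj
      rw [DirectSum.component.of, dif_neg]
      intro e
      have := congrArg Subtype.val e
      simp only [insert_empty_eq, Finset.singleton_inj] at this
      exact hj (Subtype.ext this)
    · simp
  · intro h
    refine Finset.sum_eq_zero fun j _ => ?_
    have hj := j.2
    rw [Finset.mem_sdiff, Finset.mem_range] at hj
    rw [(glueAtMap_glueMap_eq_zero_iff j.1 h0 x).mpr (h j.1 (by omega)), map_zero]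

/-- Both conditions say that the coefficients of certain tableaux vanish: those not standard for the
concatenation, and those standard after some merger. By `isStd_flatten_iff` these are the same
tableaux. -/
theorem mem_range_upIncl_flatten {N : ℕ} {L : List Comp} (hL : ∀ γ ∈ L, γ ≠ [])
    (hN : (L.map Comp.size).sum = N) (x : ribbonMod k N L) :
    x ∈ LinearMap.range (upIncl k (isUpGluing_flatten L hL N)) ↔
      ∀ i, i + 1 < L.length → glueMap k (isGluing_mergeComp N L i) x = 0 := by
  rw [mem_range_upIncl]
  constructor
  · intro h i hi
    rw [glueMap_eq_zero_iff]
    intro T hT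
    have hT' := (isGluing_mergeComp N L i).isStd hT
    exact h T hT' fun hS => (isStd_flatten_iff hL hN hT').mp hS i hi hT
  · intro h T hT hT'
    rw [isStd_flatten_iff hL hN hT] at hT'
    push Not at hT'
    obtain ⟨i, hi, hS⟩ := hT'
    exact (glueMap_eq_zero_iff _ x).mp (h i hi) T hS

theorem range_upIncl_flatten {N : ℕ} {L : List Comp} (hL : ∀ γ ∈ L, γ ≠ [])
    (hN : (L.map Comp.size).sum = N) :
    LinearMap.range (upIncl k (isUpGluing_flatten L hL N)) = ribbonH0 k N L := by
  ext x
  rw [mem_range_upIncl_flatten hL hN, mem_ribbonH0_iff]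

/-- The empty composition has no columns, so positive column numbers exclude it. Next to an empty
composition a comma would not separate two cells. -/
theorem SeqIdx.ne_nil {α : List ℕ} (hα : ∀ d ∈ α, 0 < d) {N : ℕ} (L : SeqIdx α N) :
    ∀ γ ∈ L.1, γ ≠ [] := by
  rintro γ hγ rfl
  have h : Comp.numCols [] ∈ α := L.2.1 ▸ List.mem_map_of_mem hγ
  exact lt_irrefl _ (hα _ h)

/-- The inclusion of the sum of the ribbon modules of the concatenations into the sum of the
generalized ribbon modules. -/
def flattenIncl (k : Type u) [Field k] {α : List ℕ} (hα : ∀ d ∈ α, 0 < d) (N : ℕ) :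
    (⨁ γ : SeqIdx α N, ribbonMod k N [γ.1.flatten]) →ₗ[Hecke k N] (seqSum k α).X N :=
  DirectSum.toModule (Hecke k N) (SeqIdx α N) _ fun γ =>
    seqSumOf k γ ∘ₗ upIncl k (isUpGluing_flatten γ.1 (γ.ne_nil hα) N)

theorem flattenIncl_lof {α : List ℕ} (hα : ∀ d ∈ α, 0 < d) {N : ℕ} (γ : SeqIdx α N)
    (x : ribbonMod k N [γ.1.flatten]) :
    flattenIncl k hα N (DirectSum.lof (Hecke k N) (SeqIdx α N)
      (fun γ => ribbonMod k N [γ.1.flatten]) γ x)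
      = seqSumOf k γ (upIncl k (isUpGluing_flatten γ.1 (γ.ne_nil hα) N) x) :=
  DirectSum.toModule_lof (Hecke k N) (ι := SeqIdx α N) (M := fun γ => ribbonMod k N [γ.1.flatten])
    γ x

theorem flattenIncl_injective {α : List ℕ} (hα : ∀ d ∈ α, 0 < d) (N : ℕ) :
    Function.Injective (flattenIncl k hα N) :=
  directSum_map_injective (R := Hecke k N) (φ := id) (M' := fun L : SeqIdx α N => ribbonMod k N L.1)
    (f := fun γ => upIncl k (isUpGluing_flatten γ.1 (γ.ne_nil hα) N))
    (F := flattenIncl k hα N) Function.injective_id (fun γ x => flattenIncl_lof hα γ x)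
    fun _ => upIncl_injective _

/-- The coordinate of an element of the sum of the generalized ribbon modules. -/
def seqSumCoord {α : List ℕ} {N : ℕ} (x : (seqSum k α).X N) (L : SeqIdx α N) : ribbonMod k N L.1 :=
  (show ⨁ L : SeqIdx α N, ribbonMod k N L.1 from x) L

theorem mem_range_flattenIncl {α : List ℕ} (hα : ∀ d ∈ α, 0 < d) {N : ℕ} (x : (seqSum k α).X N) :
    x ∈ LinearMap.range (flattenIncl k hα N) ↔ ∀ (L : SeqIdx α N) (i : ℕ), i + 1 < L.1.length →
      glueMap k (isGluing_mergeComp N L.1 i) (seqSumCoord x L) = 0 := by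
  constructor
  · rintro ⟨y, rfl⟩ L i hi
    have h : seqSumCoord (flattenIncl k hα N y) L
        = upIncl k (isUpGluing_flatten L.1 (L.ne_nil hα) N) (y L) :=
      directSum_map_apply (R := Hecke k N) (φ := id)
        (M' := fun L : SeqIdx α N => ribbonMod k N L.1)
        (f := fun γ => upIncl k (isUpGluing_flatten γ.1 (γ.ne_nil hα) N))
        (F := flattenIncl k hα N) Function.injective_id (fun γ x => flattenIncl_lof hα γ x) y L
    rw [h]
    exact (mem_range_upIncl_flatten (L.ne_nil hα) L.2.2 _).mp ⟨_, rfl⟩ i hi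
  · intro h
    classical
    have hx : x = ∑ L ∈ DFinsupp.support (show Π₀ L : SeqIdx α N, ribbonMod k N L.1 from x),
        seqSumOf k L (seqSumCoord x L) :=
      (DirectSum.sum_support_of (show ⨁ L : SeqIdx α N, ribbonMod k N L.1 from x)).symm
    rw [hx]
    refine Submodule.sum_mem _ fun L _ => ?_
    obtain ⟨y, hy⟩ := (mem_range_upIncl_flatten (k := k) (L.ne_nil hα) L.2.2
      (seqSumCoord x L)).mpr (h L)
    exact ⟨_, (flattenIncl_lof hα L y).trans (congrArg _ hy)⟩

/-- Injectivity of merging on sequences with prescribed column numbers rules out cancellation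
between different summands. -/
theorem nearAt_eq_zero_iff {i : ℕ} {α β : List ℕ} (hα : ∀ d ∈ α, 0 < d) (hβ : MergesTo i α β)
    {N : ℕ} (x : (seqSum k α).X N) :
    nearAt k hβ N x = 0 ↔
      ∀ L : SeqIdx α N, glueMap k (isGluing_mergeComp N L.1 i) (seqSumCoord x L) = 0 := by
  refine directSum_map_eq_zero_iff (R := Hecke k N) (φ := SeqIdx.merge hβ)
    (M := fun L : SeqIdx α N => ribbonMod k N L.1) (M' := fun L : SeqIdx β N => ribbonMod k N L.1)
    (f := fun L => glueMap k (isGluing_mergeComp N L.1 i))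
    (F := nearAt k hβ N) (fun L L' h => ?_) (fun L y => nearAt_of hβ L y) x
  exact Subtype.ext (mergeComp_injective (L.ne_nil hα) (L'.ne_nil hα) (L.2.1.trans L'.2.1.symm)
    (congrArg Subtype.val h))

/-- Each multiplication map is carried to a gluing map by `ident`, which is also injective on the
target. Vanishing of all of them is then the condition describing the image of the concatenated
ribbons, summand by summand. -/
theorem mem_ribbonSchur_iff {d : ℕ} {α : List ℕ} (hα : ∀ e ∈ d :: α, 0 < e) {N : ℕ}
    (x : (algPow k d α).X N) :
    x ∈ ribbonSchur k d α N ↔ ident k d α N x ∈ LinearMap.range (flattenIncl k hα N) := by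
  rw [ribbonSchur, LinearMap.mem_ker, mem_range_flattenIncl, funext_iff]
  have hlen : ∀ L : SeqIdx (d :: α) N, L.1.length = α.length + 1 := fun L => by
    have := congrArg List.length L.2.1
    simpa using this
  have key : ∀ i, i < α.length → (mergeMap k d α i N x = 0 ↔ ∀ L : SeqIdx (d :: α) N,
      glueMap k (isGluing_mergeComp N L.1 i) (seqSumCoord (ident k d α N x) L) = 0) := by
    intro i hi
    rw [← nearAt_eq_zero_iff hα (mergesTo_mergeAt d α i), ← ident_mergeMap d α i hi N x]
    exact (map_eq_zero_iff _ (ident_bijective _ _ N).1).symm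
  constructor
  · intro h L i hi
    rw [hlen L] at hi
    exact (key i (by omega)).mp (h ⟨i, by omega⟩) L
  · intro h i
    exact (key i.1 i.2).mpr fun L => h L i.1 (by rw [hlen L]; omega)

end Cohomology

end

end ZeroHecke

/-! ### The proposition -/

theorem mainTheorem9 (k : Type*) [Field k] (α₁ : ℕ) (α : List ℕ)
    (hα : ∀ d ∈ α₁ :: α, 0 < d) (N : ℕ) :
    -- all modules in question are projective
    Module.Projective (ZeroHecke.Hecke k N) (ZeroHecke.ribbonSchur k α₁ α N) ∧
    (∀ γ : ZeroHecke.SeqIdx (α₁ :: α) N,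
      Module.Projective (ZeroHecke.Hecke k N) (ZeroHecke.ribbonMod k N [γ.1.flatten])) ∧
    -- the canonical map from the induction product to the sum of the generalized ribbon modules
    -- is an isomorphism
    Function.Bijective (ZeroHecke.ident k α₁ α N) ∧
    -- the decomposition; under the above identification its summands are the `H⁰` of the complexes
    ∃ e : (DirectSum (ZeroHecke.SeqIdx (α₁ :: α) N)
          (fun γ => ZeroHecke.ribbonMod k N [γ.1.flatten])) ≃ₗ[ZeroHecke.Hecke k N]
        ZeroHecke.ribbonSchur k α₁ α N,
      ∀ γ : ZeroHecke.SeqIdx (α₁ :: α) N,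
        LinearMap.range
          (ZeroHecke.ident k α₁ α N ∘ₗ (ZeroHecke.ribbonSchur k α₁ α N).subtype ∘ₗ
            e.toLinearMap ∘ₗ
            DirectSum.lof (ZeroHecke.Hecke k N) (ZeroHecke.SeqIdx (α₁ :: α) N)
              (fun γ => ZeroHecke.ribbonMod k N [γ.1.flatten]) γ)
        = (ZeroHecke.ribbonH0 k N γ.1).map (ZeroHecke.seqSumOf k γ) := by
  have hproj : ∀ γ : ZeroHecke.SeqIdx (α₁ :: α) N,
      Module.Projective (ZeroHecke.Hecke k N) (ZeroHecke.ribbonMod k N [γ.1.flatten]) :=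
    fun γ => ZeroHecke.tabMod_projective k N _
  have hbij := ZeroHecke.ident_bijective (k := k) α₁ α N
  let I := LinearEquiv.ofBijective (ZeroHecke.ident k α₁ α N) hbij
  have hmap : (ZeroHecke.ribbonSchur k α₁ α N).map I.toLinearMap
      = LinearMap.range (ZeroHecke.flattenIncl k hα N) := by
    ext y
    constructor
    · rintro ⟨x, hx, rfl⟩
      exact (ZeroHecke.mem_ribbonSchur_iff hα x).mp hx
    · intro hy
      obtain ⟨x, rfl⟩ := hbij.2 y
      exact ⟨x, (ZeroHecke.mem_ribbonSchur_iff hα x).mpr hy, rfl⟩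
  -- The inclusion of the concatenated ribbons, viewed as an isomorphism onto its range, is carried
  -- back along the identification `I`; by `he`, following `e` with `ident` gives the inclusion
  -- again.
  let e := (LinearEquiv.ofInjective _ (ZeroHecke.flattenIncl_injective (k := k) hα N)).trans
    ((LinearEquiv.ofEq _ _ hmap.symm).trans (I.submoduleMap (ZeroHecke.ribbonSchur k α₁ α N)).symm)
  have he : ∀ z, ZeroHecke.ident k α₁ α N (e z).1 = ZeroHecke.flattenIncl k hα N z := by
    intro z
    have h := (I.submoduleMap (ZeroHecke.ribbonSchur k α₁ α N)).apply_symm_apply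
      (LinearEquiv.ofEq _ _ hmap.symm
        (LinearEquiv.ofInjective _ (ZeroHecke.flattenIncl_injective (k := k) hα N) z))
    exact congrArg Subtype.val h
  refine ⟨Module.Projective.of_equiv' e, hproj, hbij, e, fun γ => ?_⟩
  -- With `H⁰` rewritten as the range of `upIncl`, both sides are ranges of maps out of the same
  -- ribbon module, and the maps coincide.
  rw [← ZeroHecke.range_upIncl_flatten (γ.ne_nil hα) γ.2.2, ← LinearMap.range_comp]
  refine congrArg LinearMap.range (LinearMap.ext fun x => ?_)
  exact (he _).trans (ZeroHecke.flattenIncl_lof hα γ x)
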